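/- **Boundary Boltzmann weights $B_{8vSOS}$.** Let $0<q<1$, $\kappa\in\mathbb C$, write $q^x=e^{x\log q}$ and $$\theta(x;q)=\prod_{j\ge 0}(1-q^jx)(1-q^{j+1}/x),\qquad \theta(x_1,\dots,x_r;q)=\prod_{i=1}^r\theta(x_i;q).$$ *Face weights.* Put $$A_{Ba}(z,\xi)=\frac{\theta(q^{-z},q^{2\kappa+\xi};q)}{\theta(q^{2\kappa-z},q^{\xi};q)},\qquad B_{Ba}(z,\xi)=\frac{\theta(q^{-z-\xi},q^{2\kappa};q)}{\theta(q^{2\kappa-z},q^{-\xi};q)},\qquad u(\xi)=q^{-\kappa}\Bigl(\frac{\theta(q^{-\xi+2\kappa};q)}{\theta(q^{-\xi-2\kappa};q)}\Bigr)^{1/2},$$ with any choice of the square roots such that $u(\xi)u(-\xi)=1$ whenever $\theta(q^{\xi};q)$, $\theta(q^{\xi+2\kappa};q)$ and $\theta(q^{\xi-2\kappa};q)$ are nonzero. Let $v_+,v_-$ be the standard basis of $\mathbb C^2$ (with $v_{\pm1}=v_\pm$) and define, with respect to the ordered basis $(v_+\otimes v_+,v_+\otimes v_-,v_-\otimes v_+,v_-\otimes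 v_-)$, $$R_{8vSOS}(z,\xi)=q^{z/2}\frac{\theta(q^{2\kappa-z};q)}{\theta(q^{2\kappa};q)}\begin{pmatrix}1&0&0&0\\0&u(\xi)A_{Ba}(z,\xi)&B_{Ba}(z,\xi)&0\\0&B_{Ba}(z,-\xi)&u(-\xi)A_{Ba}(z,-\xi)&0\\0&0&0&1\end{pmatrix}.$$ Write $R^{\nu_1\nu_2}_{\mu_1\mu_2}(z,\xi)$ for the coefficient of $v_{\nu_1}\otimes v_{\nu_2}$ in $R_{8vSOS}(z,\xi)(v_{\mu_1}\otimes v_{\mu_2})$, set to $0$ unless all $\mu_i,\nu_i\in\{1,-1\}$. For $a,b,c,d\in\mathbb C$ let $$W_{8vSOS}\left(\begin{matrix}a&b\\c&d\end{matrix}\,\Big|\,z,\xi\right)=R^{d-c,\,c-a}_{b-a,\,d-b}(z,\xi-2\kappa a).$$ *Boundary weights.* Let $\zeta,\zeta',\upsilon,\upsilon'\in\mathbb C$, and put $$(a,b,c,d)=(q^{\zeta+\upsilon},-q^{\zeta-\upsilon},q^{\frac12+\zeta'+\upsilon'},-q^{\frac12+\zeta'-\upsilon'}),\qquad (\tilde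 a,\tilde b,\tilde c,\tilde d)=(q^{\zeta+\zeta'},-q^{\zeta-\zeta'},q^{\frac12+\upsilon+\upsilon'},-q^{\frac12+\upsilon-\upsilon'}),$$ $$\mathcal C(z,\xi)=\frac{\theta(\tilde aq^{\xi},\tilde bq^{\xi},\tilde cq^{\xi},dq^{\xi-z}/\tilde a;q)}{\theta(q^{2\xi},dq^{-z};q)}\,q^{-(\zeta+\upsilon-z)(\zeta+\zeta'-\xi)},$$ and let $\tilde{\mathcal C}(z,\xi)$ be $\mathcal C(z,\xi)$ with $\upsilon$ and $\zeta'$ interchanged. Set $$\alpha_{Ba}(z,\xi)=\frac{\mathcal C(z,\xi)-\tilde{\mathcal C}(\xi,z)}{\tilde{\mathcal C}(\xi,-z)}\,q^{2z\xi},\qquad \beta_{Ba}(z,\xi)=\frac{\mathcal C(z,\xi)}{\tilde{\mathcal C}(-\xi,-z)},\qquad K_{Ba}(z,\xi)=\begin{pmatrix}\alpha_{Ba}(z,\xi)&\beta_{Ba}(z,\xi)\\\beta_{Ba}(z,-\xi)&\alpha_{Ba}(z,-\xi)\end{pmatrix}$$ (in the basis $(v_+,v_-)$). Write $K^{\nu}_{\mu}(z,\xi)$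 for the coefficient of $v_\nu$ in $K_{Ba}(z,\xi)v_\mu$, set to $0$ unless $\mu,\nu\in\{1,-1\}$, and for heights $a,b,c\in\mathbb C$ let $$B_{8vSOS}\left(b\ \begin{matrix}c\\a\end{matrix}\,\Big|\,z,\xi\right)=K^{a-b}_{c-b}\bigl(z,\tfrac{\xi}{2}-\kappa b\bigr).$$ *Claim.* For every $(\zeta,\zeta',\upsilon,\upsilon')\in\mathbb C^4$, the weights $B=B_{8vSOS}$ solve the face boundary Yang–Baxter equations with respect to $W=W_{8vSOS}$: for all heights $a,b,c,d,e\in\mathbb C$, $$\begin{aligned}&\sum_{f,g}W\left(\begin{matrix}c&f\\d&e\end{matrix}\Big|z_1-z_2,\xi\right)B\left(f\ \begin{matrix}g\\e\end{matrix}\Big|z_1,\xi\right)W\left(\begin{matrix}c&b\\f&g\end{matrix}\Big|z_1+z_2,\xi\right)B\left(b\ \begin{matrix}a\\g\end{matrix}\Big|z_2,\xi\right)\\&=\sum_{f,g}B\left(d\ \begin{matrix}g\\e\end{matrix}\Big|z_2,\xi\right)W\left(\begin{matrix}c&f\\d&g\end{matrix}\Big|z_1+z_2,\xi\right)B\left(f\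 \begin{matrix}a\\g\end{matrix}\Big|z_1,\xi\right)W\left(\begin{matrix}c&b\\f&a\end{matrix}\Big|z_1-z_2,\xi\right),\end{aligned}$$ where $f,g$ run over $\mathbb C$ (only finitely many terms are nonzero). The equation holds at all $z_1,z_2,\xi\in\mathbb C$ for which the denominators in the above formulas for the entries of $R_{8vSOS}(z_1\pm z_2,\xi-2\kappa c)$ and of $K_{Ba}(z_i,\frac{\xi}{2}-\kappa f)$, $i=1,2$, $f=c\pm1$, are nonzero. -/

import Mathlib

noncomputable section

namespace FaceModel

/-! ### Theta functions and parameters -/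

/-- The renormalised Jacobi theta function `θ(x; q) = ∏_{j ≥ 0} (1 - q^j x)(1 - q^{j+1} / x)`. -/
def theta (q : ℝ) (x : ℂ) : ℂ :=
  ∏' j : ℕ, (1 - (q : ℂ) ^ j * x) * (1 - (q : ℂ) ^ (j + 1) / x)

/-- The four free boundary parameters `ζ, ζ', υ, υ'`. -/
structure BoundaryParams where
  zeta : ℂ
  zeta' : ℂ
  ups : ℂ
  ups' : ℂ

namespace BoundaryParams

/-- The duality involution: interchange `υ` and `ζ'`. -/
def dual (p : BoundaryParams) : BoundaryParams where
  zeta := p.zeta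
  zeta' := p.ups
  ups := p.zeta'
  ups' := p.ups'

/-! The Askey-Wilson parameters `a, b, c, d`; the dual ones are those of `p.dual`. -/

def a (q : ℝ) (p : BoundaryParams) : ℂ := (q : ℂ) ^ (p.zeta + p.ups)

def b (q : ℝ) (p : BoundaryParams) : ℂ := -(q : ℂ) ^ (p.zeta - p.ups)

def c (q : ℝ) (p : BoundaryParams) : ℂ := (q : ℂ) ^ (1 / 2 + p.zeta' + p.ups')

def d (q : ℝ) (p : BoundaryParams) : ℂ := -(q : ℂ) ^ (1 / 2 + p.zeta' - p.ups')

end BoundaryParams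

/-- The function `𝒞(z, ξ)`. -/
def calC (q : ℝ) (p : BoundaryParams) (z ξ : ℂ) : ℂ :=
  theta q (p.dual.a q * (q : ℂ) ^ ξ) * theta q (p.dual.b q * (q : ℂ) ^ ξ)
      * theta q (p.dual.c q * (q : ℂ) ^ ξ) * theta q (p.d q * (q : ℂ) ^ (ξ - z) / p.dual.a q)
    / (theta q ((q : ℂ) ^ (2 * ξ)) * theta q (p.d q * (q : ℂ) ^ (-z)))
    * (q : ℂ) ^ (-((p.zeta + p.ups - z) * (p.zeta + p.zeta' - ξ)))

/-- The function `𝒞̃(z, ξ)`, which is `𝒞(z, ξ)` with `υ` and `ζ'` interchanged. -/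
def calCDual (q : ℝ) (p : BoundaryParams) (z ξ : ℂ) : ℂ := calC q p.dual z ξ

/-- The denominators in the formula for `𝒞(z, ξ)` do not vanish. -/
def CalCDefined (q : ℝ) (p : BoundaryParams) (z ξ : ℂ) : Prop :=
  theta q ((q : ℂ) ^ (2 * ξ)) ≠ 0 ∧ theta q (p.d q * (q : ℂ) ^ (-z)) ≠ 0

/-! ### The dynamical `K`-matrix `K_Ba` -/

def alphaBa (q : ℝ) (p : BoundaryParams) (z ξ : ℂ) : ℂ :=
  (calC q p z ξ - calCDual q p ξ z) / calCDual q p ξ (-z) * (q : ℂ) ^ (2 * z * ξ)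

def betaBa (q : ℝ) (p : BoundaryParams) (z ξ : ℂ) : ℂ :=
  calC q p z ξ / calCDual q p (-ξ) (-z)

/-- `K_Ba(z, ξ)` as a matrix with respect to the ordered basis `(v₊, v₋)` of `ℂ²`. -/
def KBa (q : ℝ) (p : BoundaryParams) (z ξ : ℂ) : Matrix (Fin 2) (Fin 2) ℂ :=
  !![alphaBa q p z ξ, betaBa q p z ξ;
     betaBa q p z (-ξ), alphaBa q p z (-ξ)]

/-- All denominators in the formulas for the four entries of `K_Ba(z, ξ)` are nonzero. -/
structure KBaDefined (q : ℝ) (p : BoundaryParams) (z ξ : ℂ) : Prop where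
  num_pos : CalCDefined q p z ξ
  num_neg : CalCDefined q p z (-ξ)
  dual_pos : CalCDefined q p.dual ξ z
  dual_neg : CalCDefined q p.dual (-ξ) z
  den_pos : CalCDefined q p.dual ξ (-z)
  den_neg : CalCDefined q p.dual (-ξ) (-z)
  den_pos_ne : calCDual q p ξ (-z) ≠ 0
  den_neg_ne : calCDual q p (-ξ) (-z) ≠ 0

/-! ### The dynamical `R`-matrix `R_8vSOS` -/

def ABa (q : ℝ) (κ z ξ : ℂ) : ℂ :=
  theta q ((q : ℂ) ^ (-z)) * theta q ((q : ℂ) ^ (2 * κ + ξ))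
    / (theta q ((q : ℂ) ^ (2 * κ - z)) * theta q ((q : ℂ) ^ ξ))

def BBa (q : ℝ) (κ z ξ : ℂ) : ℂ :=
  theta q ((q : ℂ) ^ (-z - ξ)) * theta q ((q : ℂ) ^ (2 * κ))
    / (theta q ((q : ℂ) ^ (2 * κ - z)) * theta q ((q : ℂ) ^ (-ξ)))

/-- `u(ξ) = q^{-κ} (θ(q^{-ξ+2κ}; q) / θ(q^{-ξ-2κ}; q))^{1/2}`, for an arbitrary choice of the
square roots subject to the gauge condition `u(ξ) u(-ξ) = 1`. Both requirements are imposed only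
where the functions in question are defined. -/
structure IsSOSGauge (q : ℝ) (κ : ℂ) (u : ℂ → ℂ) : Prop where
  sq_eq : ∀ ξ : ℂ, theta q ((q : ℂ) ^ (-ξ - 2 * κ)) ≠ 0 →
    u ξ ^ 2 = ((q : ℂ) ^ (-κ)) ^ 2
      * (theta q ((q : ℂ) ^ (-ξ + 2 * κ)) / theta q ((q : ℂ) ^ (-ξ - 2 * κ)))
  mul_neg : ∀ ξ : ℂ, theta q ((q : ℂ) ^ ξ) ≠ 0 → theta q ((q : ℂ) ^ (ξ + 2 * κ)) ≠ 0 →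
    theta q ((q : ℂ) ^ (ξ - 2 * κ)) ≠ 0 → u ξ * u (-ξ) = 1

/-- `R_8vSOS(z, ξ)` as a matrix with respect to the ordered basis
`(v₊ ⊗ v₊, v₊ ⊗ v₋, v₋ ⊗ v₊, v₋ ⊗ v₋)` of `ℂ² ⊗ ℂ²`. -/
def R8vSOS (q : ℝ) (κ : ℂ) (u : ℂ → ℂ) (z ξ : ℂ) : Matrix (Fin 4) (Fin 4) ℂ :=
  ((q : ℂ) ^ (z / 2) * (theta q ((q : ℂ) ^ (2 * κ - z)) / theta q ((q : ℂ) ^ (2 * κ)))) •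
    !![1, 0, 0, 0;
       0, u ξ * ABa q κ z ξ, BBa q κ z ξ, 0;
       0, BBa q κ z (-ξ), u (-ξ) * ABa q κ z (-ξ), 0;
       0, 0, 0, 1]

/-- All denominators in the formulas for the entries of `R_8vSOS(z, ξ)` (including those inside
`u(ξ)` and `u(-ξ)`) are nonzero. -/
structure R8vSOSDefined (q : ℝ) (κ z ξ : ℂ) : Prop where
  kappa : theta q ((q : ℂ) ^ (2 * κ)) ≠ 0
  spectral : theta q ((q : ℂ) ^ (2 * κ - z)) ≠ 0
  pos : theta q ((q : ℂ) ^ ξ) ≠ 0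
  neg : theta q ((q : ℂ) ^ (-ξ)) ≠ 0
  u_pos : theta q ((q : ℂ) ^ (-ξ - 2 * κ)) ≠ 0
  u_neg : theta q ((q : ℂ) ^ (ξ - 2 * κ)) ≠ 0

/-! ### Boltzmann weights of the face model -/

open Classical in
/-- Position in `(v₊, v₋)` of the basis vector of weight `μ`; `none` unless `μ ∈ {1, -1}`. -/
def spinIndex (μ : ℂ) : Option (Fin 2) :=
  if μ = 1 then some 0 else if μ = -1 then some 1 else none

/-- Position in `(v₊ ⊗ v₊, v₊ ⊗ v₋, v₋ ⊗ v₊, v₋ ⊗ v₋)` of the basis vector of weight `(μ₁, μ₂)`;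
`none` unless both weights are in `{1, -1}`. -/
def tensorIndex (μ₁ μ₂ : ℂ) : Option (Fin 4) :=
  match spinIndex μ₁, spinIndex μ₂ with
  | some 0, some 0 => some 0
  | some 0, some 1 => some 1
  | some 1, some 0 => some 2
  | some 1, some 1 => some 3
  | _, _ => none

/-- The coefficient `K^ν_μ` in `K v_μ = ∑_ν K^ν_μ v_ν`, zero unless `μ, ν ∈ {1, -1}`. -/
def coeffK (K : Matrix (Fin 2) (Fin 2) ℂ) (ν μ : ℂ) : ℂ :=
  match spinIndex ν, spinIndex μ with
  | some i, some j => K i j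
  | _, _ => 0

/-- The coefficient `R^{ν₁ν₂}_{μ₁μ₂}` in
`R (v_{μ₁} ⊗ v_{μ₂}) = ∑ R^{ν₁ν₂}_{μ₁μ₂} v_{ν₁} ⊗ v_{ν₂}`, zero unless all four weights are in
`{1, -1}`. -/
def coeffR (R : Matrix (Fin 4) (Fin 4) ℂ) (ν₁ ν₂ μ₁ μ₂ : ℂ) : ℂ :=
  match tensorIndex ν₁ ν₂, tensorIndex μ₁ μ₂ with
  | some i, some j => R i j
  | _, _ => 0

/-- The Boltzmann weight `W (a b; c d | z, ξ) = R^{d-c, c-a}_{b-a, d-b}(z, ξ - 2κa)` of a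
dynamical matrix `R(z, ξ)`, for heights `a, b, c, d ∈ ℂ`. -/
def faceWeight (κ : ℂ) (R : ℂ → ℂ → Matrix (Fin 4) (Fin 4) ℂ) (a b c d z ξ : ℂ) : ℂ :=
  coeffR (R z (ξ - 2 * κ * a)) (d - c) (c - a) (b - a) (d - b)

/-- The boundary Boltzmann weight `B (b, c over a | z, ξ) = K^{a-b}_{c-b}(z, ξ/2 - κb)` of a
dynamical matrix `K(z, ξ)`. The arguments are in the order `b`, `c` (upper), `a` (lower). -/
def boundaryWeight (κ : ℂ) (K : ℂ → ℂ → Matrix (Fin 2) (Fin 2) ℂ) (b c a z ξ : ℂ) : ℂ :=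
  coeffK (K z (ξ / 2 - κ * b)) (a - b) (c - b)

/-- The eight-vertex SOS face weights. -/
def W8vSOS (q : ℝ) (κ : ℂ) (u : ℂ → ℂ) : ℂ → ℂ → ℂ → ℂ → ℂ → ℂ → ℂ :=
  faceWeight κ (R8vSOS q κ u)

/-- The boundary Boltzmann weights built from `K_Ba`. -/
def B8vSOS (q : ℝ) (κ : ℂ) (p : BoundaryParams) : ℂ → ℂ → ℂ → ℂ → ℂ → ℂ :=
  boundaryWeight κ (KBa q p)

/-- The face boundary Yang-Baxter equation for the weights `W`, `B` at the heights `a, b, c, d, e`,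
the spectral parameters `z₁, z₂` and the dynamical parameter `ξ`. The sums run over all heights
`f, g ∈ ℂ`; only finitely many summands are nonzero, since weights vanish unless adjacent heights
differ by `±1`. -/
def BoundaryYangBaxter (W : ℂ → ℂ → ℂ → ℂ → ℂ → ℂ → ℂ) (B : ℂ → ℂ → ℂ → ℂ → ℂ → ℂ)
    (a b c d e z₁ z₂ ξ : ℂ) : Prop :=
  (∑ᶠ (f : ℂ) (g : ℂ),
      W c f d e (z₁ - z₂) ξ * B f g e z₁ ξ * W c b f g (z₁ + z₂) ξ * B b a g z₂ ξ)
    = ∑ᶠ (f : ℂ) (g : ℂ),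
      B d g e z₂ ξ * W c f d g (z₁ + z₂) ξ * B f a g z₁ ξ * W c b f a (z₁ - z₂) ξ

end FaceModel

end

noncomputable section

namespace FaceModel

open Filter Topology Finset

/-! Write [x] = q^((x² - x)/2) θ(q^x), which is `bracket`. It is an odd theta function satisfying
the Weierstrass three-term identity (`bracket_weierstrass`). That identity, together with the
behaviour of [x] under half-periods, carries the whole argument.

The structure of K_Ba(z, ξ) is as follows. A factor depending only on z splits off from all four
entries (`commonFactor`). The off-diagonal entries then depend on ξ alone (`betaFactor`). The
diagonal entries become q^(2zξ) times a sum, over the four half-periods ω_k with multiplier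
exponents μ_k, of Kronecker kernels exp(-2μ_k z)[ξ + ω_k - 2z] / ([ξ + ω_k][2z]), with coefficients
free of z and ξ (`thetaQuotient_expansion`). This sum is a partial fraction expansion in ξ with five
poles. Four of them, at the -ω_k, produce the kernels. The residue at the fifth is the term 𝒞̃(ξ, z)
subtracted in the definition of α_Ba.

Three relations follow. The exchange relation between K at the heights c ± 1 is linear in the
diagonal entries, so it suffices to prove it for a single kernel (`kernel_exchange`), where it is a
combination of two Weierstrass identities. The cross relation (`diagonalFactor_cross`) comes from
the exchange relation and its copy with z₁ and z₂ swapped, by unitarity of the R-matrix. Finally,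
the reduced determinant of K does not depend on the dynamical variable (`alphaFactor_mul_neg`).

These relations suffice. Adjacent heights differ by ±1, so (b, a) and (d, e) each have four possible
values relative to c. Every one of the sixteen resulting scalar equations is trivial or a
combination of the three relations (`boundaryYangBaxter_of_entries`).

The facts about [x] rest on the Jacobi triple product, which turns the infinite product into a
lattice sum, and on splitting a product of two lattice sums by parity (`altGaussSum_mul`). -/

/-- The finite `q`-factorial `∏_{j=1}^n (1 - q^j)`. -/
def qFact (q : ℝ) (n : ℕ) : ℝ := ∏ j ∈ range n, (1 - q ^ (j + 1))

/-- The Gaussian binomial coefficient. -/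
def gaussBinom (q : ℝ) (N k : ℕ) : ℝ := qFact q N / (qFact q k * qFact q (N - k))

/-! ### Gaussian binomials and the finite q-binomial theorem. -/

section QBinomial

variable {q : ℝ} (hq0 : 0 < q) (hq1 : q < 1)
include hq0 hq1

theorem one_sub_pow_pos (j : ℕ) : 0 < 1 - q ^ (j + 1) := by
  have := pow_lt_one₀ hq0.le hq1 (Nat.succ_ne_zero j)
  simpa using this

theorem qFact_pos (n : ℕ) : 0 < qFact q n :=
  prod_pos fun j _ => one_sub_pow_pos hq0 hq1 j

theorem qFact_le_one (n : ℕ) : qFact q n ≤ 1 :=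
  prod_le_one (fun j _ => (one_sub_pow_pos hq0 hq1 j).le) fun j _ => by
    have := pow_pos hq0 (j + 1); linarith

theorem qFact_antitone : Antitone (qFact q) :=
  antitone_nat_of_succ_le fun n => by
    rw [qFact, prod_range_succ]
    refine mul_le_of_le_one_right (qFact_pos hq0 hq1 n).le ?_
    have := pow_pos hq0 (n + 1); linarith

theorem gaussBinom_succ {N k : ℕ} (hk : k < N) :
    gaussBinom q (N + 1) (k + 1) = gaussBinom q N (k + 1) + q ^ (N - k) * gaussBinom q N k := by
  obtain ⟨m, rfl⟩ := Nat.exists_eq_add_of_lt hk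
  have e1 : k + m + 1 + 1 - (k + 1) = m + 1 := by omega
  have e2 : k + m + 1 - (k + 1) = m := by omega
  have e3 : k + m + 1 - k = m + 1 := by omega
  have hk := (qFact_pos hq0 hq1 k).ne'
  have hm := (qFact_pos hq0 hq1 m).ne'
  have hk1 := (one_sub_pow_pos hq0 hq1 k).ne'
  have hm1 := (one_sub_pow_pos hq0 hq1 m).ne'
  have s : ∀ n, qFact q (n + 1) = qFact q n * (1 - q ^ (n + 1)) := fun n => prod_range_succ _ _
  simp only [gaussBinom, e1, e2, e3, s (k + m + 1), s k, s m]
  field_simp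
  ring

theorem gaussBinom_zero_right (N : ℕ) : gaussBinom q N 0 = 1 := by
  have := (qFact_pos hq0 hq1 N).ne'
  simpa [gaussBinom, qFact] using this

theorem gaussBinom_self (N : ℕ) : gaussBinom q N N = 1 := by
  have := (qFact_pos hq0 hq1 N).ne'
  simpa [gaussBinom, qFact] using this

/-- The `q`-binomial theorem. -/
theorem prod_one_add_pow_mul (N : ℕ) (y : ℂ) :
    ∏ j ∈ range N, (1 + (q : ℂ) ^ j * y)
      = ∑ k ∈ range (N + 1), (q : ℂ) ^ (k.choose 2) * gaussBinom q N k * y ^ k := by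
  induction N with
  | zero => simp [gaussBinom_zero_right hq0 hq1]
  | succ N ih =>
    have e1 := sum_range_succ' (fun k => (q : ℂ) ^ (k.choose 2) * gaussBinom q (N + 1) k * y ^ k)
      (N + 1)
    have e2 := sum_range_succ (fun k => (q : ℂ) ^ ((k + 1).choose 2) * gaussBinom q (N + 1) (k + 1)
      * y ^ (k + 1)) N
    have e3 := sum_range_succ' (fun k => (q : ℂ) ^ (k.choose 2) * gaussBinom q N k * y ^ k) N
    have e4 := sum_range_succ (fun k => (q : ℂ) ^ (k.choose 2) * gaussBinom q N k * y ^ k) N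
    rw [prod_range_succ, ih, mul_add, mul_one, e1, e2]
    nth_rewrite 1 [e3]
    rw [e4, add_mul, sum_mul]
    have hterm : ∀ k ∈ range N, (q : ℂ) ^ ((k + 1).choose 2) * gaussBinom q (N + 1) (k + 1)
          * y ^ (k + 1)
        = (q : ℂ) ^ ((k + 1).choose 2) * gaussBinom q N (k + 1) * y ^ (k + 1)
          + (q : ℂ) ^ (k.choose 2) * gaussBinom q N k * y ^ k * ((q : ℂ) ^ N * y) := by
      intro k hk
      have hk := mem_range.mp hk
      have hN : (q : ℂ) ^ N = (q : ℂ) ^ k * (q : ℂ) ^ (N - k) := by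
        rw [← pow_add]; congr 1; omega
      have hc : (k + 1).choose 2 = k + k.choose 2 := by
        rw [Nat.choose_succ_succ' k 1, Nat.choose_one_right]
      rw [gaussBinom_succ hq0 hq1 hk, hN, hc]
      push_cast
      ring
    rw [sum_congr rfl hterm, sum_add_distrib]
    have hc : (N + 1).choose 2 = N + N.choose 2 := by
      rw [Nat.choose_succ_succ' N 1, Nat.choose_one_right]
    simp only [gaussBinom_zero_right hq0 hq1, gaussBinom_self hq0 hq1, hc]
    simp
    ring

end QBinomial

/-! ### The Jacobi triple product, as a limit of its finite form. -/

section TripleProduct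

variable {q : ℝ} (hq0 : 0 < q) (hq1 : q < 1)

theorem ofReal_eq_exp_log (hq0 : 0 < q) : (q : ℂ) = Complex.exp (Real.log q) := by
  rw [← Complex.ofReal_exp, Real.exp_log hq0]

theorem ofReal_cpow_eq_exp (hq0 : 0 < q) (x : ℂ) : (q : ℂ) ^ x = Complex.exp (Real.log q * x) := by
  rw [Complex.cpow_def_of_ne_zero (by exact_mod_cast hq0.ne'), ← Complex.ofReal_log hq0.le]

include hq0 hq1

theorem summable_qpow : Summable fun j : ℕ => ‖(q : ℂ) ^ j‖ := by
  have : ∀ j : ℕ, ‖(q : ℂ) ^ j‖ = q ^ j := fun j => by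
    rw [norm_pow, Complex.norm_real, Real.norm_of_nonneg hq0.le]
  simp only [this]
  exact summable_geometric_of_lt_one hq0.le hq1

theorem multipliable_one_sub_qpow_mul (x : ℂ) : Multipliable fun j : ℕ => 1 - (q : ℂ) ^ j * x := by
  have : Summable fun j : ℕ => ‖-((q : ℂ) ^ j * x)‖ := by
    simpa using (summable_qpow hq0 hq1).mul_right ‖x‖
  simpa [sub_eq_add_neg] using multipliable_one_add_of_summable this

theorem multipliable_theta (x : ℂ) :
    Multipliable fun j : ℕ => (1 - (q : ℂ) ^ j * x) * (1 - (q : ℂ) ^ (j + 1) / x) := by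
  refine (multipliable_one_sub_qpow_mul hq0 hq1 x).mul ?_
  have := multipliable_one_sub_qpow_mul hq0 hq1 (q / x)
  refine this.congr fun j => ?_
  rw [pow_succ]; ring

theorem tendsto_theta (x : ℂ) :
    Tendsto (fun n => ∏ j ∈ range n, (1 - (q : ℂ) ^ j * x) * (1 - (q : ℂ) ^ (j + 1) / x))
      atTop (𝓝 (theta q x)) :=
  (multipliable_theta hq0 hq1 x).hasProd.tendsto_prod_nat

/-- A positive limit P that also bounds every `qFact` from below controls all Gaussian binomials
uniformly by 1/P², which is the domination needed in the triple product limit. -/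
theorem exists_tendsto_qFact : ∃ P : ℝ, 0 < P ∧ (∀ n, P ≤ qFact q n) ∧
    Tendsto (qFact q) atTop (𝓝 P) := by
  have hs : Summable fun j : ℕ => ‖-(q ^ (j + 1))‖ := by
    have := (summable_nat_add_iff 1).mpr (summable_geometric_of_lt_one hq0.le hq1)
    simpa [abs_of_pos hq0] using this
  have hm := multipliable_one_add_of_summable hs
  have ht := hm.hasProd.tendsto_prod_nat
  have hne : ∏' j : ℕ, (1 + -(q ^ (j + 1))) ≠ 0 := by
    refine tprod_one_add_ne_zero_of_summable (fun j => ?_) hs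
    have := (one_sub_pow_pos hq0 hq1 j).ne'
    simpa [sub_eq_add_neg] using this
  have ht' : Tendsto (qFact q) atTop (𝓝 (∏' j : ℕ, (1 + -(q ^ (j + 1))))) := by
    have e : qFact q = fun n => ∏ j ∈ range n, (1 + -(q ^ (j + 1))) := by
      funext n; simp [qFact, sub_eq_add_neg]
    rw [e]; exact ht
  have hle := (qFact_antitone hq0 hq1).le_of_tendsto ht'
  refine ⟨_, lt_of_le_of_ne ?_ hne.symm, hle, ht'⟩
  exact ge_of_tendsto' ht' fun n => (qFact_pos hq0 hq1 n).le

theorem gaussBinom_nonneg (N k : ℕ) : 0 ≤ gaussBinom q N k :=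
  div_nonneg (qFact_pos hq0 hq1 _).le
    (mul_pos (qFact_pos hq0 hq1 _) (qFact_pos hq0 hq1 _)).le

/-- The finite Jacobi triple product. -/
theorem prod_theta_eq_sum (n : ℕ) (v : ℂ) :
    ∏ j ∈ range n, (1 - (q : ℂ) ^ j * Complex.exp v) * (1 - (q : ℂ) ^ (j + 1) / Complex.exp v)
      = ∑ k ∈ range (2 * n + 1), (gaussBinom q (2 * n) k : ℂ) *
          jacobiTheta₂_term ((k : ℤ) - n)
            (1 / 2 + (v - Real.log q / 2) / (2 * Real.pi * Complex.I))
            (Real.log q / (2 * Real.pi * Complex.I)) := by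
  set L : ℂ := (Real.log q : ℂ) with hL
  have hpi : (Real.pi : ℂ) ≠ 0 := by exact_mod_cast Real.pi_ne_zero
  have hqp : ∀ j : ℕ, (q : ℂ) ^ j = Complex.exp (j * L) := fun j => by
    rw [ofReal_eq_exp_log hq0, ← Complex.exp_nat_mul]
  have hneg : ∀ w : ℂ, -Complex.exp w = Complex.exp (Real.pi * Complex.I + w) := fun w => by
    rw [Complex.exp_add, Complex.exp_pi_mul_I]; ring
  have hneg' : ∀ w : ℂ, -Complex.exp w = Complex.exp (-(Real.pi * Complex.I) + w) := fun w => by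
    rw [Complex.exp_add, Complex.exp_neg, Complex.exp_pi_mul_I]; ring
  -- Extracting -q^(j+1)/e^v turns the factors in 1/e^v into factors in e^v with negative powers of
  -- q. All 2n factors then form one geometric run, to which the q-binomial theorem applies.
  have hfac : ∀ j : ℕ, 1 - (q : ℂ) ^ (j + 1) / Complex.exp v
      = Complex.exp (-(Real.pi * Complex.I) - v + (j + 1) * L)
        * (1 - Complex.exp (v - (j + 1) * L)) := fun j => by
    have : Complex.exp (-(Real.pi * Complex.I) - v + (j + 1) * L)
        = -Complex.exp (-v + (j + 1) * L) := by
      rw [hneg']; congr 1; ring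
    rw [this, hqp, div_eq_mul_inv, ← Complex.exp_neg, ← Complex.exp_add]
    have h1 : Complex.exp (-v + (j + 1) * L) * Complex.exp (v - (j + 1) * L) = 1 := by
      rw [← Complex.exp_add]; simp
    have h2 : (((j + 1 : ℕ) : ℂ) * L + -v) = -v + (j + 1) * L := by push_cast; ring
    rw [h2]
    linear_combination -h1
  have hexp : ∏ j ∈ range n, Complex.exp (-(Real.pi * Complex.I) - v + (j + 1) * L)
      = Complex.exp (-(n * (Real.pi * Complex.I)) - n * v + n * (n + 1) / 2 * L) := by
    induction n with
    | zero => simp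
    | succ n ih =>
      rw [prod_range_succ, ih, ← Complex.exp_add]
      congr 1; push_cast; ring
  -- Starting the run at -e^v q^(-n), its last n factors are the 1 - q^j e^v. Its first n, read
  -- backwards, are the 1 - e^v q^(-(j+1)).
  have hprod : ∏ j ∈ range (2 * n),
        (1 + (q : ℂ) ^ j * Complex.exp (Real.pi * Complex.I + v - n * L))
      = (∏ j ∈ range n, (1 - (q : ℂ) ^ j * Complex.exp v))
        * ∏ j ∈ range n, (1 - Complex.exp (v - (j + 1) * L)) := by
    rw [two_mul, prod_range_add, mul_comm]
    congr 1
    · refine prod_congr rfl fun j _ => ?_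
      rw [hqp, hqp, ← Complex.exp_add, ← Complex.exp_add, sub_eq_add_neg (1 : ℂ), hneg]
      congr 2; push_cast; ring
    · rw [← prod_range_reflect]
      refine prod_congr rfl fun j hj => ?_
      have hj := mem_range.mp hj
      rw [hqp, ← Complex.exp_add, sub_eq_add_neg (1 : ℂ), hneg]
      congr 2
      rw [Nat.cast_sub (by omega), Nat.cast_sub (by omega)]
      push_cast; ring
  have hk2 : ∀ k : ℕ, ((k.choose 2 : ℕ) : ℂ) = k * (k - 1) / 2 := fun k =>
    Nat.cast_choose_two ℂ k
  calc _ = Complex.exp (-(n * (Real.pi * Complex.I)) - n * v + n * (n + 1) / 2 * L)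
        * ∏ j ∈ range (2 * n),
          (1 + (q : ℂ) ^ j * Complex.exp (Real.pi * Complex.I + v - n * L)) := by
        rw [hprod, prod_mul_distrib, prod_congr rfl fun j _ => hfac j, prod_mul_distrib, hexp]
        ring
    _ = _ := by
        rw [prod_one_add_pow_mul hq0 hq1, mul_sum]
        refine sum_congr rfl fun k _ => ?_
        rw [hqp, ← Complex.exp_nat_mul, jacobiTheta₂_term]
        have : ∀ a b c g d : ℂ, d = a + b + c → Complex.exp a * (Complex.exp b * g * Complex.exp c)
            = g * Complex.exp d := fun a b c g d h => by
          rw [h, Complex.exp_add, Complex.exp_add]; ring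
        refine this _ _ _ _ _ ?_
        rw [hk2]
        push_cast
        field_simp
        ring

theorem log_div_two_pi_I_im_pos : 0 < (Real.log q / (2 * Real.pi * Complex.I) : ℂ).im := by
  have : (Real.log q / (2 * Real.pi * Complex.I) : ℂ)
      = ((-(Real.log q / (2 * Real.pi)) : ℝ) : ℂ) * Complex.I := by
    have hpi : (Real.pi : ℂ) ≠ 0 := by exact_mod_cast Real.pi_ne_zero
    push_cast
    field_simp
    rw [Complex.I_sq]; ring
  have hlog := Real.log_neg hq0 hq1
  rw [this, Complex.im_ofReal_mul, Complex.I_im, mul_one, neg_pos]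
  exact div_neg_of_neg_of_pos hlog (by positivity)

/-- The Jacobi triple product identity. -/
theorem exists_theta_eq_jacobiTheta₂ : ∃ P : ℝ, 0 < P ∧ ∀ v : ℂ,
    theta q (Complex.exp v) = (P : ℂ)⁻¹ *
      jacobiTheta₂ (1 / 2 + (v - Real.log q / 2) / (2 * Real.pi * Complex.I))
            (Real.log q / (2 * Real.pi * Complex.I)) := by
  obtain ⟨P, hP, hle, hlim⟩ := exists_tendsto_qFact hq0 hq1
  refine ⟨P, hP, fun v => ?_⟩
  set Z : ℂ := 1 / 2 + (v - Real.log q / 2) / (2 * Real.pi * Complex.I)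
  set T : ℂ := Real.log q / (2 * Real.pi * Complex.I) with hT
  have hTim : 0 < T.im := log_div_two_pi_I_im_pos hq0 hq1
  have hsum := (summable_jacobiTheta₂_term_iff Z T).mpr hTim
  -- The finite sum recentred at its middle index and extended by zero to ℤ. For fixed m the
  -- binomial coefficient tends to P/(P·P) = 1/P, so dominated convergence applies.
  let f : ℕ → ℤ → ℂ := fun n m => if m ∈ Icc (-(n : ℤ)) n then
    (gaussBinom q (2 * n) (n + m).toNat : ℂ) * jacobiTheta₂_term m Z T else 0
  have hfin : ∀ n : ℕ, ∏ j ∈ range n, (1 - (q : ℂ) ^ j * Complex.exp v)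
      * (1 - (q : ℂ) ^ (j + 1) / Complex.exp v) = ∑' m : ℤ, f n m := fun n => by
    rw [prod_theta_eq_sum hq0 hq1, tsum_eq_sum (s := Icc (-(n : ℤ)) n)
      (fun m hm => if_neg hm)]
    refine sum_bij' (fun k _ => (k : ℤ) - n) (fun m _ => (n + m).toNat) ?_ ?_ ?_ ?_ ?_
    · intro k hk; simp at hk ⊢; omega
    · intro m hm; simp at hm ⊢; omega
    · intro k hk; simp
    · intro m hm; simp at hm ⊢; omega
    · intro k hk
      have h : (k : ℤ) - n ∈ Icc (-(n : ℤ)) n := by simp at hk ⊢; omega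
      have h2 : ((n : ℤ) + ((k : ℤ) - n)).toNat = k := by omega
      simp only [if_pos h, h2, Z, T]
  have hbound : ∀ N k : ℕ, ‖(gaussBinom q N k : ℂ)‖ ≤ (P * P)⁻¹ := fun N k => by
    rw [Complex.norm_real, Real.norm_of_nonneg (gaussBinom_nonneg hq0 hq1 N k), gaussBinom,
      div_eq_mul_inv]
    refine (mul_le_of_le_one_left ?_ (qFact_le_one hq0 hq1 N)).trans ?_
    · exact inv_nonneg.mpr (mul_pos (qFact_pos hq0 hq1 _) (qFact_pos hq0 hq1 _)).le
    · exact inv_anti₀ (mul_pos hP hP) (mul_le_mul (hle _) (hle _) hP.le (qFact_pos hq0 hq1 _).le)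
  have hlim2 : Tendsto (fun n => ∑' m : ℤ, f n m) atTop
      (𝓝 (∑' m : ℤ, (P : ℂ)⁻¹ * jacobiTheta₂_term m Z T)) := by
    refine tendsto_tsum_of_dominated_convergence
      (bound := fun m => (P * P)⁻¹ * ‖jacobiTheta₂_term m Z T‖) (hsum.norm.mul_left _) ?_ ?_
    · intro m
      have h1 : Tendsto (fun n : ℕ => (n + m : ℤ).toNat) atTop atTop := by
        refine tendsto_atTop.mpr fun b => ?_
        filter_upwards [eventually_ge_atTop (b + m.natAbs)] with n hn
        omega
      have h2 : Tendsto (fun n : ℕ => 2 * n - (n + m : ℤ).toNat) atTop atTop := by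
        refine tendsto_atTop.mpr fun b => ?_
        filter_upwards [eventually_ge_atTop (b + m.natAbs)] with n hn
        omega
      have h3 : Tendsto (fun n : ℕ => 2 * n) atTop atTop := by
        refine tendsto_atTop.mpr fun b => ?_
        filter_upwards [eventually_ge_atTop b] with n hn
        omega
      have h4 : Tendsto (fun n : ℕ => gaussBinom q (2 * n) (n + m : ℤ).toNat) atTop
          (𝓝 (P / (P * P))) :=
        (hlim.comp h3).div ((hlim.comp h1).mul (hlim.comp h2)) (mul_pos hP hP).ne'
      have h5 : P / (P * P) = P⁻¹ := by field_simp
      rw [h5] at h4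
      have h6 := ((Complex.continuous_ofReal.tendsto _).comp h4).mul_const
        (jacobiTheta₂_term m Z T)
      rw [Complex.ofReal_inv] at h6
      refine h6.congr' ?_
      filter_upwards [eventually_ge_atTop m.natAbs] with n hn
      have : m ∈ Icc (-(n : ℤ)) n := by simp; omega
      simp only [f, if_pos this, Function.comp]
    · refine Eventually.of_forall fun n m => ?_
      simp only [f]
      split_ifs
      · rw [norm_mul]
        exact mul_le_mul_of_nonneg_right (hbound _ _) (norm_nonneg _)
      · rw [norm_zero]
        exact mul_nonneg (inv_nonneg.mpr (mul_pos hP hP).le) (norm_nonneg _)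
  have := tendsto_nhds_unique ((tendsto_theta hq0 hq1 (Complex.exp v)).congr hfin) hlim2
  rw [this, tsum_mul_left, jacobiTheta₂]

end TripleProduct

/-! ### Products of Gaussian lattice sums. -/

section GaussSum

/-- The Gaussian lattice sum `∑_{n ∈ ℤ} exp(h (t + n)²)`. -/
def gaussSum (h : ℝ) (t : ℂ) : ℂ := ∑' n : ℤ, Complex.exp (h * (t + n) ^ 2)

theorem summable_gauss {h : ℝ} (hh : h < 0) (t : ℂ) :
    Summable fun n : ℤ => Complex.exp (h * (t + n) ^ 2) := by
  have hpi : (Real.pi : ℂ) ≠ 0 := by exact_mod_cast Real.pi_ne_zero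
  have him : 0 < ((h : ℂ) / (Real.pi * Complex.I)).im := by
    have : (h : ℂ) / (Real.pi * Complex.I) = ((-(h / Real.pi) : ℝ) : ℂ) * Complex.I := by
      push_cast
      field_simp
      rw [Complex.I_sq]; ring
    rw [this, Complex.im_ofReal_mul, Complex.I_im, mul_one, neg_pos]
    exact div_neg_of_neg_of_pos hh Real.pi_pos
  have := ((summable_jacobiTheta₂_term_iff (h * t / (Real.pi * Complex.I)) _).mpr him).mul_left
    (Complex.exp (h * t ^ 2))
  refine this.congr fun n => ?_
  rw [jacobiTheta₂_term, ← Complex.exp_add]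
  congr 1
  field_simp
  ring

/-- Pairs of integers, split according to the parity of the sum of their entries. -/
def parityEquiv : (ℤ × ℤ) ⊕ (ℤ × ℤ) ≃ ℤ × ℤ :=
  Equiv.ofBijective
    (Sum.elim (fun p => (p.1 + p.2, p.1 - p.2)) fun p => (p.1 + p.2, p.1 - p.2 + 1)) <| by
    constructor
    · rintro (⟨a, b⟩ | ⟨a, b⟩) (⟨c, d⟩ | ⟨c, d⟩) h <;>
        simp only [Sum.elim_inl, Sum.elim_inr, Prod.mk.injEq] at h
      · obtain ⟨rfl, rfl⟩ : a = c ∧ b = d := by omega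
        rfl
      · omega
      · omega
      · obtain ⟨rfl, rfl⟩ : a = c ∧ b = d := by omega
        rfl
    · rintro ⟨n, m⟩
      rcases Int.even_or_odd (n + m) with ⟨r, hr⟩ | ⟨r, hr⟩
      · refine ⟨Sum.inl (r, n - r), ?_⟩
        simp only [Sum.elim_inl, Prod.mk.injEq]
        omega
      · refine ⟨Sum.inr (r, n - r), ?_⟩
        simp only [Sum.elim_inr, Prod.mk.injEq]
        omega

theorem parityEquiv_inl (p : ℤ × ℤ) : parityEquiv (Sum.inl p) = (p.1 + p.2, p.1 - p.2) := rfl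

theorem parityEquiv_inr (p : ℤ × ℤ) : parityEquiv (Sum.inr p) = (p.1 + p.2, p.1 - p.2 + 1) := rfl

/-- The alternating Gaussian lattice sum. -/
def altGaussSum (h : ℝ) (x : ℂ) : ℂ :=
  ∑' n : ℤ, Complex.exp (Real.pi * Complex.I * n + h / 2 * (x + n - 1 / 2) ^ 2)

theorem exp_pi_mul_I_mul_int_mul (n : ℤ) :
    ‖Complex.exp (Real.pi * Complex.I * n)‖ = 1 := by
  have : (Real.pi : ℂ) * Complex.I * n = ((Real.pi * n : ℝ) : ℂ) * Complex.I := by push_cast; ring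
  rw [this, Complex.norm_exp_ofReal_mul_I]

theorem summable_norm_altGauss {h : ℝ} (hh : h < 0) (x : ℂ) :
    Summable fun n : ℤ =>
      ‖Complex.exp (Real.pi * Complex.I * n + h / 2 * (x + n - 1 / 2) ^ 2)‖ := by
  have := (summable_gauss (h := h / 2) (by linarith) (x - 1 / 2)).norm
  refine this.congr fun n => ?_
  rw [Complex.exp_add, norm_mul, exp_pi_mul_I_mul_int_mul, one_mul]
  congr 2
  push_cast
  ring

/-- The squares (x + y + n - 1/2)² and (x - y + m - 1/2)² recombine into squares in x + (n + m -
1)/2 and y + (n - m)/2. These run independently once the parity of n + m is fixed, and that parity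
is also the sign. The result is a 2 × 2 determinant in x and y, which is the form that makes the
Weierstrass identity purely algebraic. -/
theorem altGaussSum_mul {h : ℝ} (hh : h < 0) (x y : ℂ) :
    altGaussSum h (x + y) * altGaussSum h (x - y)
      = gaussSum h (x - 1 / 2) * gaussSum h y - gaussSum h x * gaussSum h (y - 1 / 2) := by
  have hs := fun t => (summable_gauss hh t).norm
  rw [altGaussSum, altGaussSum, tsum_mul_tsum_of_summable_norm (summable_norm_altGauss hh _)
    (summable_norm_altGauss hh _), ← parityEquiv.tsum_eq]
  have h2 : ∀ k : ℤ, Complex.exp (Real.pi * Complex.I * (2 * k)) = 1 := fun k => by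
    rw [← Complex.exp_int_mul_two_pi_mul_I k]; congr 1; ring
  have key : ∀ p : ℤ × ℤ,
      Complex.exp (Real.pi * Complex.I * p.1 + h / 2 * (x + y + p.1 - 1 / 2) ^ 2)
        * Complex.exp (Real.pi * Complex.I * p.2 + h / 2 * (x - y + p.2 - 1 / 2) ^ 2)
      = Complex.exp (Real.pi * Complex.I * (p.1 + p.2))
        * (Complex.exp (h * (x + (p.1 + p.2 - 1) / 2) ^ 2)
          * Complex.exp (h * (y + (p.1 - p.2) / 2) ^ 2)) := fun p => by
    rw [← Complex.exp_add, ← Complex.exp_add, ← Complex.exp_add]; congr 1; ring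
  have hinl : ∀ p : ℤ × ℤ, Complex.exp (h * (x - 1 / 2 + p.1) ^ 2) * Complex.exp (h * (y + p.2) ^ 2)
      = Complex.exp (Real.pi * Complex.I * (parityEquiv (Sum.inl p)).1
          + h / 2 * (x + y + (parityEquiv (Sum.inl p)).1 - 1 / 2) ^ 2)
        * Complex.exp (Real.pi * Complex.I * (parityEquiv (Sum.inl p)).2
          + h / 2 * (x - y + (parityEquiv (Sum.inl p)).2 - 1 / 2) ^ 2) := fun p => by
    rw [key]
    have e1 : ((parityEquiv (Sum.inl p)).1 : ℂ) = p.1 + p.2 := by simp [parityEquiv_inl]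
    have e2 : ((parityEquiv (Sum.inl p)).2 : ℂ) = p.1 - p.2 := by simp [parityEquiv_inl]
    have e3 : ((p.1 : ℂ) + p.2 + (p.1 - p.2)) = 2 * p.1 := by ring
    rw [e1, e2, e3, h2, one_mul]
    congr 3 <;> ring
  have hinr : ∀ p : ℤ × ℤ,
      -(Complex.exp (h * (x + p.1) ^ 2) * Complex.exp (h * (y - 1 / 2 + p.2) ^ 2))
      = Complex.exp (Real.pi * Complex.I * (parityEquiv (Sum.inr p)).1
          + h / 2 * (x + y + (parityEquiv (Sum.inr p)).1 - 1 / 2) ^ 2)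
        * Complex.exp (Real.pi * Complex.I * (parityEquiv (Sum.inr p)).2
          + h / 2 * (x - y + (parityEquiv (Sum.inr p)).2 - 1 / 2) ^ 2) := fun p => by
    rw [key]
    have e1 : ((parityEquiv (Sum.inr p)).1 : ℂ) = p.1 + p.2 := by simp [parityEquiv_inr]
    have e2 : ((parityEquiv (Sum.inr p)).2 : ℂ) = p.1 - p.2 + 1 := by
      simp [parityEquiv_inr]
    have e3 : Complex.exp (Real.pi * Complex.I * ((p.1 : ℂ) + p.2 + (p.1 - p.2 + 1))) = -1 := by
      have : (Real.pi : ℂ) * Complex.I * ((p.1 : ℂ) + p.2 + (p.1 - p.2 + 1))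
        = Real.pi * Complex.I * (2 * p.1) + Real.pi * Complex.I := by ring
      rw [this, Complex.exp_add, h2, Complex.exp_pi_mul_I, one_mul]
    rw [e1, e2, e3, neg_one_mul]
    congr 4 <;> ring
  have s1 := summable_mul_of_summable_norm (hs (x - 1 / 2)) (hs y)
  have s2 := (summable_mul_of_summable_norm (hs x) (hs (y - 1 / 2))).neg
  rw [Summable.tsum_sum]
  · rw [sub_eq_add_neg (gaussSum h (x - 1 / 2) * gaussSum h y), gaussSum, gaussSum, gaussSum, gaussSum,
      tsum_mul_tsum_of_summable_norm (hs _) (hs _), tsum_mul_tsum_of_summable_norm (hs _) (hs _),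
      ← tsum_neg]
    exact congrArg₂ _ (tsum_congr fun p => (hinl p).symm) (tsum_congr fun p => (hinr p).symm)
  · exact s1.congr hinl
  · exact s2.congr hinr

end GaussSum

/-! ### The odd theta function [x] and the Weierstrass identity. -/

section Bracket

/-- The odd theta function `q^{(x² - x)/2} θ(q^x; q)` of the additive variable `x`. -/
def bracket (q : ℝ) (x : ℂ) : ℂ := (q : ℂ) ^ ((x ^ 2 - x) / 2) * theta q ((q : ℂ) ^ x)

variable {q : ℝ} (hq0 : 0 < q) (hq1 : q < 1)
include hq0 hq1

/-- The first form gives holomorphy. The second is the first with the square completed in the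
exponent, and it gives the algebraic identities. -/
theorem exists_bracket_eq_jacobiTheta₂ : ∃ C T : ℂ, C ≠ 0 ∧ 0 < T.im ∧ ∀ x : ℂ,
    bracket q x = C * (Complex.exp (Real.log q / 2 * (x ^ 2 - x)) * jacobiTheta₂
      (1 / 2 + (Real.log q * x - Real.log q / 2) / (2 * Real.pi * Complex.I)) T) ∧
    bracket q x = C * Complex.exp (-(Real.log q / 8)) * altGaussSum (Real.log q) x := by
  obtain ⟨P, hP, h⟩ := exists_theta_eq_jacobiTheta₂ hq0 hq1
  have hpi : (Real.pi : ℂ) ≠ 0 := by exact_mod_cast Real.pi_ne_zero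
  refine ⟨(P : ℂ)⁻¹, _, inv_ne_zero (by exact_mod_cast hP.ne'), log_div_two_pi_I_im_pos hq0 hq1,
    fun x => ?_⟩
  have h1 : bracket q x = (P : ℂ)⁻¹ * (Complex.exp (Real.log q / 2 * (x ^ 2 - x)) * jacobiTheta₂
      (1 / 2 + (Real.log q * x - Real.log q / 2) / (2 * Real.pi * Complex.I))
        (Real.log q / (2 * Real.pi * Complex.I))) := by
    rw [bracket, ofReal_cpow_eq_exp hq0, ofReal_cpow_eq_exp hq0, h]
    have : (Real.log q : ℂ) * ((x ^ 2 - x) / 2) = Real.log q / 2 * (x ^ 2 - x) := by ring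
    rw [this]; ring
  refine ⟨h1, ?_⟩
  rw [h1, mul_assoc _ _ (altGaussSum _ _)]
  congr 1
  rw [altGaussSum, jacobiTheta₂, ← tsum_mul_left, ← tsum_mul_left]
  refine tsum_congr fun n => ?_
  rw [jacobiTheta₂_term, ← Complex.exp_add, ← Complex.exp_add]
  congr 1
  field_simp
  ring

/-- The Weierstrass three-term identity. -/
theorem bracket_weierstrass (x y u v : ℂ) :
    bracket q (x + y) * bracket q (x - y) * (bracket q (u + v) * bracket q (u - v))
      - bracket q (x + u) * bracket q (x - u) * (bracket q (y + v) * bracket q (y - v))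
      + bracket q (x + v) * bracket q (x - v) * (bracket q (y + u) * bracket q (y - u)) = 0 := by
  obtain ⟨C, T, -, -, h⟩ := exists_bracket_eq_jacobiTheta₂ hq0 hq1
  have hh := Real.log_neg hq0 hq1
  simp only [fun x => (h x).2]
  set C' := C * Complex.exp (-(Real.log q / 8))
  -- Each product [x + y][x - y] is a multiple of the determinant of the vectors (`gaussSum h (t -
  -- 1/2)`, `gaussSum h t`) at t = x and t = y. The claim is the Plücker relation for four vectors
  -- in the plane.
  have e := fun x y => altGaussSum_mul hh x y
  have : ∀ a b c d : ℂ, C' * a * (C' * b) * (C' * c * (C' * d)) = C' ^ 4 * ((a * b) * (c * d)) :=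
    fun a b c d => by ring
  simp only [this, e]
  ring

theorem differentiable_bracket : Differentiable ℂ (bracket q) := by
  obtain ⟨C, T, -, hT, h⟩ := exists_bracket_eq_jacobiTheta₂ hq0 hq1
  have e : bracket q = _ := funext fun x => (h x).1
  rw [e]
  refine Differentiable.const_mul (Differentiable.mul (by fun_prop) fun x => ?_) C
  exact (differentiableAt_jacobiTheta₂_fst _ hT).comp x (by fun_prop)

theorem continuous_bracket : Continuous (bracket q) := (differentiable_bracket hq0 hq1).continuous

theorem theta_neg_one_ne_zero : theta q (-1) ≠ 0 := by
  have hs : Summable fun j : ℕ => ‖(q : ℂ) ^ j‖ := summable_qpow hq0 hq1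
  have hs' : Summable fun j : ℕ => ‖(q : ℂ) ^ (j + 1)‖ := (summable_nat_add_iff 1).mpr hs
  have hpos : ∀ j : ℕ, (1 + (q : ℂ) ^ j) ≠ 0 := fun j => by
    have : (0 : ℝ) < 1 + q ^ j := by positivity
    exact_mod_cast this.ne'
  have h1 := tprod_one_add_ne_zero_of_summable hpos hs
  have h2 := tprod_one_add_ne_zero_of_summable (fun j => hpos (j + 1)) hs'
  have : theta q (-1) = (∏' j : ℕ, (1 + (q : ℂ) ^ j)) * ∏' j : ℕ, (1 + (q : ℂ) ^ (j + 1)) := by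
    rw [theta, ← (multipliable_one_add_of_summable hs).tprod_mul
      (multipliable_one_add_of_summable hs')]
    refine tprod_congr fun j => ?_
    ring
  rw [this]
  exact mul_ne_zero h1 h2

/-- By the identity theorem, vanishing near t = 0 would force [x] to vanish on the whole plane. At x
= πi / log q, however, the argument q^x is -1, where every factor of the product is nonzero. -/
theorem eventually_bracket_ne_zero (A : ℂ) {B : ℂ} (hB : B ≠ 0) :
    ∀ᶠ t : ℂ in 𝓝[≠] 0, bracket q (A + t * B) ≠ 0 := by
  have hd : Differentiable ℂ fun t : ℂ => bracket q (A + t * B) :=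
    (differentiable_bracket hq0 hq1).comp (by fun_prop)
  have ha : AnalyticOnNhd ℂ (fun t : ℂ => bracket q (A + t * B)) Set.univ :=
    fun t _ => hd.analyticAt t
  rcases (ha 0 (Set.mem_univ _)).eventually_eq_zero_or_eventually_ne_zero with h | h
  · exfalso
    have h0 := ha.eqOn_zero_of_preconnected_of_eventuallyEq_zero isPreconnected_univ
      (Set.mem_univ 0) h
    have hlog : (Real.log q : ℂ) ≠ 0 := by exact_mod_cast (Real.log_neg hq0 hq1).ne
    have h1 := h0 (Set.mem_univ ((Real.pi * Complex.I / Real.log q - A) / B))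
    simp only [Pi.zero_apply] at h1
    have e : A + (Real.pi * Complex.I / Real.log q - A) / B * B
        = Real.pi * Complex.I / Real.log q := by field_simp; ring
    rw [e, bracket, ofReal_cpow_eq_exp hq0, ofReal_cpow_eq_exp hq0, mul_div_cancel₀ _ hlog,
      Complex.exp_pi_mul_I] at h1
    exact mul_ne_zero (Complex.exp_ne_zero _) (theta_neg_one_ne_zero hq0 hq1) h1
  · exact h

end Bracket

/-! ### Symmetries of [x] and elliptic partial fractions. -/

section BracketIdentities

variable {q : ℝ} (hq0 : 0 < q) (hq1 : q < 1)

theorem altGaussSum_neg (h : ℝ) (x : ℂ) : altGaussSum h (-x) = -altGaussSum h x := by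
  rw [altGaussSum, altGaussSum, ← tsum_neg, ← (Equiv.subLeft (1 : ℤ)).tsum_eq]
  refine tsum_congr fun n => ?_
  have h2 : Complex.exp (Real.pi * Complex.I * (2 * n)) = 1 := by
    rw [← Complex.exp_int_mul_two_pi_mul_I n]; congr 1; ring
  have e : (Real.pi : ℂ) * Complex.I * n + h / 2 * (x + n - 1 / 2) ^ 2
      = Real.pi * Complex.I * (2 * n) + ((Real.pi * Complex.I * ((1 - n : ℤ) : ℂ)
        + h / 2 * (-x + ((1 - n : ℤ) : ℂ) - 1 / 2) ^ 2) - Real.pi * Complex.I) := by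
    push_cast; ring
  have e' := congrArg Complex.exp e
  rw [Complex.exp_add (_ * (2 * _)), h2, one_mul, Complex.exp_sub _ (_ * Complex.I),
    Complex.exp_pi_mul_I, div_neg, div_one] at e'
  rw [Equiv.subLeft_apply, e', neg_neg]

theorem altGaussSum_add_one (h : ℝ) (x : ℂ) : altGaussSum h (x + 1) = -altGaussSum h x := by
  rw [altGaussSum, altGaussSum, ← tsum_neg, ← (Equiv.addRight (1 : ℤ)).tsum_eq
    fun n : ℤ => -Complex.exp (Real.pi * Complex.I * n + h / 2 * (x + n - 1 / 2) ^ 2)]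
  refine tsum_congr fun n => ?_
  have e : (Real.pi : ℂ) * Complex.I * ((n + 1 : ℤ) : ℂ) + h / 2 * (x + ((n + 1 : ℤ) : ℂ) - 1 / 2) ^ 2
      = (Real.pi * Complex.I * n + h / 2 * (x + 1 + n - 1 / 2) ^ 2) + Real.pi * Complex.I := by
    push_cast; ring
  have e' := congrArg Complex.exp e
  rw [Complex.exp_add _ (_ * Complex.I), Complex.exp_pi_mul_I, mul_neg_one] at e'
  rw [Equiv.coe_addRight, e', neg_neg]

include hq0 hq1

theorem bracket_neg (x : ℂ) : bracket q (-x) = -bracket q x := by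
  obtain ⟨C, T, -, -, h⟩ := exists_bracket_eq_jacobiTheta₂ hq0 hq1
  rw [(h _).2, (h x).2, altGaussSum_neg]; ring

theorem bracket_add_one (x : ℂ) : bracket q (x + 1) = -bracket q x := by
  obtain ⟨C, T, -, -, h⟩ := exists_bracket_eq_jacobiTheta₂ hq0 hq1
  rw [(h _).2, (h x).2, altGaussSum_add_one]; ring

theorem bracket_sub_comm (x y : ℂ) : bracket q (x - y) = -bracket q (y - x) := by
  rw [← neg_sub, bracket_neg hq0 hq1]

/-- Splitting a product of two quotients of theta functions into partial fractions. -/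
theorem bracket_mul_bracket (X δ σ d : ℂ) :
    bracket q (X + σ) * bracket q (X + δ + d) * bracket q δ * bracket q (σ + d)
      = bracket q (δ + d) * bracket q (X + σ + d) * bracket q (X + δ) * bracket q σ
        - bracket q (σ - δ) * bracket q d * bracket q (X + δ + σ + d) * bracket q X := by
  have h := bracket_weierstrass hq0 hq1 (X + (σ + d + δ) / 2) ((σ + d - δ) / 2) ((δ + d + σ) / 2)
    ((δ + d - σ) / 2)
  rw [show X + (σ + d + δ) / 2 + (σ + d - δ) / 2 = X + σ + d by ring,
    show X + (σ + d + δ) / 2 - (σ + d - δ) / 2 = X + δ by ring,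
    show (δ + d + σ) / 2 + (δ + d - σ) / 2 = δ + d by ring,
    show (δ + d + σ) / 2 - (δ + d - σ) / 2 = σ by ring,
    show X + (σ + d + δ) / 2 + (δ + d + σ) / 2 = X + δ + σ + d by ring,
    show X + (σ + d + δ) / 2 - (δ + d + σ) / 2 = X by ring,
    show (σ + d - δ) / 2 + (δ + d - σ) / 2 = d by ring,
    show (σ + d - δ) / 2 - (δ + d - σ) / 2 = σ - δ by ring,
    show X + (σ + d + δ) / 2 + (δ + d - σ) / 2 = X + δ + d by ring,
    show X + (σ + d + δ) / 2 - (δ + d - σ) / 2 = X + σ by ring,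
    show (σ + d - δ) / 2 + (δ + d + σ) / 2 = σ + d by ring,
    show (σ + d - δ) / 2 - (δ + d + σ) / 2 = -δ by ring, bracket_neg hq0 hq1 δ] at h
  linear_combination -h

/-- Partial fraction expansion of a product of quotients of theta functions. -/
theorem bracket_partialFraction (c d : ℕ → ℂ) (n : ℕ)
    (hc : ∀ i < n + 1, ∀ j < n + 1, i ≠ j → bracket q (c i - c j) ≠ 0)
    (hd : ∀ m < n + 1, bracket q (∑ i ∈ range (m + 1), d i) ≠ 0)
    (x : ℂ) (hx : ∀ i < n + 1, bracket q (x - c i) ≠ 0) :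
    ∏ i ∈ range (n + 1), bracket q (x - c i + d i) / bracket q (x - c i)
      = ∑ i ∈ range (n + 1),
          (∏ j ∈ range (n + 1), if j = i then bracket q (d j)
            else bracket q (c i - c j + d j) / bracket q (c i - c j))
          * (bracket q (x - c i + ∑ j ∈ range (n + 1), d j)
            / (bracket q (x - c i) * bracket q (∑ j ∈ range (n + 1), d j))) := by
  induction n generalizing x with
  | zero =>
    have h0 := hd 0 (by omega)
    have hx0 := hx 0 (by omega)
    simp at h0 ⊢
    field_simp
  | succ n ih =>
    have ih' := ih (fun i hi j hj => hc i (by omega) j (by omega)) fun m hm => hd m (by omega)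
    have hN : ∀ i < n + 1, bracket q (c (n + 1) - c i) ≠ 0 := fun i hi =>
      hc _ (by omega) _ (by omega) (by omega)
    have hN' : ∀ i < n + 1, bracket q (c i - c (n + 1)) ≠ 0 := fun i hi =>
      hc _ (by omega) _ (by omega) (by omega)
    have hσ := hd n (by omega)
    have hσ' := hd (n + 1) (by omega)
    have hxN := hx (n + 1) (by omega)
    rw [prod_range_succ, ih' x fun i hi => hx i (by omega), sum_range_succ _ (n + 1),
      sum_range_succ d (n + 1)]
    rw [sum_range_succ d (n + 1)] at hσ'
    set σ := ∑ j ∈ range (n + 1), d j with hσdef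
    -- The residue at the new pole is the old product evaluated there. The induction hypothesis at x
    -- = c (n + 1) expands it over the old poles, so both sides can be compared term by term.
    have hlast : (∏ j ∈ range (n + 1 + 1), if j = n + 1 then bracket q (d j)
            else bracket q (c (n + 1) - c j + d j) / bracket q (c (n + 1) - c j))
        = (∑ i ∈ range (n + 1), (∏ j ∈ range (n + 1), if j = i then bracket q (d j)
            else bracket q (c i - c j + d j) / bracket q (c i - c j))
          * (bracket q (c (n + 1) - c i + σ) / (bracket q (c (n + 1) - c i) * bracket q σ)))
          * bracket q (d (n + 1)) := by
      rw [← ih' (c (n + 1)) hN, prod_range_succ, if_pos rfl]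
      congr 1
      refine prod_congr rfl fun j hj => ?_
      rw [if_neg (mem_range.mp hj).ne]
    rw [hlast, sum_mul, sum_mul, sum_mul, ← sum_add_distrib]
    refine sum_congr rfl fun i hi => ?_
    have hi := mem_range.mp hi
    rw [prod_range_succ _ (n + 1), if_neg (by omega : n + 1 ≠ i)]
    -- An old pole term times the new factor splits into a term at the old pole and one at the new
    -- pole, with total shift increased from σ to σ + d (n + 1).
    have key := bracket_mul_bracket hq0 hq1 (x - c i) (c i - c (n + 1)) σ (d (n + 1))
    have e1 : x - c i + (c i - c (n + 1)) = x - c (n + 1) := by ring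
    have e2 : σ - (c i - c (n + 1)) = c (n + 1) - c i + σ := by ring
    rw [e1, e2] at key
    have e3 : x - c (n + 1) + (σ + d (n + 1)) = x - c (n + 1) + σ + d (n + 1) := by ring
    have e4 : x - c i + (σ + d (n + 1)) = x - c i + σ + d (n + 1) := by ring
    rw [e3, e4, bracket_sub_comm hq0 hq1 (c (n + 1)) (c i)]
    have h1 := hN' i hi
    have h2 := hx i (by omega)
    generalize (∏ j ∈ range (n + 1), if j = i then bracket q (d j)
            else bracket q (c i - c j + d j) / bracket q (c i - c j)) = R
    field_simp
    linear_combination R * key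

end BracketIdentities

/-! ### Kronecker kernels at half-periods and their exchange relation. -/

section Kernel

variable {q : ℝ} (hq0 : 0 < q) (hq1 : q < 1)

/-- `ω` is a half-period of the theta function, with multiplier `exp(-2μx)`. -/
def IsHalfPeriod (q : ℝ) (ω μ : ℂ) : Prop :=
  ∃ ε : ℂ, ε ≠ 0 ∧ ∀ x, bracket q (x + 2 * ω) = ε * Complex.exp (-2 * μ * x) * bracket q x

/-- The Kronecker kernel attached to a half-period. -/
def kernel (q : ℝ) (ω μ z ξ : ℂ) : ℂ :=
  Complex.exp (-2 * μ * z) * bracket q (ξ + ω - 2 * z) / (bracket q (ξ + ω) * bracket q (2 * z))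

/-- In the quotient the constant ε and the x-dependent part of the multiplier cancel. Only an
exponential in the shift z survives, and the prefactors in `kernel` are designed to absorb it. -/
theorem IsHalfPeriod.div_sub {ω μ : ℂ} (h : IsHalfPeriod q ω μ) (y z : ℂ) :
    bracket q (y - z) / bracket q y
      = Complex.exp (-2 * μ * z) * (bracket q (y + 2 * ω - z) / bracket q (y + 2 * ω)) := by
  obtain ⟨ε, hε, h⟩ := h
  have e1 : y + 2 * ω - z = (y - z) + 2 * ω := by ring
  have e2 : Complex.exp (-2 * μ * (y - z)) = Complex.exp (-2 * μ * y) * Complex.exp (2 * μ * z) := by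
    rw [← Complex.exp_add]; congr 1; ring
  have e3 : Complex.exp (-2 * μ * z) * Complex.exp (2 * μ * z) = 1 := by
    rw [← Complex.exp_add]; simp
  have e4 := Complex.exp_ne_zero (-2 * μ * y)
  rw [e1, h, h, e2]
  have : ε * (Complex.exp (-2 * μ * y) * Complex.exp (2 * μ * z)) * bracket q (y - z)
      / (ε * Complex.exp (-2 * μ * y) * bracket q y)
      = Complex.exp (2 * μ * z) * (bracket q (y - z) / bracket q y) := by
    rw [show ε * (Complex.exp (-2 * μ * y) * Complex.exp (2 * μ * z)) * bracket q (y - z)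
      = (ε * Complex.exp (-2 * μ * y)) * (Complex.exp (2 * μ * z) * bracket q (y - z)) by ring,
      mul_div_mul_left _ _ (mul_ne_zero hε e4), mul_div_assoc]
  rw [this, ← mul_assoc, e3, one_mul]

include hq0 hq1

theorem IsHalfPeriod.div_reflect {ω μ : ℂ} (h : IsHalfPeriod q ω μ) (y z : ℂ) :
    bracket q (-y + ω - z) / bracket q (-y + ω)
      = Complex.exp (2 * μ * z) * (bracket q (y + ω + z) / bracket q (y + ω)) := by
  have e := h.div_sub (y - ω) (-z)
  rw [show y - ω - -z = -(-y + ω - z) by ring, show y - ω = -(-y + ω) by ring,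
    bracket_neg hq0 hq1, bracket_neg hq0 hq1, neg_div_neg_eq] at e
  rw [e]
  congr 2
  · ring
  · congr 1; ring
  · congr 1; ring

theorem kernel_neg_neg {ω μ : ℂ} (h : IsHalfPeriod q ω μ) (z ξ : ℂ) :
    kernel q ω μ (-z) (-ξ) = -kernel q ω μ z ξ := by
  have e := h.div_reflect hq0 hq1 ξ (-(2 * z))
  have e1 : -ξ + ω - -(2 * z) = -ξ + ω - 2 * -z := by ring
  have e2 : ξ + ω + -(2 * z) = ξ + ω - 2 * z := by ring
  have e4 : bracket q (2 * -z) = -bracket q (2 * z) := by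
    rw [mul_neg, bracket_neg hq0 hq1]
  have e5 : Complex.exp (-2 * μ * -z) * Complex.exp (2 * μ * -(2 * z)) = Complex.exp (-2 * μ * z) := by
    rw [← Complex.exp_add]; congr 1; ring
  rw [e1, e2] at e
  rw [kernel, kernel, e4, ← div_div, mul_div_assoc, e, ← mul_assoc, e5, ← div_div, mul_div_assoc,
    div_neg, mul_neg, mul_div_assoc, mul_div_assoc]

/-- Two Weierstrass identities share the product [z₁ - κ + X - z₂][z₁ - κ - X + z₂], which occurs
once with the factor [2X][2z₁] and once with [2κ][2z₂]. Eliminating the shared product gives the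
relation. -/
theorem bracket_exchange (X κ z₁ z₂ : ℂ) :
    bracket q (z₁ + z₂) * bracket q (2 * κ - (z₁ - z₂)) * bracket q (X + κ - 2 * z₂)
        * bracket q (2 * X) * bracket q (X - κ) * bracket q (2 * z₁)
      = bracket q (z₁ - z₂) * bracket q (2 * κ - (z₁ + z₂)) * bracket q (X - κ - 2 * z₂)
          * bracket q (2 * X) * bracket q (X + κ) * bracket q (2 * z₁)
        + bracket q (2 * κ) * bracket q (2 * z₂) *
          (bracket q (z₁ - z₂) * bracket q (2 * X - (z₁ + z₂)) * bracket q (X - κ + 2 * z₁)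
              * bracket q (X + κ)
            + bracket q (z₁ + z₂) * bracket q (2 * X + (z₁ - z₂)) * bracket q (X + κ - 2 * z₁)
              * bracket q (X - κ)) := by
  have h := bracket_weierstrass hq0 hq1 (z₁ - κ) (X - z₂) (X + z₁) (X - z₁)
  have h' := bracket_weierstrass hq0 hq1 (z₁ - κ) (X - z₂) (κ + z₂) (κ - z₂)
  rw [show X + z₁ + (X - z₁) = 2 * X by ring, show X + z₁ - (X - z₁) = 2 * z₁ by ring,
    show z₁ - κ + (X + z₁) = X - κ + 2 * z₁ by ring, show z₁ - κ - (X + z₁) = -(X + κ) by ring,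
    show X - z₂ + (X - z₁) = 2 * X - (z₁ + z₂) by ring, show X - z₂ - (X - z₁) = z₁ - z₂ by ring,
    show z₁ - κ + (X - z₁) = X - κ by ring, show z₁ - κ - (X - z₁) = -(X + κ - 2 * z₁) by ring,
    show X - z₂ + (X + z₁) = 2 * X + (z₁ - z₂) by ring,
    show X - z₂ - (X + z₁) = -(z₁ + z₂) by ring,
    bracket_neg hq0 hq1, bracket_neg hq0 hq1, bracket_neg hq0 hq1] at h
  rw [show κ + z₂ + (κ - z₂) = 2 * κ by ring, show κ + z₂ - (κ - z₂) = 2 * z₂ by ring,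
    show z₁ - κ + (κ + z₂) = z₁ + z₂ by ring, show z₁ - κ - (κ + z₂) = -(2 * κ - (z₁ - z₂)) by ring,
    show X - z₂ + (κ - z₂) = X + κ - 2 * z₂ by ring, show X - z₂ - (κ - z₂) = X - κ by ring,
    show z₁ - κ + (κ - z₂) = z₁ - z₂ by ring, show z₁ - κ - (κ - z₂) = -(2 * κ - (z₁ + z₂)) by ring,
    show X - z₂ + (κ + z₂) = X + κ by ring,
    show X - z₂ - (κ + z₂) = X - κ - 2 * z₂ by ring,
    bracket_neg hq0 hq1, bracket_neg hq0 hq1] at h'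
  linear_combination bracket q (2 * X) * bracket q (2 * z₁) * h'
    - bracket q (2 * κ) * bracket q (2 * z₂) * h

/-- This is `bracket_exchange` at X = x + ω. The factors in 2X = 2x + 2ω are moved back to 2x by the
multiplier of the full period 2ω, so the R-matrix weights are the same for all four half-periods.
That uniformity lets the relation be summed over kernels. -/
theorem kernel_exchange {ω μ : ℂ} (h : IsHalfPeriod q ω μ) {x κ z₁ z₂ : ℂ}
    (hx : bracket q (2 * x) ≠ 0) (hadd : bracket q (x + κ + ω) ≠ 0)
    (hsub : bracket q (x - κ + ω) ≠ 0) (hz₁ : bracket q (2 * z₁) ≠ 0)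
    (hz₂ : bracket q (2 * z₂) ≠ 0) :
    bracket q (z₁ + z₂) * bracket q (2 * κ - (z₁ - z₂)) * kernel q ω μ z₂ (x + κ)
      = bracket q (z₁ - z₂) * (bracket q (2 * κ - (z₁ + z₂)) * kernel q ω μ z₂ (x - κ)
          + bracket q (2 * κ) * (bracket q (2 * x - (z₁ + z₂)) / bracket q (2 * x))
            * kernel q ω μ z₁ (-(x - κ)))
        + bracket q (z₁ + z₂) * (bracket q (2 * κ)
            * (bracket q (2 * x + (z₁ - z₂)) / bracket q (2 * x))) * kernel q ω μ z₁ (x + κ) := by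
  have hX : bracket q (2 * (x + ω)) ≠ 0 := by
    obtain ⟨ε, hε, h⟩ := h
    rw [mul_add, h]
    exact mul_ne_zero (mul_ne_zero hε (Complex.exp_ne_zero _)) hx
  have r1 := h.div_reflect hq0 hq1 (x - κ) (2 * z₁)
  have r2 := h.div_sub (2 * x) (z₁ + z₂)
  have r3 := h.div_sub (2 * x) (-(z₁ - z₂))
  have base := bracket_exchange hq0 hq1 (x + ω) κ z₁ z₂
  rw [show 2 * x - -(z₁ - z₂) = 2 * x + (z₁ - z₂) by ring,
    show 2 * x + 2 * ω - -(z₁ - z₂) = 2 * (x + ω) + (z₁ - z₂) by ring, ← mul_add] at r3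
  rw [← mul_add] at r2
  have hk : kernel q ω μ z₁ (-(x - κ)) = Complex.exp (-2 * μ * z₁) *
      (bracket q (-(x - κ) + ω - 2 * z₁) / bracket q (-(x - κ) + ω)) / bracket q (2 * z₁) := by
    rw [kernel]; field_simp
  rw [hk, r1, r2, r3]
  rw [show x + ω + κ = x + κ + ω by ring, show x + ω - κ = x - κ + ω by ring] at base
  have x1 : Complex.exp (-2 * μ * (z₁ + z₂)) * (Complex.exp (-2 * μ * z₁)
      * Complex.exp (2 * μ * (2 * z₁))) = Complex.exp (-2 * μ * z₂) := by
    rw [← Complex.exp_add, ← Complex.exp_add]; congr 1; ring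
  have x2 : Complex.exp (-2 * μ * -(z₁ - z₂)) * Complex.exp (-2 * μ * z₁)
      = Complex.exp (-2 * μ * z₂) := by
    rw [← Complex.exp_add]; congr 1; ring
  have baseDiv : bracket q (z₁ + z₂) * bracket q (2 * κ - (z₁ - z₂))
        * (bracket q (x + κ + ω - 2 * z₂) / (bracket q (x + κ + ω) * bracket q (2 * z₂)))
      = bracket q (z₁ - z₂) * bracket q (2 * κ - (z₁ + z₂))
          * (bracket q (x - κ + ω - 2 * z₂) / (bracket q (x - κ + ω) * bracket q (2 * z₂)))
        + bracket q (z₁ - z₂) * bracket q (2 * κ)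
          * (bracket q (2 * (x + ω) - (z₁ + z₂)) / bracket q (2 * (x + ω)))
          * (bracket q (x - κ + ω + 2 * z₁) / bracket q (x - κ + ω)) / bracket q (2 * z₁)
        + bracket q (z₁ + z₂) * bracket q (2 * κ)
          * (bracket q (2 * (x + ω) + (z₁ - z₂)) / bracket q (2 * (x + ω)))
          * (bracket q (x + κ + ω - 2 * z₁) / (bracket q (x + κ + ω) * bracket q (2 * z₁))) := by
    clear hk x1 x2 r1 r2 r3
    generalize bracket q (x + κ + ω - 2 * z₂) = t₁ at base ⊢
    generalize bracket q (x - κ + ω - 2 * z₂) = t₂ at base ⊢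
    generalize bracket q (x - κ + ω + 2 * z₁) = t₃ at base ⊢
    generalize bracket q (x + κ + ω - 2 * z₁) = t₄ at base ⊢
    generalize bracket q (2 * z₁) = t₅ at base hz₁ ⊢
    generalize bracket q (2 * z₂) = t₆ at base hz₂ ⊢
    field_simp
    linear_combination base
  rw [kernel, kernel, kernel]
  linear_combination Complex.exp (-2 * μ * z₂) * baseDiv
    - bracket q (z₁ - z₂) * bracket q (2 * κ)
          * (bracket q (2 * (x + ω) - (z₁ + z₂)) / bracket q (2 * (x + ω)))
          * (bracket q (x - κ + ω + 2 * z₁) / bracket q (x - κ + ω)) / bracket q (2 * z₁) * x1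
    - bracket q (z₁ + z₂) * bracket q (2 * κ)
          * (bracket q (2 * (x + ω) + (z₁ - z₂)) / bracket q (2 * (x + ω)))
          * (bracket q (x + κ + ω - 2 * z₁) / (bracket q (x + κ + ω) * bracket q (2 * z₁))) * x2

end Kernel

/-! ### The four half-periods, the even theta functions and the duplication formula. -/

/-- The half-periods `0, τ/2, 1/2, (1 + τ)/2` of the theta function, where `τ = 2πi / log q`. -/
def halfPeriod (q : ℝ) : Fin 4 → ℂ :=
  ![0, Real.pi * Complex.I / Real.log q, 1 / 2, 1 / 2 + Real.pi * Complex.I / Real.log q]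

/-- The exponents of the multipliers belonging to the half-periods. -/
def halfExponent : Fin 4 → ℂ := ![0, -(Real.pi * Complex.I), 0, -(Real.pi * Complex.I)]

/-- The four Jacobi theta functions. -/
def halfBracket (q : ℝ) (k : Fin 4) (x : ℂ) : ℂ :=
  Complex.exp (halfExponent k * x) * bracket q (x + halfPeriod q k)

section HalfPeriods

variable {q : ℝ} (hq0 : 0 < q) (hq1 : q < 1)
theorem halfBracket_zero_apply (x : ℂ) : halfBracket q 0 x = bracket q x := by
  simp [halfBracket, halfPeriod, halfExponent]

include hq0

theorem bracket_ne_zero_of_theta {x : ℂ} (h : theta q ((q : ℂ) ^ x) ≠ 0) : bracket q x ≠ 0 := by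
  rw [bracket, ofReal_cpow_eq_exp hq0 ((x ^ 2 - x) / 2)]
  exact mul_ne_zero (Complex.exp_ne_zero _) h

include hq1

theorem log_ofReal_ne_zero : (Real.log q : ℂ) ≠ 0 := by
  exact_mod_cast (Real.log_neg hq0 hq1).ne

theorem bracket_add_tau (x : ℂ) :
    bracket q (x + 2 * (Real.pi * Complex.I / Real.log q))
      = -Complex.exp ((Real.pi * Complex.I) ^ 2 * 2 / Real.log q)
        * Complex.exp (2 * (Real.pi * Complex.I) * x) * bracket q x := by
  have hL := log_ofReal_ne_zero hq0 hq1
  simp only [bracket, ofReal_cpow_eq_exp hq0]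
  have e1 : (Real.log q : ℂ) * (x + 2 * (Real.pi * Complex.I / Real.log q))
      = Real.log q * x + 2 * Real.pi * Complex.I := by field_simp
  have e2 : (Real.log q : ℂ) * (((x + 2 * (Real.pi * Complex.I / Real.log q)) ^ 2
        - (x + 2 * (Real.pi * Complex.I / Real.log q))) / 2)
      = (Real.pi * Complex.I) ^ 2 * 2 / Real.log q + 2 * (Real.pi * Complex.I) * x
        + Real.log q * ((x ^ 2 - x) / 2) - Real.pi * Complex.I := by
    field_simp; ring
  rw [e1, e2, Complex.exp_periodic, Complex.exp_sub, Complex.exp_pi_mul_I, Complex.exp_add,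
    Complex.exp_add]
  ring

theorem isHalfPeriod_halfPeriod (k : Fin 4) : IsHalfPeriod q (halfPeriod q k) (halfExponent k) := by
  have h0 : Complex.exp ((Real.pi * Complex.I) ^ 2 * 2 / Real.log q) ≠ 0 := Complex.exp_ne_zero _
  fin_cases k
  · exact ⟨1, one_ne_zero, fun x => by simp [halfPeriod, halfExponent]⟩
  · refine ⟨_, neg_ne_zero.mpr h0, fun x => ?_⟩
    simp only [halfPeriod, halfExponent, Fin.mk_one, Matrix.cons_val_one, Matrix.cons_val_zero]
    rw [bracket_add_tau hq0 hq1]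
    congr 3; ring
  · refine ⟨-1, by simp, fun x => ?_⟩
    have := bracket_add_one hq0 hq1 x
    simpa [halfPeriod, halfExponent] using this
  · refine ⟨_, h0, fun x => ?_⟩
    simp only [halfPeriod, halfExponent, Fin.reduceFinMk, Matrix.cons_val]
    rw [mul_add, ← add_assoc, bracket_add_tau hq0 hq1,
      show x + 2 * (1 / 2) = x + 1 by ring, bracket_add_one hq0 hq1,
      show 2 * (Real.pi * Complex.I) * (x + 1)
        = -2 * -(Real.pi * Complex.I) * x + 2 * Real.pi * Complex.I by ring, Complex.exp_periodic]
    ring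

theorem bracket_neg_add_half (x : ℂ) : bracket q (-x + 1 / 2) = bracket q (x + 1 / 2) := by
  rw [show -x + 1 / 2 = -(x - 1 / 2) by ring, bracket_neg hq0 hq1,
    show x + 1 / 2 = x - 1 / 2 + 1 by ring, bracket_add_one hq0 hq1]

theorem bracket_neg_add_half_tau (x : ℂ) :
    bracket q (-x + Real.pi * Complex.I / Real.log q)
      = Complex.exp (-2 * (Real.pi * Complex.I) * x)
        * bracket q (x + Real.pi * Complex.I / Real.log q) := by
  have hL := log_ofReal_ne_zero hq0 hq1
  have h := bracket_add_tau hq0 hq1 (x - Real.pi * Complex.I / Real.log q)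
  rw [show x - Real.pi * Complex.I / Real.log q + 2 * (Real.pi * Complex.I / Real.log q)
    = x + Real.pi * Complex.I / Real.log q by ring] at h
  have e : Complex.exp (-2 * (Real.pi * Complex.I) * x)
      * (Complex.exp ((Real.pi * Complex.I) ^ 2 * 2 / Real.log q)
      * Complex.exp (2 * (Real.pi * Complex.I) * (x - Real.pi * Complex.I / Real.log q))) = 1 := by
    rw [← Complex.exp_add, ← Complex.exp_add, ← Complex.exp_zero]
    congr 1
    field_simp
    ring
  rw [h, show -x + Real.pi * Complex.I / Real.log q = -(x - Real.pi * Complex.I / Real.log q) by ring,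
    bracket_neg hq0 hq1]
  linear_combination bracket q (x - Real.pi * Complex.I / Real.log q) * e

theorem bracket_neg_add_half_add_half_tau (x : ℂ) :
    bracket q (-x + (1 / 2 + Real.pi * Complex.I / Real.log q))
      = Complex.exp (-2 * (Real.pi * Complex.I) * x)
        * bracket q (x + (1 / 2 + Real.pi * Complex.I / Real.log q)) := by
  rw [show -x + (1 / 2 + Real.pi * Complex.I / Real.log q)
      = -(x - 1 / 2) + Real.pi * Complex.I / Real.log q by ring, bracket_neg_add_half_tau hq0 hq1,
    show x + (1 / 2 + Real.pi * Complex.I / Real.log q)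
      = x - 1 / 2 + Real.pi * Complex.I / Real.log q + 1 by ring, bracket_add_one hq0 hq1,
    show -2 * (Real.pi * Complex.I) * (x - 1 / 2)
      = -2 * (Real.pi * Complex.I) * x + Real.pi * Complex.I by ring, Complex.exp_add,
    Complex.exp_pi_mul_I]
  ring

/-- The exponential in `halfBracket` is exactly half of the multiplier picked up under reflection.
The three theta functions shifted by a nonzero half-period therefore become even, while the
unshifted one is odd. -/
theorem halfBracket_neg {k : Fin 4} (hk : k ≠ 0) (x : ℂ) :
    halfBracket q k (-x) = halfBracket q k x := by
  have e : Complex.exp (-(Real.pi * Complex.I) * -x) * Complex.exp (-2 * (Real.pi * Complex.I) * x)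
      = Complex.exp (-(Real.pi * Complex.I) * x) := by
    rw [← Complex.exp_add]; congr 1; ring
  fin_cases k
  · exact absurd rfl hk
  · simp only [halfBracket, halfPeriod, halfExponent, Fin.mk_one, Matrix.cons_val_one,
      Matrix.cons_val_zero]
    rw [bracket_neg_add_half_tau hq0 hq1, ← mul_assoc, e]
  · simp only [halfBracket, halfPeriod, halfExponent, Fin.reduceFinMk, Matrix.cons_val]
    rw [bracket_neg_add_half hq0 hq1, zero_mul, zero_mul]
  · simp only [halfBracket, halfPeriod, halfExponent, Fin.reduceFinMk, Matrix.cons_val]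
    rw [bracket_neg_add_half_add_half_tau hq0 hq1, ← mul_assoc, e]

theorem continuous_halfBracket (k : Fin 4) : Continuous (halfBracket q k) := by
  have := continuous_bracket hq0 hq1
  unfold halfBracket
  fun_prop

theorem theta_ne_zero {x : ℂ} (h1 : ∀ j : ℕ, 1 - (q : ℂ) ^ j * x ≠ 0)
    (h2 : ∀ j : ℕ, 1 - (q : ℂ) ^ (j + 1) / x ≠ 0) : theta q x ≠ 0 := by
  have s1 : Summable fun j : ℕ => ‖-((q : ℂ) ^ j * x)‖ := by
    simpa using (summable_qpow hq0 hq1).mul_right ‖x‖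
  have s2 : Summable fun j : ℕ => ‖-((q : ℂ) ^ (j + 1) / x)‖ := by
    have := ((summable_nat_add_iff 1).mpr (summable_qpow hq0 hq1)).mul_right ‖x⁻¹‖
    simpa [div_eq_mul_inv] using this
  have n1 := tprod_one_add_ne_zero_of_summable (fun j => by rw [← sub_eq_add_neg]; exact h1 j) s1
  have n2 := tprod_one_add_ne_zero_of_summable (fun j => by rw [← sub_eq_add_neg]; exact h2 j) s2
  rw [theta]
  simp only [sub_eq_add_neg]
  rw [(multipliable_one_add_of_summable s1).tprod_mul (multipliable_one_add_of_summable s2)]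
  exact mul_ne_zero n1 n2

theorem bracket_halfPeriod_ne_zero {k : Fin 4} (hk : k ≠ 0) : bracket q (halfPeriod q k) ≠ 0 := by
  have hL := log_ofReal_ne_zero hq0 hq1
  refine bracket_ne_zero_of_theta hq0 ?_
  have hhalf : ‖(q : ℂ) ^ (1 / 2 : ℂ)‖ < 1 ∧ ‖(q : ℂ) / (q : ℂ) ^ (1 / 2 : ℂ)‖ < 1 := by
    have h1 : ‖(q : ℂ) ^ (1 / 2 : ℂ)‖ = q ^ (1 / 2 : ℝ) := by
      rw [Complex.norm_cpow_eq_rpow_re_of_pos hq0]; norm_num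
    have h2 : q ^ (1 / 2 : ℝ) < 1 := Real.rpow_lt_one hq0.le hq1 (by norm_num)
    have h3 : (0 : ℝ) < q ^ (1 / 2 : ℝ) := Real.rpow_pos_of_pos hq0 _
    have h4 : q ^ (1 / 2 : ℝ) * q ^ (1 / 2 : ℝ) = q := by
      rw [← Real.rpow_add hq0]; norm_num
    rw [norm_div, h1, Complex.norm_real, Real.norm_of_nonneg hq0.le, div_lt_one h3]
    exact ⟨h2, by nlinarith⟩
  have hsmall : ∀ x : ℂ, ‖x‖ < 1 → ‖(q : ℂ) / x‖ < 1 → theta q x ≠ 0 := fun x hx hx' => by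
    have hpow : ∀ j : ℕ, ‖(q : ℂ) ^ j‖ ≤ 1 := fun j => by
      rw [norm_pow, Complex.norm_real, Real.norm_of_nonneg hq0.le]
      exact pow_le_one₀ hq0.le hq1.le
    have hne : ∀ y : ℂ, ‖y‖ < 1 → 1 - y ≠ 0 := fun y hy h => by
      rw [← sub_eq_zero.mp h, norm_one] at hy
      exact lt_irrefl _ hy
    refine theta_ne_zero hq0 hq1 (fun j => hne _ ?_) fun j => hne _ ?_
    · rw [norm_mul]
      exact (mul_le_of_le_one_left (norm_nonneg _) (hpow j)).trans_lt hx
    · rw [pow_succ, mul_div_assoc, norm_mul]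
      exact (mul_le_of_le_one_left (norm_nonneg _) (hpow j)).trans_lt hx'
  have hpi : (Real.log q : ℂ) * (Real.pi * Complex.I / Real.log q) = Real.pi * Complex.I := by
    field_simp
  fin_cases k
  · exact absurd rfl hk
  · simp only [halfPeriod, Fin.mk_one, Matrix.cons_val_one, Matrix.cons_val_zero]
    rw [ofReal_cpow_eq_exp hq0, hpi, Complex.exp_pi_mul_I]
    exact theta_neg_one_ne_zero hq0 hq1
  · simp only [halfPeriod, Fin.reduceFinMk, Matrix.cons_val]
    exact hsmall _ hhalf.1 hhalf.2
  · simp only [halfPeriod, Fin.reduceFinMk, Matrix.cons_val]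
    have : (q : ℂ) ^ (1 / 2 + Real.pi * Complex.I / Real.log q) = -(q : ℂ) ^ (1 / 2 : ℂ) := by
      rw [ofReal_cpow_eq_exp hq0, ofReal_cpow_eq_exp hq0, mul_add, hpi, Complex.exp_add,
        Complex.exp_pi_mul_I, mul_neg_one]
    rw [this]
    refine hsmall _ (by rw [norm_neg]; exact hhalf.1) (by rw [div_neg, norm_neg]; exact hhalf.2)

/-- Up to sign, every difference is itself a nonzero half-period, except ω₂ - ω₁, which differs from
ω₃ by the period 2ω₁. The lemma makes the poles of the expansion distinct. -/
theorem bracket_halfPeriod_sub_ne_zero {j k : Fin 4} (h : j ≠ k) :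
    bracket q (halfPeriod q j - halfPeriod q k) ≠ 0 := by
  have h1 : bracket q (halfPeriod q 1) ≠ 0 := bracket_halfPeriod_ne_zero hq0 hq1 (by decide)
  have h2 : bracket q (halfPeriod q 2) ≠ 0 := bracket_halfPeriod_ne_zero hq0 hq1 (by decide)
  have h3 : bracket q (halfPeriod q 3) ≠ 0 := bracket_halfPeriod_ne_zero hq0 hq1 (by decide)
  have h21 : bracket q (halfPeriod q 2 - halfPeriod q 1) ≠ 0 := by
    obtain ⟨ε, -, he⟩ := isHalfPeriod_halfPeriod hq0 hq1 1
    have := he (halfPeriod q 2 - halfPeriod q 1)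
    rw [show halfPeriod q 2 - halfPeriod q 1 + 2 * halfPeriod q 1 = halfPeriod q 3 by
      simp [halfPeriod]; ring] at this
    intro h0
    rw [h0, mul_zero] at this
    exact h3 this
  have e0 : halfPeriod q 0 = 0 := rfl
  have e31 : halfPeriod q 3 - halfPeriod q 1 = halfPeriod q 2 := by simp [halfPeriod]
  have e32 : halfPeriod q 3 - halfPeriod q 2 = halfPeriod q 1 := by simp [halfPeriod]
  have main : ∀ j k : Fin 4, k < j → bracket q (halfPeriod q j - halfPeriod q k) ≠ 0 := by
    intro j k hkj
    fin_cases j <;> fin_cases k <;> first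
      | exact absurd hkj (by decide)
      | (simp only [Fin.mk_one, Fin.zero_eta, Fin.reduceFinMk, e0, sub_zero, e31, e32]; assumption)
  rcases lt_or_gt_of_ne h with h | h
  · rw [bracket_sub_comm hq0 hq1, neg_ne_zero]
    exact main _ _ h
  · exact main _ _ h

/-- Factors 2n and 2n + 1 on the left split as differences of squares into the n-th factors of the
four thetas on the right. Partial products of lengths 2n and n therefore agree exactly. -/
theorem theta_sq {X Y : ℂ} (hY : Y ^ 2 = q) (hX : X ≠ 0) :
    theta q (X ^ 2) = theta q X * theta q (-X) * theta q (Y * X) * theta q (-(Y * X)) := by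
  have hY0 : Y ≠ 0 := by
    rintro rfl
    have : (q : ℂ) ≠ 0 := by exact_mod_cast hq0.ne'
    simp at hY; exact this hY.symm
  have hfin : ∀ n : ℕ, ∏ j ∈ range (2 * n), (1 - (q : ℂ) ^ j * X ^ 2) * (1 - (q : ℂ) ^ (j + 1) / X ^ 2)
      = (∏ j ∈ range n, (1 - (q : ℂ) ^ j * X) * (1 - (q : ℂ) ^ (j + 1) / X))
        * (∏ j ∈ range n, (1 - (q : ℂ) ^ j * -X) * (1 - (q : ℂ) ^ (j + 1) / -X))
        * (∏ j ∈ range n, (1 - (q : ℂ) ^ j * (Y * X)) * (1 - (q : ℂ) ^ (j + 1) / (Y * X)))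
        * (∏ j ∈ range n, (1 - (q : ℂ) ^ j * -(Y * X)) * (1 - (q : ℂ) ^ (j + 1) / -(Y * X))) := by
    intro n
    induction n with
    | zero => simp
    | succ n ih =>
      rw [show 2 * (n + 1) = 2 * n + 1 + 1 by ring, prod_range_succ, prod_range_succ, ih]
      simp only [prod_range_succ]
      have e1 : (q : ℂ) ^ (2 * n) = ((q : ℂ) ^ n) ^ 2 := by ring
      simp only [pow_succ _ (2 * n + 1), pow_succ _ (2 * n), pow_succ _ n, e1]
      generalize (q : ℂ) ^ n = W
      have f1 : (1 - W ^ 2 * X ^ 2) = (1 - W * X) * (1 - W * -X) := by ring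
      have f2 : (1 - W ^ 2 * q / X ^ 2)
          = (1 - W * q / (Y * X)) * (1 - W * q / -(Y * X)) := by rw [← hY]; field_simp; ring
      have f3 : (1 - W ^ 2 * q * X ^ 2) = (1 - W * (Y * X)) * (1 - W * -(Y * X)) := by
        rw [← hY]; ring
      have f4 : (1 - W ^ 2 * q * q / X ^ 2)
          = (1 - W * q / X) * (1 - W * q / -X) := by field_simp; ring
      rw [f1, f2, f3, f4]
      ring
  have h2 : Tendsto (fun n : ℕ => 2 * n) atTop atTop :=
    tendsto_atTop_mono (fun n => by rw [id]; omega) tendsto_id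
  refine tendsto_nhds_unique ((tendsto_theta hq0 hq1 (X ^ 2)).comp h2) ?_
  refine Tendsto.congr (fun n => (hfin n).symm) ?_
  exact (((tendsto_theta hq0 hq1 _).mul (tendsto_theta hq0 hq1 _)).mul
    (tendsto_theta hq0 hq1 _)).mul (tendsto_theta hq0 hq1 _)

/-- The duplication formula. -/
theorem exists_bracket_two_mul : ∃ C : ℂ, C ≠ 0 ∧ ∀ x,
    bracket q (2 * x) = C * ∏ k, halfBracket q k x := by
  have hL := log_ofReal_ne_zero hq0 hq1
  set L : ℂ := (Real.log q : ℂ) with hLdef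
  set w : ℂ := Real.pi * Complex.I with hw
  refine ⟨Complex.exp (-(L / 2 * ((w / L) ^ 2 - w / L + ((1 / 2) ^ 2 - 1 / 2)
    + ((1 / 2 + w / L) ^ 2 - (1 / 2 + w / L))))), Complex.exp_ne_zero _, fun x => ?_⟩
  have hY : ((q : ℂ) ^ (1 / 2 : ℂ)) ^ 2 = q := by
    rw [← Complex.cpow_nat_mul]; norm_num
  have hX : Complex.exp (L * x) ≠ 0 := Complex.exp_ne_zero _
  have key := theta_sq hq0 hq1 hY hX
  have n1 : -Complex.exp (L * x) = Complex.exp (L * (x + w / L)) := by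
    rw [mul_add, mul_div_cancel₀ _ hL, Complex.exp_add, Complex.exp_pi_mul_I, mul_neg_one]
  have n2 : (q : ℂ) ^ (1 / 2 : ℂ) * Complex.exp (L * x) = Complex.exp (L * (x + 1 / 2)) := by
    rw [ofReal_cpow_eq_exp hq0, ← Complex.exp_add]; congr 1; ring
  have n3 : -((q : ℂ) ^ (1 / 2 : ℂ) * Complex.exp (L * x))
      = Complex.exp (L * (x + (1 / 2 + w / L))) := by
    rw [n2, ← add_assoc, mul_add L (x + 1 / 2), mul_div_cancel₀ _ hL, Complex.exp_add,
      Complex.exp_pi_mul_I, mul_neg_one]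
  rw [n1, n3, n2, ← Complex.exp_nat_mul] at key
  have hx2 : ((2 : ℕ) : ℂ) * (L * x) = L * (2 * x) := by push_cast; ring
  rw [hx2] at key
  rw [Fin.prod_univ_four]
  simp only [halfBracket, halfPeriod, halfExponent, Matrix.cons_val, bracket,
    ofReal_cpow_eq_exp hq0, ← hLdef, ← hw, key, add_zero, zero_mul, Complex.exp_zero, one_mul]
  have : ∀ A B a1 a2 a3 a4 m1 m3 t0 t1 t2 t3 : ℂ, A = B + a1 + (m1 + a2) + a3 + (m3 + a4) →
      Complex.exp A * (t0 * t1 * t2 * t3) = Complex.exp B * (Complex.exp a1 * t0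
        * (Complex.exp m1 * (Complex.exp a2 * t1)) * (Complex.exp a3 * t2)
        * (Complex.exp m3 * (Complex.exp a4 * t3))) := by
    intro A B a1 a2 a3 a4 m1 m3 t0 t1 t2 t3 h
    rw [h]; simp only [Complex.exp_add]; ring
  refine this _ _ _ _ _ _ _ _ _ _ _ _ ?_
  field_simp
  ring

end HalfPeriods

/-! ### Expansion of the diagonal boundary weight in Kronecker kernels. -/

section Expansion

variable {q : ℝ}

/-- Coefficients of the expansion of the diagonal boundary weight in Kronecker kernels. -/
def expansionCoeff (q : ℝ) (C : ℂ) (a : Fin 4 → ℂ) (k : Fin 4) : ℂ :=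
  -(C⁻¹ * Complex.exp (-(Real.pi * Complex.I) * (a 1 + a 3))
    * (∏ j, if j = k then bracket q (a j)
        else bracket q (halfPeriod q j - halfPeriod q k + a j)
          / bracket q (halfPeriod q j - halfPeriod q k))
    * ![1, Complex.exp (Real.pi * Complex.I * (a 0 + a 1 + a 2 + a 3)), 1,
        -Complex.exp (Real.pi * Complex.I * (a 0 + a 1 + a 2 + a 3))] k)

/-- The product of Jacobi theta functions `∏ θ_k(ξ + a_k) / θ(2ξ)`. -/
def thetaQuotient (q : ℝ) (a : Fin 4 → ℂ) (ξ : ℂ) : ℂ :=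
  (∏ k, halfBracket q k (ξ + a k)) / bracket q (2 * ξ)

/-- By duplication each half-period theta divides [2x], so the single condition [2x] ≠ 0 excludes
the poles of all four kernels. -/
theorem bracket_add_halfPeriod_ne_zero {C : ℂ}
    (hdup : ∀ x, bracket q (2 * x) = C * ∏ k, halfBracket q k x) {x : ℂ} (hx : bracket q (2 * x) ≠ 0) (k : Fin 4) :
    bracket q (x + halfPeriod q k) ≠ 0 := by
  rw [hdup] at hx
  have := prod_ne_zero_iff.mp (right_ne_zero_of_mul hx) k (mem_univ k)
  exact right_ne_zero_of_mul this

/-- Duplication of the denominator gives a product of quotients [ξ + ω_k + a_k]/[ξ + ω_k], ready for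
partial fractions. The exponentials in ξ cancel. -/
theorem thetaQuotient_eq {C : ℂ}
    (hdup : ∀ x, bracket q (2 * x) = C * ∏ k, halfBracket q k x) (a : Fin 4 → ℂ) {ξ : ℂ} (hξ : bracket q (2 * ξ) ≠ 0) :
    thetaQuotient q a ξ = C⁻¹ * Complex.exp (-(Real.pi * Complex.I) * (a 1 + a 3))
      * ∏ k, bracket q (ξ + halfPeriod q k + a k) / bracket q (ξ + halfPeriod q k) := by
  have hne := bracket_add_halfPeriod_ne_zero hdup hξ
  rw [thetaQuotient, hdup, prod_div_distrib]
  have e : ∏ k, halfBracket q k (ξ + a k) = Complex.exp (-(Real.pi * Complex.I) * (a 1 + a 3))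
      * Complex.exp (-(Real.pi * Complex.I) * (2 * ξ))
      * ∏ k, bracket q (ξ + halfPeriod q k + a k) := by
    simp only [halfBracket, prod_mul_distrib, add_right_comm ξ (a _)]
    rw [← Complex.exp_sum, ← Complex.exp_add, Fin.sum_univ_four]
    congr 2
    simp only [halfExponent, Matrix.cons_val]
    ring
  have e' : ∏ k, halfBracket q k ξ = Complex.exp (-(Real.pi * Complex.I) * (2 * ξ))
      * ∏ k, bracket q (ξ + halfPeriod q k) := by
    simp only [halfBracket, prod_mul_distrib]
    rw [← Complex.exp_sum, Fin.sum_univ_four]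
    congr 2
    simp only [halfExponent, Matrix.cons_val]
    ring
  rw [e, e']
  have h1 := Complex.exp_ne_zero (-(Real.pi * Complex.I) * (2 * ξ))
  have h2 : ∏ k, bracket q (ξ + halfPeriod q k) ≠ 0 := prod_ne_zero_iff.mpr fun k _ => hne k
  generalize Complex.exp (-(Real.pi * Complex.I) * (2 * ξ)) = A at *
  field_simp

theorem eq_of_eventually_eq {f g : ℂ → ℂ} (hf : Continuous f) (hg : Continuous g)
    (h : ∀ᶠ t in 𝓝[≠] (0 : ℂ), f t = g t) : f 0 = g 0 :=
  tendsto_nhds_unique_of_eventuallyEq ((hf.tendsto 0).mono_left nhdsWithin_le_nhds)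
    ((hg.tendsto 0).mono_left nhdsWithin_le_nhds) h

variable (hq0 : 0 < q) (hq1 : q < 1)
include hq0 hq1

/-- The five-pole case with one pole singled out. The conditions on partial sums of the shifts are
those required by the inductive expansion. -/
theorem bracket_partialFraction_fin (c d : Fin 4 → ℂ) (c' d' x : ℂ)
    (hc : ∀ i j, i ≠ j → bracket q (c i - c j) ≠ 0) (hc' : ∀ i, bracket q (c i - c') ≠ 0)
    (h1 : bracket q (d 0) ≠ 0) (h2 : bracket q (d 0 + d 1) ≠ 0)
    (h3 : bracket q (d 0 + d 1 + d 2) ≠ 0) (h4 : bracket q (d 0 + d 1 + d 2 + d 3) ≠ 0)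
    (h5 : bracket q (d 0 + d 1 + d 2 + d 3 + d') ≠ 0)
    (hx : ∀ i, bracket q (x - c i) ≠ 0) (hx' : bracket q (x - c') ≠ 0) :
    (∏ k, bracket q (x - c k + d k) / bracket q (x - c k))
        * (bracket q (x - c' + d') / bracket q (x - c'))
      = (∑ k, (∏ j, if j = k then bracket q (d j)
              else bracket q (c k - c j + d j) / bracket q (c k - c j))
            * (bracket q (c k - c' + d') / bracket q (c k - c'))
            * (bracket q (x - c k + (d 0 + d 1 + d 2 + d 3 + d'))
              / (bracket q (x - c k) * bracket q (d 0 + d 1 + d 2 + d 3 + d'))))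
        + (∏ j, bracket q (c' - c j + d j) / bracket q (c' - c j)) * bracket q d'
          * (bracket q (x - c' + (d 0 + d 1 + d 2 + d 3 + d'))
            / (bracket q (x - c') * bracket q (d 0 + d 1 + d 2 + d 3 + d'))) := by
  let C : ℕ → ℂ := fun n => if h : n < 4 then c ⟨n, h⟩ else c'
  let D : ℕ → ℂ := fun n => if h : n < 4 then d ⟨n, h⟩ else d'
  have hC : ∀ i : Fin 4, C i = c i := fun i => by simp [C]
  have hD : ∀ i : Fin 4, D i = d i := fun i => by simp [D]
  have hC4 : C 4 = c' := by simp [C]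
  have hD4 : D 4 = d' := by simp [D]
  have hC' : ∀ i (h : i < 4), C i = c ⟨i, h⟩ := fun i h => by simp [C, h]
  have e0 : D 0 = d 0 := hD 0
  have e1 : D 1 = d 1 := hD 1
  have e2 : D 2 = d 2 := hD 2
  have e3 : D 3 = d 3 := hD 3
  have hsum : ∑ j ∈ range (4 + 1), D j = d 0 + d 1 + d 2 + d 3 + d' := by
    simp [sum_range_succ, e0, e1, e2, e3, hD4]
  have h := bracket_partialFraction hq0 hq1 C D 4 ?_ ?_ x ?_
  · rw [prod_range_succ, sum_range_succ, hsum, prod_range, sum_range, hC4, hD4,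
      prod_range_succ _ 4, if_pos rfl, prod_range, hD4] at h
    simp only [hC, hD] at h
    rw [h]
    congr 1
    refine sum_congr rfl fun k _ => ?_
    rw [prod_range_succ, prod_range, if_neg k.2.ne', hC4, hD4]
    simp only [hC, hD, Fin.val_inj]
  · intro i hi j hj hij
    by_cases hi4 : i < 4
    · by_cases hj4 : j < 4
      · rw [hC' i hi4, hC' j hj4]
        exact hc _ _ (by simpa using hij)
      · obtain rfl : j = 4 := by omega
        rw [hC' i hi4, hC4]
        exact hc' _
    · obtain rfl : i = 4 := by omega
      have hj4 : j < 4 := by omega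
      rw [hC' j hj4, hC4, bracket_sub_comm hq0 hq1, neg_ne_zero]
      exact hc' _
  · intro m hm
    interval_cases m <;> simp [sum_range_succ, *]
  · intro i hi
    by_cases hi4 : i < 4
    · rw [hC' i hi4]
      exact hx _
    · obtain rfl : i = 4 := by omega
      rw [hC4]
      exact hx'

/-- This evaluates the fifth factor at the pole -ω_k. Since ω₃ - ω_k is again a half-period,
reflection reduces the quotient to a sign and an exponential. After the kernel's own exponential is
accounted for, only s remains, which is why the expansion coefficients do not depend on z. -/
theorem bracket_ratio_halfPeriod (y s z : ℂ) (hy : y = z + s)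
    (hne : ∀ k, bracket q (y + halfPeriod q 3 - halfPeriod q k) ≠ 0) (k : Fin 4) :
    Complex.exp (2 * (Real.pi * Complex.I) * y)
        * (bracket q (y + halfPeriod q 3 - halfPeriod q k + -(2 * y))
          / bracket q (y + halfPeriod q 3 - halfPeriod q k))
        * Complex.exp (2 * halfExponent k * z)
      = ![1, Complex.exp (2 * (Real.pi * Complex.I) * s), 1,
        -Complex.exp (2 * (Real.pi * Complex.I) * s)] k := by
  have hk := hne k
  have e1 : Complex.exp (2 * (Real.pi * Complex.I) * y) * Complex.exp (-2 * (Real.pi * Complex.I) * y)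
      = 1 := by
    rw [← Complex.exp_add, ← Complex.exp_zero]; congr 1; ring
  have e2 : Complex.exp (2 * (Real.pi * Complex.I) * y) * Complex.exp (2 * -(Real.pi * Complex.I) * z)
      = Complex.exp (2 * (Real.pi * Complex.I) * s) := by
    rw [← Complex.exp_add, hy]; congr 1; ring
  fin_cases k
  · simp only [halfPeriod, halfExponent, Fin.zero_eta, Matrix.cons_val, sub_zero, mul_zero,
      zero_mul, Complex.exp_zero, mul_one] at hk ⊢
    rw [show y + (1 / 2 + Real.pi * Complex.I / Real.log q) + -(2 * y)
      = -y + (1 / 2 + Real.pi * Complex.I / Real.log q) by ring,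
      bracket_neg_add_half_add_half_tau hq0 hq1, mul_div_assoc, div_self hk, mul_one, e1]
  · simp only [halfPeriod, halfExponent, Fin.mk_one, Matrix.cons_val] at hk ⊢
    rw [show y + (1 / 2 + Real.pi * Complex.I / Real.log q) - Real.pi * Complex.I / Real.log q
      = y + 1 / 2 by ring] at hk ⊢
    rw [show y + 1 / 2 + -(2 * y) = -y + 1 / 2 by ring, bracket_neg_add_half hq0 hq1,
      div_self hk, mul_one, e2]
  · simp only [halfPeriod, halfExponent, Fin.reduceFinMk, Matrix.cons_val, mul_zero,
      zero_mul, Complex.exp_zero, mul_one] at hk ⊢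
    rw [show y + (1 / 2 + Real.pi * Complex.I / Real.log q) - 1 / 2
      = y + Real.pi * Complex.I / Real.log q by ring] at hk ⊢
    rw [show y + Real.pi * Complex.I / Real.log q + -(2 * y)
      = -y + Real.pi * Complex.I / Real.log q by ring,
      bracket_neg_add_half_tau hq0 hq1, mul_div_assoc, div_self hk, mul_one, e1]
  · simp only [halfPeriod, halfExponent, Fin.reduceFinMk, Matrix.cons_val,
      add_sub_cancel_right] at hk ⊢
    rw [show y + -(2 * y) = -y by ring, bracket_neg hq0 hq1, neg_div, div_self hk, mul_neg_one,
      neg_mul, e2]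

/-- Half-periods pair up as ω_k + ω_(3-k) = ω₃, so reflection reverses their order. This is the
origin of the reversed and negated parameters, that is, of the duality. -/
theorem prod_bracket_reflect (a : Fin 4 → ℂ) (y : ℂ) :
    ∏ j, bracket q (halfPeriod q j - (y + halfPeriod q 3) + a j)
        / bracket q (halfPeriod q j - (y + halfPeriod q 3))
      = ∏ k, bracket q (y + halfPeriod q k + ![-a 3, -a 2, -a 1, -a 0] k)
        / bracket q (y + halfPeriod q k) := by
  have h : ∀ i j : Fin 4, halfPeriod q i + halfPeriod q j = halfPeriod q 3 →
      ∀ t, bracket q (halfPeriod q j - (y + halfPeriod q 3) + t)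
          / bracket q (halfPeriod q j - (y + halfPeriod q 3))
        = bracket q (y + halfPeriod q i + -t) / bracket q (y + halfPeriod q i) := by
    intro i j hij t
    rw [← hij, show halfPeriod q j - (y + (halfPeriod q i + halfPeriod q j)) + t
        = -(y + halfPeriod q i + -t) by ring,
      show halfPeriod q j - (y + (halfPeriod q i + halfPeriod q j)) = -(y + halfPeriod q i) by ring,
      bracket_neg hq0 hq1, bracket_neg hq0 hq1, neg_div_neg_eq]
  rw [Fin.prod_univ_four, Fin.prod_univ_four, h 3 0 (by simp [halfPeriod]),
    h 2 1 (by simp [halfPeriod]), h 1 2 (by simp [halfPeriod]; ring), h 0 3 (by simp [halfPeriod])]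
  simp only [Matrix.cons_val]
  ring

theorem continuous_thetaQuotient (ξ : ℂ) : Continuous fun a : Fin 4 → ℂ => thetaQuotient q a ξ := by
  have := continuous_halfBracket hq0 hq1
  unfold thetaQuotient
  refine Continuous.div_const (continuous_finsetProd _ fun k _ => ?_) _
  exact (this k).comp (by fun_prop)

theorem continuous_expansionCoeff (C : ℂ) (k : Fin 4) :
    Continuous fun a : Fin 4 → ℂ => expansionCoeff q C a k := by
  have hb := continuous_bracket hq0 hq1
  unfold expansionCoeff
  refine ((Continuous.mul (by fun_prop) (continuous_finsetProd _ fun j _ => ?_)).mul ?_).neg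
  · split_ifs
    · fun_prop
    · fun_prop
  · fin_cases k <;> simp only [Matrix.cons_val, Fin.zero_eta, Fin.mk_one, Fin.reduceFinMk] <;>
      fun_prop

variable {C : ℂ} (hC : C ≠ 0) (hdup : ∀ x, bracket q (2 * x) = C * ∏ k, halfBracket q k x)
include hC hdup

/-- The expansion of the diagonal boundary weight in Kronecker kernels, for generic parameters. -/
theorem thetaQuotient_expansion_of_generic (a : Fin 4 → ℂ) {s z ξ : ℂ}
    (hs : a 0 + a 1 + a 2 + a 3 = 2 * s)
    (h1 : bracket q (a 0) ≠ 0) (h2 : bracket q (a 0 + a 1) ≠ 0)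
    (h3 : bracket q (a 0 + a 1 + a 2) ≠ 0) (h4 : bracket q (2 * s) ≠ 0)
    (hz : bracket q (2 * z) ≠ 0) (hξ : bracket q (2 * ξ) ≠ 0)
    (hy : bracket q (2 * (z + s)) ≠ 0) (hξy : bracket q (ξ + (z + s + halfPeriod q 3)) ≠ 0) :
    thetaQuotient q a ξ * halfBracket q 3 (ξ - z - s)
        - thetaQuotient q ![s - a 3, s - a 2, s - a 1, s - a 0] z * halfBracket q 3 (z - ξ - s)
      = halfBracket q 3 (z + ξ + s) * ∑ k, expansionCoeff q C a k
          * kernel q (halfPeriod q k) (halfExponent k) z ξ := by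
  obtain ⟨y, hydef⟩ : ∃ y, y = z + s := ⟨_, rfl⟩
  rw [← hydef] at hy hξy
  have hyk := bracket_add_halfPeriod_ne_zero hdup hy
  have hyk' : ∀ k, bracket q (y + halfPeriod q 3 - halfPeriod q k) ≠ 0 := by
    intro k
    fin_cases k
    · simpa [halfPeriod] using hyk 3
    · simpa [halfPeriod, add_sub_assoc] using hyk 2
    · simpa [halfPeriod, add_sub_assoc] using hyk 1
    · simpa [halfPeriod, add_sub_assoc] using hyk 0
  have hσ : a 0 + a 1 + a 2 + a 3 + -(2 * y) = -(2 * z) := by rw [hs, hydef]; ring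
  -- Poles -ω_k with shifts a_k, and a fifth pole -(y + ω₃) with shift -2y. The total shift is 2s -
  -- 2y = -2z, so each half-period term is a kernel in (z, ξ). The fifth factor is θ₃(ξ - y)/θ₃(ξ +
  -- y) up to an exponential.
  have pf := bracket_partialFraction_fin hq0 hq1 (fun k => -halfPeriod q k) a
    (-(y + halfPeriod q 3)) (-(2 * y)) ξ
    (fun i j hij => by
      rw [neg_sub_neg]; exact bracket_halfPeriod_sub_ne_zero hq0 hq1 hij.symm)
    (fun i => by rw [neg_sub_neg]; exact hyk' i) h1 h2 h3 (by rw [hs]; exact h4)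
    (by rw [hσ, bracket_neg hq0 hq1, neg_ne_zero]; exact hz)
    (fun i => by rw [sub_neg_eq_add]; exact bracket_add_halfPeriod_ne_zero hdup hξ i)
    (by rw [sub_neg_eq_add]; exact hξy)
  simp only [sub_neg_eq_add, neg_add_eq_sub, hσ] at pf
  rw [prod_bracket_reflect hq0 hq1] at pf
  have hratio := bracket_ratio_halfPeriod hq0 hq1 y s z hydef hyk'
  have hPξ := thetaQuotient_eq hdup a hξ
  have hQ : thetaQuotient q ![s - a 3, s - a 2, s - a 1, s - a 0] z
      = bracket q (2 * y) / bracket q (2 * z)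
        * thetaQuotient q ![-a 3, -a 2, -a 1, -a 0] y := by
    rw [thetaQuotient, thetaQuotient, div_mul_div_comm, mul_comm (bracket q (2 * y)),
      mul_div_mul_right _ _ hy]
    congr 1
    refine prod_congr rfl fun k _ => congrArg _ ?_
    rw [hydef]
    fin_cases k <;> simp only [Matrix.cons_val, Fin.zero_eta, Fin.mk_one, Fin.reduceFinMk] <;> ring
  rw [thetaQuotient_eq hdup _ hy] at hQ
  simp only [Matrix.cons_val] at hQ
  set Pξ := ∏ k, bracket q (ξ + halfPeriod q k + a k) / bracket q (ξ + halfPeriod q k)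
  set Py := ∏ k, bracket q (y + halfPeriod q k + ![-a 3, -a 2, -a 1, -a 0] k)
        / bracket q (y + halfPeriod q k)
  set w : ℂ := Real.pi * Complex.I with hw
  set N := Complex.exp (-w * (ξ + y)) * bracket q (ξ + (y + halfPeriod q 3)) with hN
  set A := C⁻¹ * Complex.exp (-w * (a 1 + a 3)) with hA
  have hN' : halfBracket q 3 (z + ξ + s) = N := by
    rw [halfBracket, hN, hydef]
    simp only [halfExponent, Matrix.cons_val, ← hw]
    congr 2 <;> ring
  have t1 : halfBracket q 3 (ξ - z - s) = N * Complex.exp (2 * w * y)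
      * (bracket q (ξ + (y + halfPeriod q 3) + -(2 * y)) / bracket q (ξ + (y + halfPeriod q 3))) := by
    have e : Complex.exp (-w * (ξ - z - s)) = Complex.exp (-w * (ξ + y)) * Complex.exp (2 * w * y) := by
      rw [← Complex.exp_add, hydef]; congr 1; ring
    rw [halfBracket, hN]
    simp only [halfExponent, Matrix.cons_val, ← hw]
    rw [e, show ξ - z - s + halfPeriod q 3 = ξ + (y + halfPeriod q 3) + -(2 * y) by rw [hydef]; ring]
    field_simp
  have t2 : bracket q (2 * y) / bracket q (2 * z) * (C⁻¹ * Complex.exp (-w * (-a 2 + -a 0)) * Py)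
        * halfBracket q 3 (z - ξ - s)
      = N * Complex.exp (2 * w * y) * (A * (Py * bracket q (-(2 * y)) *
        (bracket q (ξ + (y + halfPeriod q 3) + -(2 * z))
          / (bracket q (ξ + (y + halfPeriod q 3)) * bracket q (-(2 * z)))))) := by
    have e : Complex.exp (-w * (-a 2 + -a 0)) * Complex.exp (-w * (ξ + s - z))
        = Complex.exp (-w * (ξ + y)) * Complex.exp (2 * w * y) * Complex.exp (-w * (a 1 + a 3)) := by
      rw [← Complex.exp_add, ← Complex.exp_add, ← Complex.exp_add, hydef]; congr 1
      linear_combination w * hs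
    rw [show z - ξ - s = -(ξ + s - z) by ring, halfBracket_neg hq0 hq1 (by decide), halfBracket, hN, hA]
    simp only [halfExponent, Matrix.cons_val, ← hw]
    rw [show ξ + s - z + halfPeriod q 3 = ξ + (y + halfPeriod q 3) + -(2 * z) by rw [hydef]; ring,
      bracket_neg hq0 hq1, bracket_neg hq0 hq1]
    generalize bracket q (2 * z) = bz at hz ⊢
    generalize bracket q (2 * y) = b_y at hy ⊢
    generalize bracket q (ξ + (y + halfPeriod q 3) + -(2 * z)) = b1
    generalize bracket q (ξ + (y + halfPeriod q 3)) = b2 at hξy ⊢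
    generalize Complex.exp (-w * (-a 2 + -a 0)) = E1 at e ⊢
    generalize Complex.exp (-w * (ξ + s - z)) = E2 at e ⊢
    generalize Complex.exp (-w * (ξ + y)) = E3 at e ⊢
    generalize Complex.exp (2 * w * y) = E4 at e ⊢
    generalize Complex.exp (-w * (a 1 + a 3)) = E5 at e ⊢
    field_simp
    linear_combination Py * b1 * e
  have t3 : ∀ k, expansionCoeff q C a k * kernel q (halfPeriod q k) (halfExponent k) z ξ
      = A * Complex.exp (2 * w * y) * ((∏ j, if j = k then bracket q (a j)
            else bracket q (halfPeriod q j - halfPeriod q k + a j)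
              / bracket q (halfPeriod q j - halfPeriod q k))
          * (bracket q (y + halfPeriod q 3 - halfPeriod q k + -(2 * y))
            / bracket q (y + halfPeriod q 3 - halfPeriod q k))
          * (bracket q (ξ + halfPeriod q k + -(2 * z))
            / (bracket q (ξ + halfPeriod q k) * bracket q (-(2 * z))))) := by
    intro k
    have hexp : Complex.exp (2 * halfExponent k * z) * Complex.exp (-2 * halfExponent k * z) = 1 := by
      rw [← Complex.exp_add, ← Complex.exp_zero]; congr 1; ring
    have e : w * (a 0 + a 1 + a 2 + a 3) = 2 * w * s := by rw [hs]; ring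
    rw [expansionCoeff, kernel, ← hw, ← hA, e, ← hratio k, bracket_neg hq0 hq1, ← sub_eq_add_neg _ (2 * z)]
    generalize (∏ j, if j = k then bracket q (a j)
            else bracket q (halfPeriod q j - halfPeriod q k + a j)
              / bracket q (halfPeriod q j - halfPeriod q k)) = R
    generalize bracket q (y + halfPeriod q 3 - halfPeriod q k + -(2 * y))
            / bracket q (y + halfPeriod q 3 - halfPeriod q k) = ρ
    rw [mul_neg, div_neg, mul_comm (Complex.exp (-2 * halfExponent k * z)), mul_div_right_comm]
    linear_combination (-A * R * Complex.exp (2 * w * y) * ρ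
      * (bracket q (ξ + halfPeriod q k - 2 * z) / (bracket q (ξ + halfPeriod q k)
        * bracket q (2 * z)))) * hexp
  rw [hPξ, hQ, t2, t1, hN', sum_congr rfl fun k _ => t3 k, ← mul_sum]
  linear_combination N * A * Complex.exp (2 * w * y) * pf

/-- The expansion of the diagonal boundary weight in Kronecker kernels. -/
theorem thetaQuotient_expansion (a : Fin 4 → ℂ) {s z ξ : ℂ}
    (hs : a 0 + a 1 + a 2 + a 3 = 2 * s)
    (hz : bracket q (2 * z) ≠ 0) (hξ : bracket q (2 * ξ) ≠ 0) :
    thetaQuotient q a ξ * halfBracket q 3 (ξ - z - s)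
        - thetaQuotient q ![s - a 3, s - a 2, s - a 1, s - a 0] z * halfBracket q 3 (z - ξ - s)
      = halfBracket q 3 (z + ξ + s) * ∑ k, expansionCoeff q C a k
          * kernel q (halfPeriod q k) (halfExponent k) z ξ := by
  -- Moving a 0 by 2t and s by t preserves the constraint that the a k sum to 2s. For small t ≠ 0
  -- all genericity conditions hold, and both sides are continuous in t.
  let b : ℂ → Fin 4 → ℂ := fun t => ![a 0 + t * 2, a 1, a 2, a 3]
  have hb : Continuous b := continuous_pi fun k => by
    fin_cases k <;> simp only [b, Matrix.cons_val, Fin.zero_eta, Fin.mk_one, Fin.reduceFinMk] <;>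
      fun_prop
  have hb' : Continuous fun t : ℂ =>
      (![s + t - a 3, s + t - a 2, s + t - a 1, s + t - (a 0 + t * 2)] : Fin 4 → ℂ) :=
    continuous_pi fun k => by
      fin_cases k <;> simp only [Matrix.cons_val, Fin.zero_eta, Fin.mk_one, Fin.reduceFinMk] <;>
        fun_prop
  have h3 := continuous_halfBracket hq0 hq1 3
  have main := eq_of_eventually_eq (f := fun t =>
      thetaQuotient q (b t) ξ * halfBracket q 3 (ξ - z - (s + t))
        - thetaQuotient q ![s + t - a 3, s + t - a 2, s + t - a 1, s + t - (a 0 + t * 2)] z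
          * halfBracket q 3 (z - ξ - (s + t)))
    (g := fun t => halfBracket q 3 (z + ξ + (s + t)) * ∑ k, expansionCoeff q C (b t) k
          * kernel q (halfPeriod q k) (halfExponent k) z ξ)
    ?_ ?_ ?_
  · have hb0 : b 0 = a := by
      funext k
      fin_cases k <;> simp [b]
    simpa only [hb0, add_zero, zero_mul] using main
  · exact ((((continuous_thetaQuotient hq0 hq1 ξ).comp hb).mul (h3.comp (by fun_prop))).sub
      (((continuous_thetaQuotient hq0 hq1 z).comp hb').mul (h3.comp (by fun_prop))))
  · refine (h3.comp (by fun_prop)).mul (continuous_finsetSum _ fun k _ => ?_)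
    exact ((continuous_expansionCoeff hq0 hq1 C k).comp hb).mul continuous_const
  · have g := fun A B hB => eventually_bracket_ne_zero hq0 hq1 A (B := B) hB
    filter_upwards [g (a 0) 2 two_ne_zero, g (a 0 + a 1) 2 two_ne_zero,
      g (a 0 + a 1 + a 2) 2 two_ne_zero, g (2 * s) 2 two_ne_zero,
      g (2 * (z + s)) 2 two_ne_zero, g (ξ + (z + s + halfPeriod q 3)) 1 one_ne_zero]
      with t g1 g2 g3 g4 g5 g6
    refine thetaQuotient_expansion_of_generic hq0 hq1 hC hdup (b t) (s := s + t) ?_ ?_ ?_ ?_ ?_ hz hξ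
      ?_ ?_
    · simp only [b, Matrix.cons_val]
      linear_combination hs
    · exact g1
    · simp only [b, Matrix.cons_val]
      rwa [show a 0 + t * 2 + a 1 = a 0 + a 1 + t * 2 by ring]
    · simp only [b, Matrix.cons_val]
      rwa [show a 0 + t * 2 + a 1 + a 2 = a 0 + a 1 + a 2 + t * 2 by ring]
    · rwa [show 2 * (s + t) = 2 * s + t * 2 by ring]
    · rwa [show 2 * (z + (s + t)) = 2 * (z + s) + t * 2 by ring]
    · rwa [show ξ + (z + (s + t) + halfPeriod q 3) = ξ + (z + s + halfPeriod q 3) + t * 1 by ring]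

end Expansion

/-! ### The entries of K_Ba and its determinant in terms of [x]. -/

section BoundaryWeights

variable {q : ℝ}

/-- The part of `𝒞(z, ξ)` that is independent of `z` and `ξ`. -/
def calCConst (q : ℝ) (p : BoundaryParams) : ℂ :=
  Complex.exp (-(Real.log q / 2 * (3 * p.zeta ^ 2 + p.zeta' ^ 2 + p.ups ^ 2 + p.ups' ^ 2
      + 2 * p.ups' * (p.ups + p.zeta' + p.zeta) - 2 * p.zeta))
    - Real.log q * (p.zeta ^ 2 + p.zeta * p.zeta' + p.ups * p.zeta + p.ups * p.zeta')
    - Real.log q / 2 * (halfPeriod q 1 ^ 2 - halfPeriod q 1) + Real.log q / 8)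

/-- The exponent is symmetric in υ and ζ', so the constant cancels in every quotient of 𝒞 or 𝒞̃ by
𝒞̃. -/
theorem calCConst_dual (p : BoundaryParams) : calCConst q p.dual = calCConst q p := by
  rw [calCConst, calCConst, BoundaryParams.dual]
  congr 1
  ring

theorem KBaDefined.neg {p : BoundaryParams} {z ξ : ℂ} (h : KBaDefined q p z ξ) :
    KBaDefined q p z (-ξ) := by
  obtain ⟨h1, h2, h3, h4, h5, h6, h7, h8⟩ := h
  rw [← neg_neg ξ] at h1 h3 h5 h7
  exact ⟨h2, h1, h4, h3, h6, h5, h8, h7⟩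

variable (hq0 : 0 < q)
include hq0

theorem theta_cpow (x : ℂ) : theta q ((q : ℂ) ^ x)
    = Complex.exp (-(Real.log q / 2 * (x ^ 2 - x))) * bracket q x := by
  rw [bracket, ofReal_cpow_eq_exp hq0 (_ / 2), ← mul_assoc, ← Complex.exp_add,
    show -((Real.log q : ℂ) / 2 * (x ^ 2 - x)) + Real.log q * ((x ^ 2 - x) / 2) = 0 by ring,
    Complex.exp_zero, one_mul]

theorem theta_cpow_ne_zero_iff {x : ℂ} : theta q ((q : ℂ) ^ x) ≠ 0 ↔ bracket q x ≠ 0 := by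
  rw [theta_cpow hq0, mul_ne_zero_iff]
  simp [Complex.exp_ne_zero]

theorem halfBracket_eq_theta (k : Fin 4) (x : ℂ) : halfBracket q k x
    = Complex.exp (halfExponent k * x + Real.log q / 2 * ((x + halfPeriod q k) ^ 2
        - (x + halfPeriod q k))) * theta q ((q : ℂ) ^ (x + halfPeriod q k)) := by
  rw [halfBracket, bracket, ofReal_cpow_eq_exp hq0 (_ / 2), ← mul_assoc, ← Complex.exp_add]
  congr 3
  ring

theorem theta_cpow_half_add (x : ℂ) : theta q ((q : ℂ) ^ (1 / 2 + x))
    = Complex.exp (-(Real.log q / 2 * x ^ 2) + Real.log q / 8) * halfBracket q 2 x := by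
  rw [halfBracket_eq_theta hq0, ← mul_assoc, ← Complex.exp_add]
  simp only [halfPeriod, halfExponent, Matrix.cons_val]
  -- The exponentials are removed in advance; that their combined exponent is zero is left as a goal
  -- for the end.
  rw [show ∀ a : ℂ, a = 0 → Complex.exp a * theta q ((q : ℂ) ^ (x + 1 / 2))
      = theta q ((q : ℂ) ^ (x + 1 / 2)) by rintro a rfl; simp, add_comm]
  ring

variable (hq1 : q < 1)
include hq1

theorem ofReal_cpow_half_tau : (q : ℂ) ^ (Real.pi * Complex.I / Real.log q : ℂ) = -1 := by
  rw [ofReal_cpow_eq_exp hq0, mul_div_cancel₀ _ (log_ofReal_ne_zero hq0 hq1), Complex.exp_pi_mul_I]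

theorem theta_neg_cpow (x : ℂ) : theta q (-(q : ℂ) ^ x)
    = Complex.exp (-(Real.log q / 2 * (x ^ 2 - x))
        - Real.log q / 2 * (halfPeriod q 1 ^ 2 - halfPeriod q 1)) * halfBracket q 1 x := by
  have hL := log_ofReal_ne_zero hq0 hq1
  have hq : (q : ℂ) ≠ 0 := by exact_mod_cast hq0.ne'
  have e : (q : ℂ) ^ (x + halfPeriod q 1) = -(q : ℂ) ^ x := by
    simp only [halfPeriod, Matrix.cons_val]
    rw [Complex.cpow_add _ _ hq, ofReal_cpow_half_tau hq0 hq1, mul_neg_one]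
  rw [halfBracket_eq_theta hq0, e, ← mul_assoc, ← Complex.exp_add]
  simp only [halfPeriod, halfExponent, Matrix.cons_val]
  rw [show ∀ a : ℂ, a = 0 → Complex.exp a * theta q (-(q : ℂ) ^ x) = theta q (-(q : ℂ) ^ x) by
    rintro a rfl; simp]
  field_simp
  ring

theorem theta_neg_cpow_half_add (x : ℂ) : theta q (-(q : ℂ) ^ (1 / 2 + x))
    = Complex.exp (-(Real.log q / 2 * x ^ 2)
        - Real.log q / 2 * (halfPeriod q 3 ^ 2 - halfPeriod q 3)) * halfBracket q 3 x := by
  have hL := log_ofReal_ne_zero hq0 hq1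
  have hq : (q : ℂ) ≠ 0 := by exact_mod_cast hq0.ne'
  have e : (q : ℂ) ^ (x + halfPeriod q 3) = -(q : ℂ) ^ (1 / 2 + x) := by
    simp only [halfPeriod, Matrix.cons_val]
    rw [← add_assoc, Complex.cpow_add _ _ hq, ofReal_cpow_half_tau hq0 hq1, mul_neg_one, add_comm x]
  rw [halfBracket_eq_theta hq0, e, ← mul_assoc, ← Complex.exp_add]
  simp only [halfPeriod, halfExponent, Matrix.cons_val]
  rw [show ∀ a : ℂ, a = 0 → Complex.exp a * theta q (-(q : ℂ) ^ (1 / 2 + x))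
    = theta q (-(q : ℂ) ^ (1 / 2 + x)) by rintro a rfl; simp]
  field_simp
  ring

theorem calC_eq (p : BoundaryParams) (z ξ : ℂ) : calC q p z ξ = calCConst q p *
    (halfBracket q 0 (ξ + (p.zeta + p.zeta')) * halfBracket q 1 (ξ + (p.zeta - p.zeta'))
      * halfBracket q 2 (ξ + (p.ups + p.ups')) * halfBracket q 3 (ξ - z - (p.zeta + p.ups'))
      / (bracket q (2 * ξ) * halfBracket q 3 (p.zeta' - p.ups' - z))) := by
  have hq : (q : ℂ) ≠ 0 := by exact_mod_cast hq0.ne'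
  have e0 : p.dual.a q * (q : ℂ) ^ ξ = (q : ℂ) ^ (ξ + (p.zeta + p.zeta')) := by
    rw [BoundaryParams.a, BoundaryParams.dual, ← Complex.cpow_add _ _ hq, add_comm]
  have e1 : p.dual.b q * (q : ℂ) ^ ξ = -(q : ℂ) ^ (ξ + (p.zeta - p.zeta')) := by
    rw [BoundaryParams.b, BoundaryParams.dual, neg_mul, ← Complex.cpow_add _ _ hq, add_comm]
  have e2 : p.dual.c q * (q : ℂ) ^ ξ = (q : ℂ) ^ (1 / 2 + (ξ + (p.ups + p.ups'))) := by
    rw [BoundaryParams.c, BoundaryParams.dual, ← Complex.cpow_add _ _ hq]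
    congr 1; ring
  have e3 : p.d q * (q : ℂ) ^ (ξ - z) / p.dual.a q
      = -(q : ℂ) ^ (1 / 2 + (ξ - z - (p.zeta + p.ups'))) := by
    rw [BoundaryParams.d, BoundaryParams.a, BoundaryParams.dual, neg_mul, neg_div,
      ← Complex.cpow_add _ _ hq, ← Complex.cpow_sub _ _ hq]
    congr 2; ring
  have e4 : p.d q * (q : ℂ) ^ (-z) = -(q : ℂ) ^ (1 / 2 + (p.zeta' - p.ups' - z)) := by
    rw [BoundaryParams.d, neg_mul, ← Complex.cpow_add _ _ hq]
    congr 2; ring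
  rw [calC, e0, e1, e2, e3, e4, theta_cpow_half_add hq0, theta_neg_cpow_half_add hq0 hq1,
    theta_neg_cpow_half_add hq0 hq1, theta_neg_cpow hq0 hq1, theta_cpow hq0, theta_cpow hq0,
    ofReal_cpow_eq_exp hq0, halfBracket_zero_apply, calCConst]
  have : ∀ x0 x1 x2 x3 y0 y3 t k b0 b1 b2 b3 d0 d3 : ℂ, k = x0 + x1 + x2 + x3 - y0 - y3 + t →
      Complex.exp x0 * b0 * (Complex.exp x1 * b1) * (Complex.exp x2 * b2) * (Complex.exp x3 * b3)
        / (Complex.exp y0 * d0 * (Complex.exp y3 * d3)) * Complex.exp t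
      = Complex.exp k * (b0 * b1 * b2 * b3 / (d0 * d3)) := by
    intro x0 x1 x2 x3 y0 y3 t k b0 b1 b2 b3 d0 d3 h
    rw [h, Complex.exp_add, Complex.exp_sub, Complex.exp_sub, Complex.exp_add, Complex.exp_add,
      Complex.exp_add, div_eq_mul_inv, div_eq_mul_inv, div_eq_mul_inv, div_eq_mul_inv, mul_inv,
      mul_inv, mul_inv, mul_inv]
    ring
  refine this _ _ _ _ _ _ _ _ _ _ _ _ _ _ ?_
  ring

theorem CalCDefined.bracket_ne_zero {p : BoundaryParams} {z ξ : ℂ} (h : CalCDefined q p z ξ) :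
    bracket q (2 * ξ) ≠ 0 ∧ halfBracket q 3 (p.zeta' - p.ups' - z) ≠ 0 := by
  have hq : (q : ℂ) ≠ 0 := by exact_mod_cast hq0.ne'
  have e4 : p.d q * (q : ℂ) ^ (-z) = -(q : ℂ) ^ (1 / 2 + (p.zeta' - p.ups' - z)) := by
    rw [BoundaryParams.d, neg_mul, ← Complex.cpow_add _ _ hq]
    congr 2; ring
  obtain ⟨h1, h2⟩ := h
  rw [e4, theta_neg_cpow_half_add hq0 hq1] at h2
  exact ⟨(theta_cpow_ne_zero_iff hq0).mp h1, right_ne_zero_of_mul h2⟩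

/-- The parameters of the numerator of `𝒞` in the variable `ξ`, completed to a quadruple. -/
def BoundaryParams.vec (p : BoundaryParams) : Fin 4 → ℂ :=
  ![p.zeta + p.zeta', p.zeta - p.zeta', p.ups + p.ups', p.ups' - p.ups]

/-- The off-diagonal boundary weight up to a factor depending only on the spectral parameter. -/
def betaFactor (q : ℝ) (p : BoundaryParams) (ξ : ℂ) : ℂ :=
  thetaQuotient q ![p.zeta + p.zeta', p.zeta - p.zeta', p.ups + p.ups', p.ups - p.ups'] ξ

/-- The diagonal boundary weight up to a factor depending only on the spectral parameter. -/
def alphaFactor (q : ℝ) (C : ℂ) (p : BoundaryParams) (z ξ : ℂ) : ℂ :=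
  ∑ k, expansionCoeff q C p.vec k * kernel q (halfPeriod q k) (halfExponent k) z ξ

/-- The common factor of the boundary weights depending only on the spectral parameter. -/
def commonFactor (q : ℝ) (p : BoundaryParams) (z : ℂ) : ℂ :=
  bracket q (2 * -z) / (halfBracket q 0 (-z + (p.zeta + p.ups)) * halfBracket q 1 (-z + (p.zeta - p.ups))
    * halfBracket q 2 (-z + (p.zeta' + p.ups')) * halfBracket q 3 (p.zeta' - p.ups' - z))

/-- Here s = ζ + υ'. Reversing the quadruple and subtracting it from s is the interchange of υ and
ζ', so the fifth residue carries the dual parameters. -/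
theorem BoundaryParams.expansion {C : ℂ} (hC : C ≠ 0)
    (hdup : ∀ x, bracket q (2 * x) = C * ∏ k, halfBracket q k x) (p : BoundaryParams) {z ξ : ℂ}
    (hz : bracket q (2 * z) ≠ 0) (hξ : bracket q (2 * ξ) ≠ 0) :
    thetaQuotient q p.vec ξ * halfBracket q 3 (ξ - z - (p.zeta + p.ups'))
        - thetaQuotient q p.dual.vec z * halfBracket q 3 (z - ξ - (p.zeta + p.ups'))
      = halfBracket q 3 (z + ξ + (p.zeta + p.ups')) * alphaFactor q C p z ξ := by
  have h := thetaQuotient_expansion hq0 hq1 hC hdup p.vec (s := p.zeta + p.ups')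
    (by simp only [BoundaryParams.vec, Matrix.cons_val]; ring) hz hξ
  have e : p.dual.vec = ![p.zeta + p.ups' - p.vec 3, p.zeta + p.ups' - p.vec 2,
      p.zeta + p.ups' - p.vec 1, p.zeta + p.ups' - p.vec 0] := by
    funext k
    fin_cases k <;> simp [BoundaryParams.vec, BoundaryParams.dual] <;> ring
  rw [e]
  exact h

theorem KBaDefined.calC_ne_zero {p : BoundaryParams} {z ξ : ℂ} (h : KBaDefined q p z ξ) :
    halfBracket q 0 (-z + (p.zeta + p.ups)) ≠ 0 ∧ halfBracket q 1 (-z + (p.zeta - p.ups)) ≠ 0 ∧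
    halfBracket q 2 (-z + (p.zeta' + p.ups')) ≠ 0 ∧
    halfBracket q 3 (z + ξ + (p.zeta + p.ups')) ≠ 0 := by
  have h1 := h.den_pos_ne
  rw [calCDual, calC_eq hq0 hq1] at h1
  have h2 := left_ne_zero_of_mul (div_eq_mul_inv (G := ℂ) _ _ ▸ right_ne_zero_of_mul h1)
  rw [mul_ne_zero_iff, mul_ne_zero_iff, mul_ne_zero_iff] at h2
  obtain ⟨⟨⟨a0, a1⟩, a2⟩, a3⟩ := h2
  refine ⟨a0, a1, a2, ?_⟩
  rw [← halfBracket_neg hq0 hq1 (by decide)]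
  convert a3 using 2
  simp only [BoundaryParams.dual]
  ring

theorem bracket_two_mul_neg (z : ℂ) : bracket q (2 * -z) = -bracket q (2 * z) := by
  rw [mul_neg, bracket_neg hq0 hq1]

/-- The only theta mixing z and ξ occurs in both 𝒞(z, ξ) and 𝒞̃(-ξ, -z). It is the same by evenness
and cancels, which separates the variables. -/
theorem betaBa_eq {p : BoundaryParams} {z ξ : ℂ} (h : KBaDefined q p z ξ) :
    betaBa q p z ξ = commonFactor q p z * betaFactor q p ξ := by
  obtain ⟨n0, n1, n2, -⟩ := h.calC_ne_zero hq0 hq1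
  obtain ⟨-, -, -, n3⟩ := h.neg.calC_ne_zero hq0 hq1
  have n4 := (h.num_pos.bracket_ne_zero hq0 hq1).1
  have n5 := (h.num_pos.bracket_ne_zero hq0 hq1).2
  have n6 := (h.den_neg.bracket_ne_zero hq0 hq1).1
  have n7 := (h.den_neg.bracket_ne_zero hq0 hq1).2
  have nK : calCConst q p ≠ 0 := Complex.exp_ne_zero _
  have e3 : ∀ x, halfBracket q 3 (-x) = halfBracket q 3 x := halfBracket_neg hq0 hq1 (by decide)
  simp only [BoundaryParams.dual] at n7
  rw [betaBa, calCDual, calC_eq hq0 hq1, calC_eq hq0 hq1, calCConst_dual, commonFactor, betaFactor,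
    thetaQuotient, Fin.prod_univ_four]
  simp only [Matrix.cons_val, BoundaryParams.dual]
  rw [show ξ - z - (p.zeta + p.ups') = -(z + -ξ + (p.zeta + p.ups')) by ring, e3,
    show -z - -ξ - (p.zeta + p.ups') = -(z + -ξ + (p.zeta + p.ups')) by ring, e3,
    show ξ + (p.ups - p.ups') = p.ups - p.ups' - -ξ by ring]
  generalize halfBracket q 3 (z + -ξ + (p.zeta + p.ups')) = x3 at *
  generalize bracket q (2 * -z) = x6 at *
  generalize bracket q (2 * ξ) = x4 at *
  field_simp

/-- Over a common denominator, 𝒞(z, ξ) - 𝒞̃(ξ, z) is the left side of `BoundaryParams.expansion`.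
The factor θ₃(z + ξ + s) produced there cancels against 𝒞̃(ξ, -z). -/
theorem alphaBa_eq {C : ℂ} (hC : C ≠ 0)
    (hdup : ∀ x, bracket q (2 * x) = C * ∏ k, halfBracket q k x)
    {p : BoundaryParams} {z ξ : ℂ} (h : KBaDefined q p z ξ) :
    alphaBa q p z ξ = commonFactor q p z
      * ((q : ℂ) ^ (2 * z * ξ) * alphaFactor q C p z ξ) := by
  obtain ⟨n0, n1, n2, n3⟩ := h.calC_ne_zero hq0 hq1
  have n4 := (h.num_pos.bracket_ne_zero hq0 hq1).1
  have n5 := (h.num_pos.bracket_ne_zero hq0 hq1).2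
  have n6 := (h.dual_pos.bracket_ne_zero hq0 hq1).1
  have n7 := (h.dual_pos.bracket_ne_zero hq0 hq1).2
  have nK : calCConst q p ≠ 0 := Complex.exp_ne_zero _
  have e3 : ∀ x, halfBracket q 3 (-x) = halfBracket q 3 x := halfBracket_neg hq0 hq1 (by decide)
  have hexp := p.expansion hq0 hq1 hC hdup n6 n4
  simp only [BoundaryParams.dual] at n7
  rw [thetaQuotient, thetaQuotient, Fin.prod_univ_four, Fin.prod_univ_four] at hexp
  simp only [Matrix.cons_val, BoundaryParams.dual, BoundaryParams.vec] at hexp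
  rw [show ξ + (p.ups' - p.ups) = -(p.ups - p.ups' - ξ) by ring, e3,
    show z + (p.ups' - p.zeta') = -(p.zeta' - p.ups' - z) by ring, e3] at hexp
  rw [alphaBa, calCDual, calCDual, calC_eq hq0 hq1, calC_eq hq0 hq1, calC_eq hq0 hq1,
    calCConst_dual, commonFactor]
  simp only [BoundaryParams.dual]
  rw [show -z - ξ - (p.zeta + p.ups') = -(z + ξ + (p.zeta + p.ups')) by ring, e3,
    bracket_two_mul_neg hq0 hq1]
  generalize alphaFactor q C p z ξ = Φ at *
  generalize halfBracket q 3 (z + ξ + (p.zeta + p.ups')) = x3 at *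
  generalize bracket q (2 * z) = x6 at *
  generalize bracket q (2 * ξ) = x4 at *
  generalize halfBracket q 3 (p.ups - p.ups' - ξ) = x7 at *
  generalize halfBracket q 3 (p.zeta' - p.ups' - z) = x5 at *
  generalize halfBracket q 3 (ξ - z - (p.zeta + p.ups')) = y1 at *
  generalize halfBracket q 3 (z - ξ - (p.zeta + p.ups')) = y2 at *
  generalize halfBracket q 0 (ξ + (p.zeta + p.zeta')) * halfBracket q 1 (ξ + (p.zeta - p.zeta'))
    * halfBracket q 2 (ξ + (p.ups + p.ups')) = y3 at *
  generalize halfBracket q 0 (z + (p.zeta + p.ups)) * halfBracket q 1 (z + (p.zeta - p.ups))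
    * halfBracket q 2 (z + (p.zeta' + p.ups')) = y4 at *
  generalize halfBracket q 0 (-z + (p.zeta + p.ups)) = y5 at *
  generalize halfBracket q 1 (-z + (p.zeta - p.ups)) = y6 at *
  generalize halfBracket q 2 (-z + (p.zeta' + p.ups')) = y7 at *
  generalize (q : ℂ) ^ (2 * z * ξ) = y8
  have e : calCConst q p * (y3 * y1 / (x4 * x5)) - calCConst q p * (y4 * y2 / (x6 * x7))
      = calCConst q p * (x3 * Φ) / (x5 * x7) := by
    rw [← hexp]
    field_simp
  rw [e]
  field_simp

theorem alphaFactor_neg_neg (C : ℂ) (p : BoundaryParams) (z ξ : ℂ) :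
    alphaFactor q C p (-z) (-ξ) = -alphaFactor q C p z ξ := by
  rw [alphaFactor, alphaFactor, ← sum_neg_distrib]
  refine sum_congr rfl fun k _ => ?_
  rw [kernel_neg_neg hq0 hq1 (isHalfPeriod_halfPeriod hq0 hq1 k), mul_neg]

/-- The determinant of the boundary matrix, up to the common factor, is independent of the
dynamical parameter. -/
theorem alphaFactor_mul_neg {C : ℂ} (hC : C ≠ 0)
    (hdup : ∀ x, bracket q (2 * x) = C * ∏ k, halfBracket q k x)
    {p : BoundaryParams} {z ξ : ℂ} (h : KBaDefined q p z ξ) :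
    alphaFactor q C p z ξ * alphaFactor q C p z (-ξ) - betaFactor q p ξ * betaFactor q p (-ξ)
      = -(thetaQuotient q p.dual.vec z * thetaQuotient q p.dual.vec (-z)) := by
  obtain ⟨-, -, -, nX⟩ := h.calC_ne_zero hq0 hq1
  obtain ⟨-, -, -, nA⟩ := h.neg.calC_ne_zero hq0 hq1
  have nξ := (h.num_pos.bracket_ne_zero hq0 hq1).1
  have nz := (h.dual_pos.bracket_ne_zero hq0 hq1).1
  have nξ' : bracket q (2 * -ξ) ≠ 0 := by
    rw [bracket_two_mul_neg hq0 hq1]; exact neg_ne_zero.mpr nξ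
  have nz' : bracket q (2 * -z) ≠ 0 := by
    rw [bracket_two_mul_neg hq0 hq1]; exact neg_ne_zero.mpr nz
  have e3 : ∀ x, halfBracket q 3 (-x) = halfBracket q 3 x := halfBracket_neg hq0 hq1 (by decide)
  have h1 := p.expansion hq0 hq1 hC hdup nz nξ
  have h2 := p.expansion hq0 hq1 hC hdup nz nξ'
  have h3 := p.expansion hq0 hq1 hC hdup nz' nξ'
  rw [alphaFactor_neg_neg hq0 hq1] at h3
  -- The quadruples for `betaFactor` and `vec` differ only in the sign of the last entry. Since θ₃
  -- is even, that sign change trades ξ for -ξ in one factor and disappears from the product.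
  have hG : betaFactor q p ξ * betaFactor q p (-ξ)
      = thetaQuotient q p.vec ξ * thetaQuotient q p.vec (-ξ) := by
    rw [betaFactor, betaFactor, thetaQuotient, thetaQuotient, thetaQuotient, thetaQuotient,
      Fin.prod_univ_four, Fin.prod_univ_four, Fin.prod_univ_four, Fin.prod_univ_four]
    simp only [Matrix.cons_val, BoundaryParams.vec]
    rw [show ξ + (p.ups' - p.ups) = -(-ξ + (p.ups - p.ups')) by ring, e3,
      show -ξ + (p.ups' - p.ups) = -(ξ + (p.ups - p.ups')) by ring, e3]
    ring
  rw [hG]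
  have s1 : halfBracket q 3 (ξ - z - (p.zeta + p.ups'))
      = halfBracket q 3 (z + -ξ + (p.zeta + p.ups')) := by rw [← e3]; congr 1; ring
  have s2 : halfBracket q 3 (-ξ - z - (p.zeta + p.ups'))
      = halfBracket q 3 (z + ξ + (p.zeta + p.ups')) := by rw [← e3]; congr 1; ring
  have s3 : halfBracket q 3 (-ξ - -z - (p.zeta + p.ups'))
      = halfBracket q 3 (z - ξ - (p.zeta + p.ups')) := by congr 1; ring
  have s4 : halfBracket q 3 (-z - -ξ - (p.zeta + p.ups'))
      = halfBracket q 3 (z + -ξ + (p.zeta + p.ups')) := by rw [← e3]; congr 1; ring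
  have s5 : halfBracket q 3 (-z + -ξ + (p.zeta + p.ups'))
      = halfBracket q 3 (z - -ξ - (p.zeta + p.ups')) := by rw [← e3]; congr 1; ring
  rw [s1] at h1
  rw [s2] at h2
  rw [s3, s4, s5] at h3
  generalize halfBracket q 3 (z + ξ + (p.zeta + p.ups')) = X at *
  generalize halfBracket q 3 (z + -ξ + (p.zeta + p.ups')) = A at *
  generalize halfBracket q 3 (z - ξ - (p.zeta + p.ups')) = B at *
  generalize halfBracket q 3 (z - -ξ - (p.zeta + p.ups')) = Y at *
  generalize thetaQuotient q p.vec ξ = P at *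
  generalize thetaQuotient q p.vec (-ξ) = P' at *
  generalize thetaQuotient q p.dual.vec z = Q at *
  generalize thetaQuotient q p.dual.vec (-z) = Q' at *
  generalize alphaFactor q C p z ξ = F at *
  generalize alphaFactor q C p z (-ξ) = F' at *
  -- The expansions at (z, ξ) and (z, -ξ) express F and F'. The one at (-z, -ξ), rewritten by
  -- oddness of `alphaFactor`, relates F to Q' and eliminates the mixed terms.
  apply mul_left_cancel₀ (mul_ne_zero nX nA)
  linear_combination (-A * F' - Q * Y) * h1 - (P * A - Q * B) * h2 - Q * X * h3

end BoundaryWeights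

/-! ### Reduction of the face equation to relations between matrix entries. -/

section Heights

theorem spinIndex_one : spinIndex 1 = some 0 := by simp [spinIndex]

theorem spinIndex_neg_one : spinIndex (-1) = some 1 := by
  have : (-1 : ℂ) ≠ 1 := by norm_num
  simp [spinIndex, this]

theorem spinIndex_eq_none {t : ℂ} (h1 : t ≠ 1) (h2 : t ≠ -1) : spinIndex t = none := by
  simp [spinIndex, h1, h2]

theorem eq_or_eq_of_spinIndex_ne_none {t : ℂ} (h : spinIndex t ≠ none) : t = 1 ∨ t = -1 := by
  by_contra! h'
  exact h (spinIndex_eq_none h'.1 h'.2)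

theorem tensorIndex_none_left {s t : ℂ} (h : spinIndex s = none) : tensorIndex s t = none := by
  simp [tensorIndex, h]

theorem tensorIndex_none_right {s t : ℂ} (h : spinIndex t = none) : tensorIndex s t = none := by
  rw [tensorIndex, h]
  split <;> simp_all

theorem coeffR_ne_zero {R : Matrix (Fin 4) (Fin 4) ℂ} {n₁ n₂ m₁ m₂ : ℂ}
    (h : coeffR R n₁ n₂ m₁ m₂ ≠ 0) : (n₁ = 1 ∨ n₁ = -1) ∧ (n₂ = 1 ∨ n₂ = -1) ∧
      (m₁ = 1 ∨ m₁ = -1) ∧ (m₂ = 1 ∨ m₂ = -1) := by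
  refine ⟨?_, ?_, ?_, ?_⟩ <;> refine eq_or_eq_of_spinIndex_ne_none fun h' => h ?_ <;> rw [coeffR]
  · rw [tensorIndex_none_left h']
  · rw [tensorIndex_none_right h']
  · rw [tensorIndex_none_left h']
    cases tensorIndex n₁ n₂ <;> rfl
  · rw [tensorIndex_none_right h']
    cases tensorIndex n₁ n₂ <;> rfl

theorem coeffK_ne_zero {K : Matrix (Fin 2) (Fin 2) ℂ} {n m : ℂ} (h : coeffK K n m ≠ 0) :
    (n = 1 ∨ n = -1) ∧ (m = 1 ∨ m = -1) := by
  refine ⟨?_, ?_⟩ <;> refine eq_or_eq_of_spinIndex_ne_none fun h' => h ?_ <;> rw [coeffK, h']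
  cases spinIndex n <;> rfl

theorem finsum_eq_add_of_support {F : ℂ → ℂ} {s t : ℂ} (hst : s ≠ t)
    (h : ∀ x, F x ≠ 0 → x = s ∨ x = t) : ∑ᶠ x, F x = F s + F t := by
  classical
  rw [finsum_eq_sum_of_support_subset (s := {s, t}), sum_pair hst]
  intro x hx
  simpa using h x hx

/-- A sum over pairs of heights reachable from `c` by two steps. -/
theorem finsum_heights {F : ℂ → ℂ → ℂ} (c : ℂ)
    (h : ∀ f g, F f g ≠ 0 → (f - c = 1 ∨ f - c = -1) ∧ (g - f = 1 ∨ g - f = -1)) :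
    ∑ᶠ (f : ℂ) (g : ℂ), F f g = F (c + 1) (c + 2) + F (c + 1) (c + 0)
      + (F (c + -1) (c + 0) + F (c + -1) (c + -2)) := by
  have h1 : ∑ᶠ g, F (c + 1) g = F (c + 1) (c + 2) + F (c + 1) (c + 0) := by
    refine finsum_eq_add_of_support (by simp) fun g hg => ?_
    rcases (h _ _ hg).2 with h | h
    · left; linear_combination h
    · right; linear_combination h
  have h2 : ∑ᶠ g, F (c + -1) g = F (c + -1) (c + 0) + F (c + -1) (c + -2) := by
    refine finsum_eq_add_of_support (by simp) fun g hg => ?_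
    rcases (h _ _ hg).2 with h | h
    · left; linear_combination h
    · right; linear_combination h
  rw [finsum_eq_add_of_support (s := c + 1) (t := c + -1) ?_ ?_, h1, h2]
  · intro h
    have : (1 : ℂ) = -1 := add_left_cancel h
    norm_num at this
  · intro f hf
    obtain ⟨g, hg⟩ : ∃ g, F f g ≠ 0 := by
      by_contra! h0
      exact hf (by simp [h0])
    rcases (h _ _ hg).1 with h | h
    · left; linear_combination h
    · right; linear_combination h

/-- Every height is kept as c plus a numeral, including c + 0, so that `faceWeight_add` and
`boundaryWeight_add` cancel c uniformly. -/
theorem two_steps {a b c : ℂ} (hb : b - c = 1 ∨ b - c = -1) (ha : a - b = 1 ∨ a - b = -1) :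
    b = c + 1 ∧ a = c + 2 ∨ b = c + 1 ∧ a = c + 0 ∨ b = c + -1 ∧ a = c + 0 ∨
      b = c + -1 ∧ a = c + -2 := by
  rcases hb with hb | hb <;> rcases ha with ha | ha
  · left; exact ⟨by linear_combination hb, by linear_combination hb + ha⟩
  · right; left; exact ⟨by linear_combination hb, by linear_combination hb + ha⟩
  · right; right; left; exact ⟨by linear_combination hb, by linear_combination hb + ha⟩
  · right; right; right; exact ⟨by linear_combination hb, by linear_combination hb + ha⟩

theorem faceWeight_add (κ : ℂ) (R : ℂ → ℂ → Matrix (Fin 4) (Fin 4) ℂ) (c β δ γ z ξ : ℂ) :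
    faceWeight κ R c (c + β) (c + δ) (c + γ) z ξ
      = coeffR (R z (ξ - 2 * κ * c)) (γ - δ) δ β (γ - β) := by
  simp only [faceWeight, add_sub_add_left_eq_sub, add_sub_cancel_left]

theorem boundaryWeight_add (κ : ℂ) (K : ℂ → ℂ → Matrix (Fin 2) (Fin 2) ℂ) (c φ γ ε z ξ : ℂ) :
    boundaryWeight κ K (c + φ) (c + γ) (c + ε) z ξ
      = coeffK (K z (ξ / 2 - κ * (c + φ))) (ε - φ) (γ - φ) := by
  simp only [boundaryWeight, add_sub_add_left_eq_sub]

/-- The boundary Yang-Baxter equation of a face model in terms of the entries of the dynamical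
matrices. -/
theorem boundaryYangBaxter_of_entries {κ : ℂ} {R : ℂ → ℂ → Matrix (Fin 4) (Fin 4) ℂ}
    {K : ℂ → ℂ → Matrix (Fin 2) (Fin 2) ℂ} {a b c d e z₁ z₂ ξ : ℂ}
    {Nm Np M₁ M₂ Dm Dp bm bp bm' bp' m p α α' u u' f₁ f₁' f₂ f₂' h₁ h₁' h₂ h₂' g g' k k' : ℂ}
    (hRm : R (z₁ - z₂) (ξ - 2 * κ * c) = Nm • !![Dm, 0, 0, 0; 0, u * (m * α), bm', 0;
      0, bm, u' * (m * α'), 0; 0, 0, 0, Dm])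
    (hRp : R (z₁ + z₂) (ξ - 2 * κ * c) = Np • !![Dp, 0, 0, 0; 0, u * (p * α), bp', 0;
      0, bp, u' * (p * α'), 0; 0, 0, 0, Dp])
    (hK₁ : K z₁ (ξ / 2 - κ * (c + 1)) = M₁ • !![f₁, g; g', f₁'])
    (hK₁' : K z₁ (ξ / 2 - κ * (c + -1)) = M₁ • !![h₁, k; k', h₁'])
    (hK₂ : K z₂ (ξ / 2 - κ * (c + 1)) = M₂ • !![f₂, g; g', f₂'])
    (hK₂' : K z₂ (ξ / 2 - κ * (c + -1)) = M₂ • !![h₂, k; k', h₂'])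
    (hu : u * u' = 1)
    (hex : p * Dm * h₂ = m * (Dp * f₂ + bp * f₁') + p * bm' * h₁)
    (hex' : p * Dm * f₂' = m * (Dp * h₂' + bp' * h₁) + p * bm * f₁')
    (hdet : f₂ * f₂' - g * g' = h₂ * h₂' - k * k')
    (hcross : Dm * (Dp * f₁ + bp * f₂') = bm * (Dp * f₂ + bp * f₁') + α * α' * m * p * h₁)
    (hcross' : Dm * (Dp * h₁' + bp' * h₂) = bm' * (Dp * h₂' + bp' * h₁) + α * α' * m * p * f₁') :
    BoundaryYangBaxter (faceWeight κ R) (boundaryWeight κ K) a b c d e z₁ z₂ ξ := by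
  rw [BoundaryYangBaxter]
  have hW : ∀ {c b d e z : ℂ}, faceWeight κ R c b d e z ξ ≠ 0 →
      (e - d = 1 ∨ e - d = -1) ∧ (d - c = 1 ∨ d - c = -1) ∧
      (b - c = 1 ∨ b - c = -1) ∧ (e - b = 1 ∨ e - b = -1) := fun h => coeffR_ne_zero h
  have hB : ∀ {b c a z : ℂ}, boundaryWeight κ K b c a z ξ ≠ 0 →
      (a - b = 1 ∨ a - b = -1) ∧ (c - b = 1 ∨ c - b = -1) := fun h => coeffK_ne_zero h
  by_cases hstep : (b - c = 1 ∨ b - c = -1) ∧ (a - b = 1 ∨ a - b = -1) ∧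
      (d - c = 1 ∨ d - c = -1) ∧ (e - d = 1 ∨ e - d = -1)
  · obtain ⟨hb, ha, hd, he⟩ := hstep
    have hsum := finsum_heights c (F := fun f g => faceWeight κ R c f d e (z₁ - z₂) ξ
      * boundaryWeight κ K f g e z₁ ξ * faceWeight κ R c b f g (z₁ + z₂) ξ
      * boundaryWeight κ K b a g z₂ ξ) fun f g h => by
        have := hW (right_ne_zero_of_mul (left_ne_zero_of_mul h))
        exact ⟨this.2.1, this.1⟩
    have hsum' := finsum_heights c (F := fun f g => boundaryWeight κ K d g e z₂ ξ
      * faceWeight κ R c f d g (z₁ + z₂) ξ * boundaryWeight κ K f a g z₁ ξ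
      * faceWeight κ R c b f a (z₁ - z₂) ξ) fun f g h => by
        have := hW (right_ne_zero_of_mul (left_ne_zero_of_mul (left_ne_zero_of_mul h)))
        exact ⟨this.2.2.1, this.2.2.2⟩
    rw [hsum, hsum']
    -- The heights c ± 2 and c ∓ 1 differ by ±3. Such pairs occur formally among the four summands
    -- and contribute zero.
    have n3 : spinIndex 3 = none := spinIndex_eq_none (by norm_num) (by norm_num)
    have n3' : spinIndex (-3) = none := spinIndex_eq_none (by norm_num) (by norm_num)
    have i1 : tensorIndex 1 1 = some 0 := by simp [tensorIndex, spinIndex_one]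
    have i2 : tensorIndex 1 (-1) = some 1 := by
      simp [tensorIndex, spinIndex_one, spinIndex_neg_one]
    have i3 : tensorIndex (-1) 1 = some 2 := by
      simp [tensorIndex, spinIndex_one, spinIndex_neg_one]
    have i4 : tensorIndex (-1) (-1) = some 3 := by simp [tensorIndex, spinIndex_neg_one]
    have i5 : ∀ t, tensorIndex 3 t = none := fun t => tensorIndex_none_left n3
    have i6 : ∀ t, tensorIndex (-3) t = none := fun t => tensorIndex_none_left n3'
    have i7 : ∀ t, tensorIndex t 3 = none := fun t => tensorIndex_none_right n3
    have i8 : ∀ t, tensorIndex t (-3) = none := fun t => tensorIndex_none_right n3'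
    have r1 : (2 - 1 : ℂ) = 1 := by norm_num
    have r2 : (2 - -1 : ℂ) = 3 := by norm_num
    have r3 : (-2 - 1 : ℂ) = -3 := by norm_num
    have r4 : (-2 - -1 : ℂ) = -1 := by norm_num
    clear hsum hsum' hW hB
    rcases two_steps hb ha with ⟨rfl, rfl⟩ | ⟨rfl, rfl⟩ | ⟨rfl, rfl⟩ | ⟨rfl, rfl⟩ <;>
      rcases two_steps hd he with ⟨rfl, rfl⟩ | ⟨rfl, rfl⟩ | ⟨rfl, rfl⟩ | ⟨rfl, rfl⟩
    -- If exactly one of a and e equals c, the equation is an exchange relation when b ≠ d and a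
    -- cross relation, with u u' = 1, when b = d. If a = e = c and b ≠ d, two exchange relations
    -- combine with the constancy of the determinant. The remaining six cases are identities.
    all_goals
      simp only [faceWeight_add, boundaryWeight_add, hRm, hRp, hK₁, hK₁', hK₂, hK₂', coeffR, coeffK,
        zero_sub, neg_neg, r1, r2, r3, r4, i1, i2, i3, i4, i5, i6, i7, i8, n3, n3', spinIndex_one,
        spinIndex_neg_one, Matrix.smul_apply, Matrix.of_apply, Matrix.cons_val, smul_eq_mul,
        zero_mul, mul_zero]
    · ring
    · linear_combination -(Nm * Np * M₁ * M₂ * g') * hcross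
        + (Nm * Np * M₁ * M₂ * g' * α * α' * m * p * h₁) * hu
    · linear_combination -(Nm * Np * M₁ * M₂ * g' * u * α) * hex
    · ring
    · linear_combination (Nm * Np * M₁ * M₂ * g) * hcross
        - (Nm * Np * M₁ * M₂ * g * α * α' * m * p * h₁) * hu
    · ring
    · linear_combination (Nm * Np * M₁ * M₂ * u * α) * (h₂ * hex' - f₂' * hex - m * Dp * hdet)
    · linear_combination (Nm * Np * M₁ * M₂ * k' * u * α) * hex'
    · linear_combination (Nm * Np * M₁ * M₂ * g * u' * α') * hex
    · linear_combination (Nm * Np * M₁ * M₂ * u' * α') * (f₂' * hex - h₂ * hex' + m * Dp * hdet)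
    · ring
    · linear_combination (Nm * Np * M₁ * M₂ * k') * hcross'
        - (Nm * Np * M₁ * M₂ * k' * α * α' * m * p * f₁') * hu
    · ring
    · linear_combination -(Nm * Np * M₁ * M₂ * k * u' * α') * hex'
    · linear_combination -(Nm * Np * M₁ * M₂ * k) * hcross'
        + (Nm * Np * M₁ * M₂ * k * α * α' * m * p * f₁') * hu
    · ring
  -- If some adjacency fails, every summand on either side contains a vanishing weight, since the
  -- weights in a single summand already force all four adjacencies.
  · have hz : ∀ f g, faceWeight κ R c f d e (z₁ - z₂) ξ
      * boundaryWeight κ K f g e z₁ ξ * faceWeight κ R c b f g (z₁ + z₂) ξ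
      * boundaryWeight κ K b a g z₂ ξ = 0 := fun f g => by
      by_contra h
      have w1 := hW (left_ne_zero_of_mul (left_ne_zero_of_mul (left_ne_zero_of_mul h)))
      have w2 := hW (right_ne_zero_of_mul (left_ne_zero_of_mul h))
      exact hstep ⟨w2.2.2.1, (hB (right_ne_zero_of_mul h)).2, w1.2.1, w1.1⟩
    have hz' : ∀ f g, boundaryWeight κ K d g e z₂ ξ
      * faceWeight κ R c f d g (z₁ + z₂) ξ * boundaryWeight κ K f a g z₁ ξ
      * faceWeight κ R c b f a (z₁ - z₂) ξ = 0 := fun f g => by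
      by_contra h
      have w1 := hW (right_ne_zero_of_mul (left_ne_zero_of_mul (left_ne_zero_of_mul h)))
      have w2 := hW (right_ne_zero_of_mul h)
      exact hstep ⟨w2.2.2.1, w2.2.2.2, w1.2.1,
        (hB (left_ne_zero_of_mul (left_ne_zero_of_mul (left_ne_zero_of_mul h)))).1⟩
    simp only [hz, hz', finsum_zero]

end Heights

/-! ### Entries of R, unitarity, and the exchange, cross and determinant relations. -/

section EntryRelations

variable {q : ℝ}

/-- The entry of the dynamical `R`-matrix at `v₊ ⊗ v₊` up to a common factor. -/
def weightD (q : ℝ) (κ w : ℂ) : ℂ := Complex.exp (Real.log q * (2 * κ * w)) * bracket q (2 * κ - w)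

/-- The exchange entry of the dynamical `R`-matrix up to a common factor. -/
def weightB (q : ℝ) (κ x w : ℂ) : ℂ :=
  Complex.exp (Real.log q * (2 * x * w)) * (bracket q (2 * κ) * (bracket q (2 * x - w) / bracket q (2 * x)))

/-- The transmission entry of the dynamical `R`-matrix, up to a common factor, the gauge and the
bracket of the spectral parameter. -/
def weightA (q : ℝ) (κ x : ℂ) : ℂ :=
  -(Complex.exp (-(Real.log q * (4 * κ * x))) * (bracket q (2 * κ + 2 * x) / bracket q (2 * x)))

/-- The diagonal entry of the dynamical `K`-matrix up to a common factor. -/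
def diagonalFactor (q : ℝ) (C : ℂ) (p : BoundaryParams) (z y : ℂ) : ℂ :=
  Complex.exp (Real.log q * (2 * z * y)) * alphaFactor q C p z y

variable (hq0 : 0 < q)
include hq0

theorem KBa_eq (hq1 : q < 1) {C : ℂ} (hC : C ≠ 0)
    (hdup : ∀ x, bracket q (2 * x) = C * ∏ k, halfBracket q k x)
    {p : BoundaryParams} {z y : ℂ} (h : KBaDefined q p z y) :
    KBa q p z y = commonFactor q p z • !![diagonalFactor q C p z y, betaFactor q p y;
      betaFactor q p (-y), diagonalFactor q C p z (-y)] := by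
  rw [KBa, alphaBa_eq hq0 hq1 hC hdup h, alphaBa_eq hq0 hq1 hC hdup h.neg, betaBa_eq hq0 hq1 h,
    betaBa_eq hq0 hq1 h.neg, ofReal_cpow_eq_exp hq0, ofReal_cpow_eq_exp hq0]
  ext i j
  fin_cases i <;> fin_cases j <;> simp [diagonalFactor]

variable (hq1 : q < 1)
include hq1

theorem ABa_eq {κ w x : ℂ} (hx : bracket q (2 * x) ≠ 0) (hw : bracket q (2 * κ - w) ≠ 0) :
    ABa q κ w (2 * x) = bracket q w * weightA q κ x / weightD q κ w := by
  simp only [ABa, weightA, weightD, theta_cpow hq0, bracket_neg hq0 hq1 w]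
  have e : Complex.exp (-(Real.log q / 2 * ((-w) ^ 2 - -w)))
      * Complex.exp (-(Real.log q / 2 * ((2 * κ + 2 * x) ^ 2 - (2 * κ + 2 * x))))
      * Complex.exp (Real.log q * (2 * κ * w))
      = Complex.exp (-(Real.log q / 2 * ((2 * κ - w) ^ 2 - (2 * κ - w))))
      * Complex.exp (-(Real.log q / 2 * ((2 * x) ^ 2 - 2 * x)))
      * Complex.exp (-(Real.log q * (4 * κ * x))) := by
    simp only [← Complex.exp_add]
    congr 1
    ring
  rw [div_eq_div_iff (mul_ne_zero (mul_ne_zero (Complex.exp_ne_zero _) hw)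
    (mul_ne_zero (Complex.exp_ne_zero _) hx)) (mul_ne_zero (Complex.exp_ne_zero _) hw)]
  generalize Complex.exp (-(Real.log q * (4 * κ * x))) = E at e ⊢
  generalize bracket q (2 * x) = X at hx ⊢
  generalize Complex.exp (-(Real.log q / 2 * ((-w) ^ 2 - -w))) = E₁ at e ⊢
  generalize Complex.exp (-(Real.log q / 2 * ((2 * κ + 2 * x) ^ 2 - (2 * κ + 2 * x)))) = E₂ at e ⊢
  generalize Complex.exp (Real.log q * (2 * κ * w)) = E₃ at e ⊢
  generalize Complex.exp (-(Real.log q / 2 * ((2 * κ - w) ^ 2 - (2 * κ - w)))) = E₄ at e ⊢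
  generalize Complex.exp (-(Real.log q / 2 * ((2 * x) ^ 2 - 2 * x))) = E₅ at e ⊢
  generalize bracket q (2 * κ + 2 * x) = Y at ⊢
  field_simp
  linear_combination -(bracket q w * Y) * e

theorem BBa_eq {κ w x : ℂ} (hx : bracket q (2 * x) ≠ 0) (hw : bracket q (2 * κ - w) ≠ 0) :
    BBa q κ w (2 * x) = weightB q κ (-x) w / weightD q κ w := by
  have hx' : bracket q (2 * -x) ≠ 0 := by rwa [bracket_two_mul_neg hq0 hq1, neg_ne_zero]
  simp only [BBa, weightB, weightD, theta_cpow hq0]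
  rw [show -w - 2 * x = 2 * -x - w by ring, show -(2 * x) = 2 * -x by ring]
  have e : Complex.exp (-(Real.log q / 2 * ((2 * -x - w) ^ 2 - (2 * -x - w))))
      * Complex.exp (-(Real.log q / 2 * ((2 * κ) ^ 2 - 2 * κ)))
      * Complex.exp (Real.log q * (2 * κ * w))
      = Complex.exp (-(Real.log q / 2 * ((2 * κ - w) ^ 2 - (2 * κ - w))))
      * Complex.exp (-(Real.log q / 2 * ((2 * -x) ^ 2 - 2 * -x)))
      * Complex.exp (Real.log q * (2 * -x * w)) := by
    simp only [← Complex.exp_add]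
    congr 1
    ring
  rw [div_eq_div_iff (mul_ne_zero (mul_ne_zero (Complex.exp_ne_zero _) hw)
    (mul_ne_zero (Complex.exp_ne_zero _) hx')) (mul_ne_zero (Complex.exp_ne_zero _) hw)]
  generalize Complex.exp (-(Real.log q / 2 * ((2 * -x - w) ^ 2 - (2 * -x - w)))) = E₁ at e ⊢
  generalize Complex.exp (-(Real.log q / 2 * ((2 * κ) ^ 2 - 2 * κ))) = E₂ at e ⊢
  generalize Complex.exp (Real.log q * (2 * κ * w)) = E₃ at e ⊢
  generalize Complex.exp (-(Real.log q / 2 * ((2 * κ - w) ^ 2 - (2 * κ - w)))) = E₄ at e ⊢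
  generalize Complex.exp (-(Real.log q / 2 * ((2 * -x) ^ 2 - 2 * -x))) = E₅ at e ⊢
  generalize Complex.exp (Real.log q * (2 * -x * w)) = E₆ at e ⊢
  generalize bracket q (2 * -x) = X at hx' ⊢
  generalize bracket q (2 * -x - w) = Y at ⊢
  field_simp
  linear_combination (Y * bracket q (2 * κ)) * e

theorem R8vSOS_eq {κ w x : ℂ} (u : ℂ → ℂ) (hx : bracket q (2 * x) ≠ 0)
    (hw : bracket q (2 * κ - w) ≠ 0) :
    R8vSOS q κ u w (2 * x) = ((q : ℂ) ^ (w / 2) * (theta q ((q : ℂ) ^ (2 * κ - w))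
        / theta q ((q : ℂ) ^ (2 * κ))) / weightD q κ w) •
      !![weightD q κ w, 0, 0, 0;
        0, u (2 * x) * (bracket q w * weightA q κ x), weightB q κ (-x) w, 0;
        0, weightB q κ x w, u (-(2 * x)) * (bracket q w * weightA q κ (-x)), 0;
        0, 0, 0, weightD q κ w] := by
  have hx' : bracket q (2 * -x) ≠ 0 := by rwa [bracket_two_mul_neg hq0 hq1, neg_ne_zero]
  have hD : weightD q κ w ≠ 0 := mul_ne_zero (Complex.exp_ne_zero _) hw
  rw [R8vSOS, ABa_eq hq0 hq1 hx hw, BBa_eq hq0 hq1 hx hw, show -(2 * x) = 2 * -x by ring,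
    ABa_eq hq0 hq1 hx' hw, BBa_eq hq0 hq1 hx' hw, neg_neg]
  ext i j
  fin_cases i <;> fin_cases j <;> simp <;> field_simp

theorem weightB_neg (κ x w : ℂ) : weightB q κ (-x) w = weightB q κ x (-w) := by
  rw [weightB, weightB, bracket_two_mul_neg hq0 hq1,
    show 2 * -x - w = -(2 * x - -w) by ring, bracket_neg hq0 hq1, neg_div_neg_eq,
    show 2 * -x * w = 2 * x * -w by ring]

/-- The Weierstrass identity at (2κ, 2x, w, 0); the exponential prefactors cancel in pairs under w ↦
-w and x ↦ -x. -/
theorem weight_unitarity {κ x : ℂ} (hx : bracket q (2 * x) ≠ 0) (w : ℂ) :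
    weightB q κ x w * weightB q κ (-x) w - weightD q κ w * weightD q κ (-w)
      = weightA q κ x * weightA q κ (-x) * bracket q w ^ 2 := by
  have h := bracket_weierstrass hq0 hq1 (2 * κ) (2 * x) w 0
  simp only [add_zero, sub_zero] at h
  have e1 : Complex.exp (Real.log q * (2 * x * w)) * Complex.exp (Real.log q * (2 * x * -w)) = 1 := by
    rw [← Complex.exp_add, ← Complex.exp_zero]; congr 1; ring
  have e2 : Complex.exp (Real.log q * (2 * κ * w)) * Complex.exp (Real.log q * (2 * κ * -w)) = 1 := by
    rw [← Complex.exp_add, ← Complex.exp_zero]; congr 1; ring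
  have e3 : Complex.exp (-(Real.log q * (4 * κ * x))) * Complex.exp (-(Real.log q * (4 * κ * -x)))
      = 1 := by
    rw [← Complex.exp_add, ← Complex.exp_zero]; congr 1; ring
  have hB : weightB q κ x w * weightB q κ x (-w)
      = bracket q (2 * κ) ^ 2 * (bracket q (2 * x + w) * bracket q (2 * x - w)) / bracket q (2 * x) ^ 2 := by
    rw [weightB, weightB, sub_neg_eq_add]
    linear_combination (bracket q (2 * κ) ^ 2 * (bracket q (2 * x + w) * bracket q (2 * x - w))
      / bracket q (2 * x) ^ 2) * e1
  have hD : weightD q κ w * weightD q κ (-w) = bracket q (2 * κ + w) * bracket q (2 * κ - w) := by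
    rw [weightD, weightD, sub_neg_eq_add]
    linear_combination (bracket q (2 * κ + w) * bracket q (2 * κ - w)) * e2
  have hA : weightA q κ x * weightA q κ (-x)
      = -(bracket q (2 * κ + 2 * x) * bracket q (2 * κ - 2 * x)) / bracket q (2 * x) ^ 2 := by
    rw [weightA, weightA, bracket_two_mul_neg hq0 hq1, mul_neg 2 x, ← sub_eq_add_neg, div_neg]
    linear_combination -(bracket q (2 * κ + 2 * x) * bracket q (2 * κ - 2 * x)
      / bracket q (2 * x) ^ 2) * e3
  rw [weightB_neg hq0 hq1, hB, hD, hA, div_mul_eq_mul_div, eq_div_iff (pow_ne_zero 2 hx), sub_mul,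
    div_mul_cancel₀ _ (pow_ne_zero 2 hx)]
  linear_combination h

/-- The relation is linear in `alphaFactor`, so it is the sum of the kernel relations weighted by
coefficients free of z and of the dynamical variable. The factor q^(2zξ) in α_Ba gives every term
the same power q^(2κz₁ + 2xz₂), which factors out. -/
theorem diagonalFactor_exchange {C : ℂ}
    (hdup : ∀ x, bracket q (2 * x) = C * ∏ k, halfBracket q k x)
    (p : BoundaryParams) {κ x z₁ z₂ : ℂ}
    (hx : bracket q (2 * x) ≠ 0) (hadd : bracket q (2 * (x + κ)) ≠ 0)
    (hsub : bracket q (2 * (x - κ)) ≠ 0) (hz₁ : bracket q (2 * z₁) ≠ 0)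
    (hz₂ : bracket q (2 * z₂) ≠ 0) :
    bracket q (z₁ + z₂) * weightD q κ (z₁ - z₂) * diagonalFactor q C p z₂ (x + κ)
      = bracket q (z₁ - z₂) * (weightD q κ (z₁ + z₂) * diagonalFactor q C p z₂ (x - κ)
          + weightB q κ x (z₁ + z₂) * diagonalFactor q C p z₁ (-(x - κ)))
        + bracket q (z₁ + z₂) * weightB q κ (-x) (z₁ - z₂) * diagonalFactor q C p z₁ (x + κ) := by
  have key : bracket q (z₁ + z₂) * bracket q (2 * κ - (z₁ - z₂)) * alphaFactor q C p z₂ (x + κ)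
      = bracket q (z₁ - z₂) * (bracket q (2 * κ - (z₁ + z₂)) * alphaFactor q C p z₂ (x - κ)
          + bracket q (2 * κ) * (bracket q (2 * x - (z₁ + z₂)) / bracket q (2 * x))
            * alphaFactor q C p z₁ (-(x - κ)))
        + bracket q (z₁ + z₂) * (bracket q (2 * κ) * (bracket q (2 * x + (z₁ - z₂)) / bracket q (2 * x)))
          * alphaFactor q C p z₁ (x + κ) := by
    simp only [alphaFactor, mul_sum, ← sum_add_distrib]
    refine sum_congr rfl fun k _ => ?_
    linear_combination expansionCoeff q C p.vec k * kernel_exchange hq0 hq1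
      (isHalfPeriod_halfPeriod hq0 hq1 k) hx (bracket_add_halfPeriod_ne_zero hdup hadd k)
      (bracket_add_halfPeriod_ne_zero hdup hsub k) hz₁ hz₂
  rw [weightB_neg hq0 hq1]
  simp only [weightD, weightB, diagonalFactor, sub_neg_eq_add]
  have e0 : Complex.exp (Real.log q * (2 * κ * (z₁ - z₂)))
      * Complex.exp (Real.log q * (2 * z₂ * (x + κ)))
      = Complex.exp (Real.log q * (2 * κ * z₁ + 2 * x * z₂)) := by
    rw [← Complex.exp_add]; congr 1; ring
  have e1 : Complex.exp (Real.log q * (2 * κ * (z₁ + z₂)))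
      * Complex.exp (Real.log q * (2 * z₂ * (x - κ)))
      = Complex.exp (Real.log q * (2 * κ * z₁ + 2 * x * z₂)) := by
    rw [← Complex.exp_add]; congr 1; ring
  have e2 : Complex.exp (Real.log q * (2 * x * (z₁ + z₂)))
      * Complex.exp (Real.log q * (2 * z₁ * -(x - κ)))
      = Complex.exp (Real.log q * (2 * κ * z₁ + 2 * x * z₂)) := by
    rw [← Complex.exp_add]; congr 1; ring
  have e3 : Complex.exp (Real.log q * (2 * x * -(z₁ - z₂)))
      * Complex.exp (Real.log q * (2 * z₁ * (x + κ)))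
      = Complex.exp (Real.log q * (2 * κ * z₁ + 2 * x * z₂)) := by
    rw [← Complex.exp_add]; congr 1; ring
  generalize Complex.exp (Real.log q * (2 * κ * z₁ + 2 * x * z₂)) = E at e0 e1 e2 e3
  linear_combination E * key
    + (bracket q (z₁ + z₂) * bracket q (2 * κ - (z₁ - z₂)) * alphaFactor q C p z₂ (x + κ)) * e0
    - (bracket q (z₁ - z₂) * bracket q (2 * κ - (z₁ + z₂)) * alphaFactor q C p z₂ (x - κ)) * e1
    - (bracket q (z₁ - z₂) * (bracket q (2 * κ) * (bracket q (2 * x - (z₁ + z₂)) / bracket q (2 * x)))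
        * alphaFactor q C p z₁ (-(x - κ))) * e2
    - (bracket q (z₁ + z₂) * (bracket q (2 * κ) * (bracket q (2 * x + (z₁ - z₂)) / bracket q (2 * x)))
        * alphaFactor q C p z₁ (x + κ)) * e3

theorem continuousAt_diagonalFactor (C : ℂ) (p : BoundaryParams) {z : ℂ} (hz : bracket q (2 * z) ≠ 0)
    (y : ℂ) (hy : ∀ k, bracket q (y + halfPeriod q k) ≠ 0) :
    ContinuousAt (fun z => diagonalFactor q C p z y) z := by
  have hc := continuous_bracket hq0 hq1
  refine ContinuousAt.mul (by fun_prop) (tendsto_finsetSum _ fun k _ => ?_)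
  refine ContinuousAt.mul continuousAt_const (ContinuousAt.div ?_ ?_ (mul_ne_zero (hy k) hz))
  · exact (by fun_prop : Continuous fun z => Complex.exp (-2 * halfExponent k * z)
      * bracket q (y + halfPeriod q k - 2 * z)).continuousAt
  · exact (by fun_prop : Continuous fun z => bracket q (y + halfPeriod q k)
      * bracket q (2 * z)).continuousAt

/-- The exchange relation obtained from `diagonalFactor_exchange` by unitarity. -/
theorem diagonalFactor_cross {C : ℂ}
    (hdup : ∀ x, bracket q (2 * x) = C * ∏ k, halfBracket q k x)
    (p : BoundaryParams) {κ x z₁ z₂ : ℂ}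
    (hx : bracket q (2 * x) ≠ 0) (hadd : bracket q (2 * (x + κ)) ≠ 0)
    (hsub : bracket q (2 * (x - κ)) ≠ 0) (hz₁ : bracket q (2 * z₁) ≠ 0)
    (hz₂ : bracket q (2 * z₂) ≠ 0) :
    weightD q κ (z₁ - z₂) * (weightD q κ (z₁ + z₂) * diagonalFactor q C p z₁ (x - κ)
        + weightB q κ x (z₁ + z₂) * diagonalFactor q C p z₂ (-(x - κ)))
      = weightB q κ x (z₁ - z₂) * (weightD q κ (z₁ + z₂) * diagonalFactor q C p z₂ (x - κ)
          + weightB q κ x (z₁ + z₂) * diagonalFactor q C p z₁ (-(x - κ)))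
        + weightA q κ x * weightA q κ (-x) * bracket q (z₁ - z₂) * bracket q (z₁ + z₂)
          * diagonalFactor q C p z₁ (x + κ) := by
  have hsub' : bracket q (2 * -(x - κ)) ≠ 0 := by rwa [bracket_two_mul_neg hq0 hq1, neg_ne_zero]
  have hk₁ := bracket_add_halfPeriod_ne_zero hdup hadd
  have hk₂ := bracket_add_halfPeriod_ne_zero hdup hsub
  have hk₃ := bracket_add_halfPeriod_ne_zero hdup hsub'
  have hc := continuous_bracket hq0 hq1
  -- The derivation divides by [z₁ - z₂], which may vanish. It is carried out for z near z₁, and the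
  -- relation then passes to the limit by continuity.
  have hne : ∀ᶠ z in 𝓝[≠] z₁, bracket q (2 * z) ≠ 0 ∧ bracket q (z - z₂) ≠ 0 := by
    refine Eventually.and (eventually_nhdsWithin_of_eventually_nhds
      ((by fun_prop : Continuous fun z => bracket q (2 * z)).continuousAt.eventually_ne hz₁)) ?_
    have h := eventually_bracket_ne_zero hq0 hq1 (z₁ - z₂) one_ne_zero
    rw [eventually_nhdsWithin_iff] at h ⊢
    have ht : Tendsto (fun z => z - z₁) (𝓝 z₁) (𝓝 0) := by
      simpa using (continuous_sub_right z₁).tendsto z₁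
    filter_upwards [ht.eventually h] with z hz hzz
    have := hz (sub_ne_zero.mpr hzz)
    rwa [show z₁ - z₂ + (z - z₁) * 1 = z - z₂ by ring] at this
  have c₁ := (continuousAt_diagonalFactor hq0 hq1 C p hz₁ _ hk₁)
  have c₂ := (continuousAt_diagonalFactor hq0 hq1 C p hz₁ _ hk₂)
  have c₃ := (continuousAt_diagonalFactor hq0 hq1 C p hz₁ _ hk₃)
  have cD : Continuous fun w => weightD q κ w := by
    unfold weightD; fun_prop
  have cB : Continuous fun w => weightB q κ x w := by
    unfold weightB; fun_prop
  refine tendsto_nhds_unique_of_eventuallyEq (l := 𝓝[≠] z₁)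
    (f := fun z => weightD q κ (z - z₂) * (weightD q κ (z + z₂) * diagonalFactor q C p z (x - κ)
        + weightB q κ x (z + z₂) * diagonalFactor q C p z₂ (-(x - κ))))
    (g := fun z => weightB q κ x (z - z₂) * (weightD q κ (z + z₂) * diagonalFactor q C p z₂ (x - κ)
          + weightB q κ x (z + z₂) * diagonalFactor q C p z (-(x - κ)))
        + weightA q κ x * weightA q κ (-x) * bracket q (z - z₂) * bracket q (z + z₂)
          * diagonalFactor q C p z (x + κ)) ?_ ?_ ?_
  · exact tendsto_nhdsWithin_of_tendsto_nhds (ContinuousAt.tendsto (by fun_prop))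
  · exact tendsto_nhdsWithin_of_tendsto_nhds (ContinuousAt.tendsto (by fun_prop))
  · filter_upwards [hne] with z hz
    have h := diagonalFactor_exchange hq0 hq1 hdup p hx hadd hsub hz.1 hz₂
    have h' := diagonalFactor_exchange hq0 hq1 hdup p hx hadd hsub hz₂ hz.1
    have hu := weight_unitarity hq0 hq1 (κ := κ) hx (z - z₂)
    rw [weightB_neg hq0 hq1, add_comm z₂ z, ← neg_sub z z₂, neg_neg, bracket_neg hq0 hq1] at h'
    refine mul_left_cancel₀ hz.2 ?_
    -- The exchange relation and its swap are weighted so that the terms in `diagonalFactor` at (z₂,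
    -- x + κ) cancel. The coefficient left at (z, x + κ) is evaluated by unitarity.
    linear_combination weightB q κ x (z - z₂) * h + weightD q κ (z - z₂) * h'
      + bracket q (z + z₂) * diagonalFactor q C p z (x + κ) * hu

theorem diagonalFactor_det {C : ℂ} (hC : C ≠ 0)
    (hdup : ∀ x, bracket q (2 * x) = C * ∏ k, halfBracket q k x)
    {p : BoundaryParams} {z y : ℂ} (h : KBaDefined q p z y) :
    diagonalFactor q C p z y * diagonalFactor q C p z (-y) - betaFactor q p y * betaFactor q p (-y)
      = -(thetaQuotient q p.dual.vec z * thetaQuotient q p.dual.vec (-z)) := by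
  have e : Complex.exp (Real.log q * (2 * z * y)) * Complex.exp (Real.log q * (2 * z * -y)) = 1 := by
    rw [← Complex.exp_add, ← Complex.exp_zero]; congr 1; ring
  rw [← alphaFactor_mul_neg hq0 hq1 hC hdup h, diagonalFactor, diagonalFactor]
  linear_combination (alphaFactor q C p z y * alphaFactor q C p z (-y)) * e

end EntryRelations

end FaceModel

end

/-! ### Assembly of the boundary Yang–Baxter equation. -/

theorem corollary2p17 (q : ℝ) (hq0 : 0 < q) (hq1 : q < 1) (κ : ℂ)
    (u : ℂ → ℂ) (hu : FaceModel.IsSOSGauge q κ u)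
    (ζ ζ' υ υ' : ℂ) (a b c d e z₁ z₂ ξ : ℂ)
    (hR_sub : FaceModel.R8vSOSDefined q κ (z₁ - z₂) (ξ - 2 * κ * c))
    (hR_add : FaceModel.R8vSOSDefined q κ (z₁ + z₂) (ξ - 2 * κ * c))
    (hK₁ : ∀ f : ℂ, f = c + 1 ∨ f = c - 1 →
      FaceModel.KBaDefined q ⟨ζ, ζ', υ, υ'⟩ z₁ (ξ / 2 - κ * f))
    (hK₂ : ∀ f : ℂ, f = c + 1 ∨ f = c - 1 →
      FaceModel.KBaDefined q ⟨ζ, ζ', υ, υ'⟩ z₂ (ξ / 2 - κ * f)) :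
    FaceModel.BoundaryYangBaxter (FaceModel.W8vSOS q κ u)
      (FaceModel.B8vSOS q κ ⟨ζ, ζ', υ, υ'⟩) a b c d e z₁ z₂ ξ := by
  open FaceModel in
  obtain ⟨C, hC, hdup⟩ := exists_bracket_two_mul hq0 hq1
  set p : BoundaryParams := ⟨ζ, ζ', υ, υ'⟩
  obtain ⟨x, hxdef⟩ : ∃ x, ξ / 2 - κ * c = x := ⟨_, rfl⟩
  have eξ : ξ - 2 * κ * c = 2 * x := by linear_combination 2 * hxdef
  have e1 : ξ / 2 - κ * (c + 1) = x - κ := by linear_combination hxdef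
  have e2 : ξ / 2 - κ * (c + -1) = x + κ := by linear_combination hxdef
  have hK₁s := hK₁ _ (Or.inl rfl)
  have hK₂s := hK₂ _ (Or.inl rfl)
  have hK₁a := hK₁ (c + -1) (Or.inr (sub_eq_add_neg c 1).symm)
  have hK₂a := hK₂ (c + -1) (Or.inr (sub_eq_add_neg c 1).symm)
  rw [e1] at hK₁s hK₂s
  rw [e2] at hK₁a hK₂a
  rw [eξ] at hR_sub hR_add
  have hx : bracket q (2 * x) ≠ 0 := (theta_cpow_ne_zero_iff hq0).mp hR_sub.pos
  have hx' : bracket q (2 * -x) ≠ 0 := by rwa [bracket_two_mul_neg hq0 hq1, neg_ne_zero]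
  have hz₁ := (hK₁s.dual_pos.bracket_ne_zero hq0 hq1).1
  have hz₂ := (hK₂s.dual_pos.bracket_ne_zero hq0 hq1).1
  have hs := (hK₁s.num_pos.bracket_ne_zero hq0 hq1).1
  have ha := (hK₁a.num_pos.bracket_ne_zero hq0 hq1).1
  have es : -x + κ = -(x - κ) := by ring
  have ea : -x - κ = -(x + κ) := by ring
  have hs' : bracket q (2 * (-x + κ)) ≠ 0 := by
    rwa [es, bracket_two_mul_neg hq0 hq1, neg_ne_zero]
  have ha' : bracket q (2 * (-x - κ)) ≠ 0 := by
    rwa [ea, bracket_two_mul_neg hq0 hq1, neg_ne_zero]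
  have hex := diagonalFactor_exchange hq0 hq1 hdup p hx ha hs hz₁ hz₂
  -- The substitution x ↦ -x exchanges the roles of the heights c + 1 and c - 1 and of the two
  -- diagonal entries of K.
  have hex' := diagonalFactor_exchange hq0 hq1 hdup p hx' hs' ha' hz₁ hz₂
  have hcross := diagonalFactor_cross hq0 hq1 hdup p hx ha hs hz₁ hz₂
  have hcross' := diagonalFactor_cross hq0 hq1 hdup p hx' hs' ha' hz₁ hz₂
  rw [es, ea, neg_neg, neg_neg] at hex' hcross'
  have hgauge : u (2 * x) * u (-(2 * x)) = 1 := by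
    refine hu.mul_neg _ hR_sub.pos ?_ hR_sub.u_neg
    have h := (theta_cpow_ne_zero_iff hq0).mp hR_sub.u_pos
    rw [theta_cpow_ne_zero_iff hq0]
    rwa [show -(2 * x) - 2 * κ = -(2 * x + 2 * κ) by ring, bracket_neg hq0 hq1, neg_ne_zero] at h
  refine boundaryYangBaxter_of_entries
    (by rw [eξ]; exact R8vSOS_eq hq0 hq1 u hx ((theta_cpow_ne_zero_iff hq0).mp hR_sub.spectral))
    (by rw [eξ]; exact R8vSOS_eq hq0 hq1 u hx ((theta_cpow_ne_zero_iff hq0).mp hR_add.spectral))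
    (by rw [e1]; exact KBa_eq hq0 hq1 hC hdup hK₁s) (by rw [e2]; exact KBa_eq hq0 hq1 hC hdup hK₁a)
    (by rw [e1]; exact KBa_eq hq0 hq1 hC hdup hK₂s) (by rw [e2]; exact KBa_eq hq0 hq1 hC hdup hK₂a)
    hgauge hex hex'
    ((diagonalFactor_det hq0 hq1 hC hdup hK₂s).trans
      (diagonalFactor_det hq0 hq1 hC hdup hK₂a).symm) hcross ?_
  linear_combination hcross'
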